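/- Let $V$ be a set of $n$ elements. For a total order $\pi$ on $V$ and $B\subseteq V$, a tournament $G$ on $V$ is called $B$-imperfect with respect to $\pi$ if for all distinct $u,v\in V\setminus B$, $G$ has the arc $(u,v)$ if and only if $u$ comes before $v$ in $\pi$; $G$ is $b$-imperfect with respect to $\pi$ if it is $B$-imperfect for some $B$ with $|B|\le b$. For two sequences, $\mathrm{lcs}$ denotes the length of their longest common subsequence. There are constants $C$, $\kappa$ and a single randomized algorithm (a program of a word RAM with $w$-bit words, for any $w$ with $2^w\ge(n+\lceil 1/\varepsilon\rceil+1)^\kappa$, so that $w=O(\log(n+1/\varepsilon)+1)$ suffices, with unit-cost arithmetic, comparisons and memory access, unit-cost sampling of a uniformly random element of $\{0,\dots,v-1\}$ for a word $v$, and unit-cost queries to the arcs of a tournament $G$) with the following properties. It is given the number $n$, the integer $\lceil 1/\varepsilon\rceil$ for a real $\varepsilon>0$, and query access to a tournament $G$ on $V=\{0,\dots,n-1\}$; it is given neither $\pi$ nor $b$. For every $n$, every $\varepsilon>0$ and every tournament $G$ on $V$ it always halts and outputs an ordering $\tilde\pi$ of $V$. If $n\ge 2$, it always makes at most $C\,n\log^3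 n/\min(\varepsilon,1)^2$ queries and runs for at most $C\,n\log^3 n/\min(\varepsilon,1)^2$ steps (so both are $O(n\log^3 n/\varepsilon^2)$ for $\varepsilon\le 1$). For every total order $\pi$ on $V$ and every integer $b\ge 0$ such that $G$ is $b$-imperfect with respect to $\pi$, $$\mathbf{E}\bigl[\mathrm{lcs}(\pi,\tilde\pi)\bigr]\ \ge\ n-(3+\varepsilon)\,b .$$ -/

import Mathlib

namespace RobustSort

/-! ### Tournaments, orderings, imperfection, longest common subsequences -/

/-- A tournament: no loops, and exactly one arc between any two distinct vertices. -/
def IsTournament {V : Type*} (G : Digraph V) : Prop :=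
  (∀ u, ¬ G.Adj u u) ∧ ∀ u v, u ≠ v → (G.Adj u v ↔ ¬ G.Adj v u)

/-- A total order on `V`, written as the sequence of all elements of `V` in increasing order. -/
def IsOrdering {V : Type*} (l : List V) : Prop :=
  l.Nodup ∧ ∀ v, v ∈ l

/-- `u` comes strictly before `v` in the sequence `l`. -/
def Before {V : Type*} [DecidableEq V] (l : List V) (u v : V) : Prop :=
  l.idxOf u < l.idxOf v

/-- `G` represents `π` correctly on all pairs of distinct vertices outside `B`. -/
def IsImperfectOn {V : Type*} [DecidableEq V] (G : Digraph V) (π : List V) (B : Finset V) : Prop :=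
  ∀ u v, u ∉ B → v ∉ B → u ≠ v → (G.Adj u v ↔ Before π u v)

/-- `G` is `b`-imperfect with respect to `π`. -/
def IsImperfect {V : Type*} [DecidableEq V] (G : Digraph V) (π : List V) (b : ℕ) : Prop :=
  ∃ B : Finset V, B.card ≤ b ∧ IsImperfectOn G π B

/-- Length of a longest common subsequence of two sequences
(`List.Sublist` is the subsequence relation). -/
noncomputable def lcs {α : Type*} (xs ys : List α) : ℕ :=
  sSup {k | ∃ l : List α, l.Sublist xs ∧ l.Sublist ys ∧ l.length = k}

/-! ### A randomized word RAM with query access to a digraph on `{0, …, n-1}`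

Words are the natural numbers below `W`. A machine has finitely many registers and finitely many
word-addressed arrays (those that occur in its program). -/

/-- Arithmetic expressions over registers and array cells. -/
inductive Expr : Type
  | lit (k : ℕ)
  | reg (x : ℕ)
  | load (a : ℕ) (i : Expr)
  | add (e f : Expr)
  | sub (e f : Expr)
  | mul (e f : Expr)
  | div (e f : Expr)
  | mod (e f : Expr)
  | lt (e f : Expr)
  | eq (e f : Expr)

/-- Programs. -/
inductive Cmd : Type
  /-- register `x` := value of `e` -/
  | assign (x : ℕ) (e : Expr)
  /-- cell `i` of array `a` := value of `e` -/
  | store (a : ℕ) (i e : Expr)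
  /-- register `x` := a fresh uniformly random element of `{0, …, v-1}`, `v` the value of `e` -/
  | rand (x : ℕ) (e : Expr)
  /-- register `x` := `1` if there is an arc from (the value of) `e` to `f`, and `0` otherwise -/
  | query (x : ℕ) (e f : Expr)
  /-- sequential composition -/
  | seq (c d : Cmd)
  /-- run `c` if the value of `e` is nonzero, and `d` otherwise -/
  | ite (e : Expr) (c d : Cmd)
  /-- run `c` as long as the value of `e` is nonzero -/
  | loop (e : Expr) (c : Cmd)

/-- Machine state; `queries` counts the executed queries and is not accessible to the program. -/
structure State : Type where
  reg : ℕ → ℕ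
  mem : ℕ → ℕ → ℕ
  queries : ℕ

/-- Word arithmetic: sums and products wrap around at `W`, subtraction is cut off at `0`,
comparisons yield `0` or `1`. -/
def Expr.eval (W : ℕ) (s : State) : Expr → ℕ
  | .lit k => k % W
  | .reg x => s.reg x
  | .load a i => s.mem a (i.eval W s)
  | .add e f => (e.eval W s + f.eval W s) % W
  | .sub e f => e.eval W s - f.eval W s
  | .mul e f => (e.eval W s * f.eval W s) % W
  | .div e f => e.eval W s / f.eval W s
  | .mod e f => e.eval W s % f.eval W s
  | .lt e f => if e.eval W s < f.eval W s then 1 else 0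
  | .eq e f => if e.eval W s = f.eval W s then 1 else 0

def State.setReg (s : State) (x v : ℕ) : State :=
  { s with reg := Function.update s.reg x v }

def State.setMem (s : State) (a i v : ℕ) : State :=
  { s with mem := Function.update s.mem a (Function.update (s.mem a) i v) }

/-- The uniform distribution on `{0, …, v-1}`; the point mass at `0` if `v = 0`. -/
noncomputable def uniformBelow (v : ℕ) : PMF ℕ :=
  if h : v = 0 then PMF.pure 0
  else PMF.uniformOfFinset (Finset.range v) (Finset.nonempty_range_iff.mpr h)

open Classical in
/-- Answer to the query for the arc `(i, j)`; `0` if `i` or `j` is not the name of a vertex. -/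
noncomputable def answer {n : ℕ} (G : Digraph (Fin n)) (i j : ℕ) : ℕ :=
  if ∃ (hi : i < n) (hj : j < n), G.Adj ⟨i, hi⟩ ⟨j, hj⟩ then 1 else 0

/-- A configuration: the commands still to be executed (first one on top), and the state. -/
abbrev Config : Type := List Cmd × State

/-- One step of the machine. Each query, each random choice, each assignment and each test takes
one step. A configuration without remaining commands has halted and does not change any more. -/
noncomputable def step {n : ℕ} (W : ℕ) (G : Digraph (Fin n)) : Config → PMF Config
  | ([], s) => PMF.pure ([], s)
  | (.assign x e :: K, s) => PMF.pure (K, s.setReg x (e.eval W s))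
  | (.store a i e :: K, s) => PMF.pure (K, s.setMem a (i.eval W s) (e.eval W s))
  | (.rand x e :: K, s) => (uniformBelow (e.eval W s)).map fun v => (K, s.setReg x v)
  | (.query x e f :: K, s) =>
      PMF.pure (K, { s.setReg x (answer G (e.eval W s) (f.eval W s)) with
        queries := s.queries + 1 })
  | (.seq c d :: K, s) => PMF.pure (c :: d :: K, s)
  | (.ite e c d :: K, s) => PMF.pure (if e.eval W s ≠ 0 then (c :: K, s) else (d :: K, s))
  | (.loop e c :: K, s) =>
      PMF.pure (if e.eval W s ≠ 0 then (c :: .loop e c :: K, s) else (K, s))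

/-- Distribution of the configuration after `t` steps. -/
noncomputable def run {n : ℕ} (W : ℕ) (G : Digraph (Fin n)) : ℕ → Config → PMF Config
  | 0, c => PMF.pure c
  | t + 1, c => (step W G c).bind (run W G t)

/-- Initial configuration of the program `P`: register `0` holds the number `n` of vertices,
register `1` the accuracy parameter `m`, everything else is `0`. -/
def init (P : Cmd) (n m : ℕ) : Config :=
  ([P], { reg := fun x => if x = 0 then n else if x = 1 then m else 0
          mem := fun _ _ => 0
          queries := 0 })

/-- The program has come to its end. -/
def Halted (c : Config) : Prop := c.1 = []

/-- The output sequence: the first `n` cells of array `0`. -/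
def output (n : ℕ) (c : Config) : List ℕ :=
  (List.range n).map (c.2.mem 0)

/-- Expectation of `f` under the discrete distribution `p` (used for bounded `f`). -/
noncomputable def expect {α : Type*} (p : PMF α) (f : α → ℝ) : ℝ :=
  ∑' a, (p a).toReal * f a

end RobustSort

open RobustSort

/-!
The algorithm sorts the vertices twice. Merge sort comes first; it is exact on a transitive
tournament and settles the case `b = 0`, where no loss at all is allowed. The second sort is a
quicksort that does not trust its pivots. In the current segment it samples `F` random triples
`p, u, v`, and then `N` random pairs `u, v` for one random pivot `p`. As soon as some
`p → u → v → p` is a directed triangle, these three vertices are put aside; one of them is bad, so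
at most two good vertices are lost for each bad one. If there was no triangle, the segment is split
by the arcs at the last pivot. The first `F` triples make a split unlikely in a segment in which
most pivots would fail their test; in the other segments a split makes progress.

The loss is counted by a shrinking set of survivors, which are in the right order across segments
(`MainInv`), so that at the end they form a common subsequence of `π` and the output
(`card_le_lcs`). A good pivot misplaces no good vertex. A bad pivot for which `2 * j` vertices have
to be given up lies in at least `j ^ 2` directed triangles (`exists_misplaced`), so it passes the
test only with small probability if `j` is large. The expected loss is bounded by a potential
(`activePotential`). In a segment with `b` bad vertices among `len` it is `(2 + η) * b`, for the
triangles, plus `al * b * (1 + log len)`, from which the misplacements are paid, plus a term for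
segments whose depth is exhausted. A random pivot separates a random pair with probability at least
`1 / 3` (`card_div_three_le_sum_separation`), so splitting lowers the logarithmic term by a constant
fraction of `al * b` on average, and this pays for the misplacements by bad pivots. Hence the
potential does not increase in expectation (`expected_potential_le`), and the bad vertices themselves
and the potential at the beginning add up to at most `3 + 1 / m` for each bad vertex.

The machine is treated through `cost`, the expected value of a function of the final state, which is
infinite if the machine has not halted in time. A finite bound therefore contains termination within
the time bound, and it is composed along the program by the rules for `Runs` (for deterministic
parts) and `CostLE`. When all vertices are regarded as bad, the same bound shows that the output
is always an ordering, for every tournament.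
-/

namespace RobustSort

open scoped ENNReal

/-! ### Expected cost of a computation -/

variable {n : ℕ}

/-- Expected value of `g` on the final state when the machine runs for `t` steps from the given
configuration. A run that has not halted after `t` steps counts as infinite cost, so that a finite
bound on this quantity also certifies that the machine has almost surely halted. -/
noncomputable def cost (W : ℕ) (G : Digraph (Fin n)) (g : State → ℝ≥0∞) : ℕ → Config → ℝ≥0∞
  | 0, c => if c.1 = [] then g c.2 else ⊤
  | t + 1, c => ∑' c', step W G c c' * cost W G g t c'

theorem tsum_bind_mul {α β : Type*} (p : PMF α) (f : α → PMF β) (F : β → ℝ≥0∞) :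
    ∑' b, (p.bind f) b * F b = ∑' a, p a * ∑' b, f a b * F b := by
  simp_rw [PMF.bind_apply, ← ENNReal.tsum_mul_right, ← ENNReal.tsum_mul_left, mul_assoc]
  exact ENNReal.tsum_comm

theorem tsum_pure_mul {α : Type*} (a : α) (F : α → ℝ≥0∞) :
    ∑' b, (PMF.pure a) b * F b = F a := by
  rw [tsum_eq_single a]
  · simp
  · intro b hb
    simp [PMF.pure_apply, hb]

theorem tsum_map_mul {α β : Type*} (p : PMF α) (f : α → β) (F : β → ℝ≥0∞) :
    ∑' b, (p.map f) b * F b = ∑' a, p a * F (f a) := by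
  rw [← PMF.bind_pure_comp, tsum_bind_mul]
  simp

theorem cost_eq_tsum_run (W : ℕ) (G : Digraph (Fin n)) (g : State → ℝ≥0∞) (t : ℕ) (c : Config) :
    cost W G g t c = ∑' c', run W G t c c' * (if c'.1 = [] then g c'.2 else ⊤) := by
  induction t generalizing c with
  | zero => simp only [run, tsum_pure_mul, cost]
  | succ t ih => simp only [run, cost, tsum_bind_mul, ih]

theorem cost_succ_of_step {W : ℕ} {G : Digraph (Fin n)} {c c' : Config}
    (h : step W G c = PMF.pure c') (g : State → ℝ≥0∞) (t : ℕ) :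
    cost W G g (t + 1) c = cost W G g t c' := by
  simp only [cost, h, tsum_pure_mul]

theorem cost_succ_le (W : ℕ) (G : Digraph (Fin n)) (g : State → ℝ≥0∞) (t : ℕ) (c : Config) :
    cost W G g (t + 1) c ≤ cost W G g t c := by
  induction t generalizing c with
  | zero =>
    obtain ⟨K, s⟩ := c
    cases K with
    | nil => rw [cost_succ_of_step (c' := ([], s)) (by simp [step])]
    | cons d K => simp [cost]
  | succ t ih =>
    rw [cost, cost]
    exact ENNReal.tsum_le_tsum fun c' => mul_le_mul_right (ih c') _

theorem cost_anti {W : ℕ} {G : Digraph (Fin n)} (g : State → ℝ≥0∞) (c : Config) {t t' : ℕ}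
    (h : t ≤ t') : cost W G g t' c ≤ cost W G g t c := by
  induction h with
  | refl => exact le_rfl
  | step _ ih => exact (cost_succ_le _ _ _ _ _).trans ih

/-- Every query takes a step. -/
theorem queries_le_of_mem_support_run {W : ℕ} {G : Digraph (Fin n)} {t : ℕ} {c c' : Config}
    (h : c' ∈ (run W G t c).support) : c'.2.queries ≤ c.2.queries + t := by
  induction t generalizing c with
  | zero =>
    simp only [run, PMF.support_pure, Set.mem_singleton_iff] at h
    simp [h]
  | succ t ih =>
    simp only [run, PMF.mem_support_bind_iff] at h
    obtain ⟨c₁, h₁, h₂⟩ := h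
    have key : c₁.2.queries ≤ c.2.queries + 1 := by
      obtain ⟨K, s⟩ := c
      match K with
      | [] => simp [step] at h₁; simp [h₁]
      | .assign x e :: K => simp [step] at h₁; simp [h₁, State.setReg]
      | .store a i e :: K => simp [step] at h₁; simp [h₁, State.setMem]
      | .rand x e :: K =>
        simp only [step, PMF.support_map, Set.mem_image] at h₁
        obtain ⟨v, -, rfl⟩ := h₁
        simp [State.setReg]
      | .query x e f :: K => simp [step] at h₁; simp [h₁]
      | .seq d e :: K => simp [step] at h₁; simp [h₁]
      | .ite e d f :: K =>
        simp only [step, PMF.support_pure, Set.mem_singleton_iff] at h₁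
        rw [h₁]; split <;> simp
      | .loop e d :: K =>
        simp only [step, PMF.support_pure, Set.mem_singleton_iff] at h₁
        rw [h₁]; split <;> simp
    have := ih h₂
    omega

/-- `c` leads from `s` to `s'` deterministically, in at most `k` steps. -/
def Runs (W : ℕ) (G : Digraph (Fin n)) (k : ℕ) (c : Cmd) (s s' : State) : Prop :=
  ∀ g K t, cost W G g (t + k) (c :: K, s) ≤ cost W G g t (K, s')

section

variable {W : ℕ} {G : Digraph (Fin n)}

theorem Runs.mono {k k' : ℕ} {c : Cmd} {s s' : State} (h : Runs W G k c s s') (hk : k ≤ k') :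
    Runs W G k' c s s' := fun g K t =>
  (cost_anti g _ (by omega)).trans (h g K t)

theorem Runs.of_step {c : Cmd} {s s' : State}
    (h : ∀ K, step W G (c :: K, s) = PMF.pure (K, s')) : Runs W G 1 c s s' := fun g K t =>
  (cost_succ_of_step (h K) g t).le

theorem Runs.seq {k₁ k₂ : ℕ} {c d : Cmd} {s s₁ s₂ : State} (h₁ : Runs W G k₁ c s s₁)
    (h₂ : Runs W G k₂ d s₁ s₂) : Runs W G (k₁ + k₂ + 1) (.seq c d) s s₂ := fun g K t => by
  rw [← add_assoc, cost_succ_of_step (c' := (c :: d :: K, s)) (by simp [step]),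
    show t + (k₁ + k₂) = t + k₂ + k₁ by ring]
  exact (h₁ g _ _).trans (h₂ g _ _)

theorem Runs.ite_true {k : ℕ} {e : Expr} {c d : Cmd} {s s' : State} (he : e.eval W s ≠ 0)
    (h : Runs W G k c s s') : Runs W G (k + 1) (.ite e c d) s s' := fun g K t => by
  rw [← add_assoc, cost_succ_of_step (c' := (c :: K, s)) (by simp [step, he])]
  exact h g _ _

theorem Runs.ite_false {k : ℕ} {e : Expr} {c d : Cmd} {s s' : State} (he : e.eval W s = 0)
    (h : Runs W G k d s s') : Runs W G (k + 1) (.ite e c d) s s' := fun g K t => by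
  rw [← add_assoc, cost_succ_of_step (c' := (d :: K, s)) (by simp [step, he])]
  exact h g _ _

theorem Runs.loop_done {e : Expr} {c : Cmd} {s : State} (he : e.eval W s = 0) :
    Runs W G 1 (.loop e c) s s := fun g K t => by
  rw [cost_succ_of_step (c' := (K, s)) (by simp [step, he])]

theorem Runs.loop_step {k k' : ℕ} {e : Expr} {c : Cmd} {s s₁ s₂ : State} (he : e.eval W s ≠ 0)
    (h : Runs W G k c s s₁) (h' : Runs W G k' (.loop e c) s₁ s₂) :
    Runs W G (k + k' + 1) (.loop e c) s s₂ := fun g K t => by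
  rw [← add_assoc, cost_succ_of_step (c' := (c :: .loop e c :: K, s)) (by simp [step, he]),
    show t + (k + k') = t + k' + k by ring]
  exact (h g _ _).trans (h' g _ _)

/-- A loop with a given number `N` of iterations, each of which advances the invariant `I`. -/
theorem Runs.for_loop {k : ℕ} {e : Expr} {c : Cmd} (I : ℕ → State → Prop) (N : ℕ)
    (hstep : ∀ j < N, ∀ s, I j s → e.eval W s ≠ 0 ∧ ∃ s', Runs W G k c s s' ∧ I (j + 1) s')
    (hdone : ∀ s, I N s → e.eval W s = 0) {s : State} (hs : I 0 s) :
    ∃ s', Runs W G (N * (k + 1) + 1) (.loop e c) s s' ∧ I N s' := by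
  suffices H : ∀ r j, j + r = N → ∀ s, I j s →
      ∃ s', Runs W G (r * (k + 1) + 1) (.loop e c) s s' ∧ I N s' from H N 0 (by omega) s hs
  intro r
  induction r with
  | zero =>
    intro j hj s hs
    obtain rfl : j = N := by omega
    exact ⟨s, by simpa using Runs.loop_done (hdone s hs), hs⟩
  | succ r ih =>
    intro j hj s hs
    obtain ⟨he, s₁, h₁, hs₁⟩ := hstep j (by omega) s hs
    obtain ⟨s₂, h₂, hs₂⟩ := ih (j + 1) (by omega) s₁ hs₁
    refine ⟨s₂, (Runs.loop_step he h₁ h₂).mono (le_of_eq ?_), hs₂⟩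
    ring

end

/-- Commands without loops and random choices. -/
def Cmd.Straight : Cmd → Prop
  | .assign _ _ => True
  | .store _ _ _ => True
  | .rand _ _ => False
  | .query _ _ _ => True
  | .seq c d => c.Straight ∧ d.Straight
  | .ite _ c d => c.Straight ∧ d.Straight
  | .loop _ _ => False

/-- An upper bound for the running time of a straight command. -/
def Cmd.size : Cmd → ℕ
  | .seq c d => c.size + d.size + 1
  | .ite _ c d => max c.size d.size + 1
  | _ => 1

/-- The effect of a straight command (a loop or a random choice is skipped). -/
noncomputable def Cmd.exec (W : ℕ) (G : Digraph (Fin n)) : Cmd → State → State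
  | .assign x e, s => s.setReg x (e.eval W s)
  | .store a i e, s => s.setMem a (i.eval W s) (e.eval W s)
  | .rand _ _, s => s
  | .query x e f, s =>
      { s.setReg x (answer G (e.eval W s) (f.eval W s)) with queries := s.queries + 1 }
  | .seq c d, s => d.exec W G (c.exec W G s)
  | .ite e c d, s => if e.eval W s ≠ 0 then c.exec W G s else d.exec W G s
  | .loop _ _, s => s

theorem runs_exec {W : ℕ} {G : Digraph (Fin n)} {c : Cmd} (hc : c.Straight) (s : State) :
    Runs W G c.size c s (c.exec W G s) := by
  induction c generalizing s with
  | assign x e => exact Runs.of_step fun K => by simp [step, Cmd.exec]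
  | store a i e => exact Runs.of_step fun K => by simp [step, Cmd.exec]
  | rand x e => exact hc.elim
  | query x e f => exact Runs.of_step fun K => by simp [step, Cmd.exec]
  | seq c d hc' hd' => exact (hc' hc.1 s).seq (hd' hc.2 _)
  | ite e c d hc' hd' =>
    by_cases he : e.eval W s = 0
    · simpa [Cmd.exec, Cmd.size, he] using
        Runs.ite_false (c := c) he ((hd' hc.2 s).mono (le_max_right c.size d.size))
    · simpa [Cmd.exec, Cmd.size, he] using
        Runs.ite_true (d := d) he ((hc' hc.1 s).mono (le_max_left c.size d.size))
  | loop e c _ => exact hc.elim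

theorem runs_exec_of_size_le {W : ℕ} {G : Digraph (Fin n)} {c : Cmd} {k : ℕ} (s : State)
    (hc : c.Straight) (hk : c.size ≤ k) : Runs W G k c s (c.exec W G s) :=
  (runs_exec hc s).mono hk

/-- The expected cost of running the configuration `c` for `t` steps is at most the real
number `ℓ`. -/
def CostLE (W : ℕ) (G : Digraph (Fin n)) (g : State → ℝ≥0∞) (t : ℕ) (c : Config) (ℓ : ℝ) : Prop :=
  0 ≤ ℓ ∧ cost W G g t c ≤ ENNReal.ofReal ℓ

section

variable {W : ℕ} {G : Digraph (Fin n)} {g : State → ℝ≥0∞}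

theorem CostLE.mono {t t' : ℕ} {c : Config} {ℓ ℓ' : ℝ} (h : CostLE W G g t c ℓ) (ht : t ≤ t')
    (hℓ : ℓ ≤ ℓ') : CostLE W G g t' c ℓ' :=
  ⟨h.1.trans hℓ, (cost_anti g c ht).trans (h.2.trans (ENNReal.ofReal_le_ofReal hℓ))⟩

theorem CostLE.of_runs {k t : ℕ} {c : Cmd} {s s' : State} {K : List Cmd} {ℓ : ℝ}
    (hr : Runs W G k c s s') (h : CostLE W G g t (K, s') ℓ) :
    CostLE W G g (t + k) (c :: K, s) ℓ :=
  ⟨h.1, (hr g K t).trans h.2⟩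

theorem CostLE.of_step {t : ℕ} {c c' : Config} {ℓ : ℝ} (hs : step W G c = PMF.pure c')
    (h : CostLE W G g t c' ℓ) : CostLE W G g (t + 1) c ℓ :=
  ⟨h.1, (cost_succ_of_step hs g t).le.trans h.2⟩

theorem CostLE.seq {t : ℕ} {c d : Cmd} {K : List Cmd} {s : State} {ℓ : ℝ}
    (h : CostLE W G g t (c :: d :: K, s) ℓ) : CostLE W G g (t + 1) (.seq c d :: K, s) ℓ :=
  h.of_step (by simp [step])

theorem CostLE.ite_true {t : ℕ} {e : Expr} {c d : Cmd} {K : List Cmd} {s : State} {ℓ : ℝ}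
    (he : e.eval W s ≠ 0) (h : CostLE W G g t (c :: K, s) ℓ) :
    CostLE W G g (t + 1) (.ite e c d :: K, s) ℓ :=
  h.of_step (by simp [step, he])

theorem CostLE.ite_false {t : ℕ} {e : Expr} {c d : Cmd} {K : List Cmd} {s : State} {ℓ : ℝ}
    (he : e.eval W s = 0) (h : CostLE W G g t (d :: K, s) ℓ) :
    CostLE W G g (t + 1) (.ite e c d :: K, s) ℓ :=
  h.of_step (by simp [step, he])

theorem CostLE.loop_done {t : ℕ} {e : Expr} {c : Cmd} {K : List Cmd} {s : State} {ℓ : ℝ}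
    (he : e.eval W s = 0) (h : CostLE W G g t (K, s) ℓ) :
    CostLE W G g (t + 1) (.loop e c :: K, s) ℓ :=
  h.of_step (by simp [step, he])

theorem CostLE.loop_step {t : ℕ} {e : Expr} {c : Cmd} {K : List Cmd} {s : State} {ℓ : ℝ}
    (he : e.eval W s ≠ 0) (h : CostLE W G g t (c :: .loop e c :: K, s) ℓ) :
    CostLE W G g (t + 1) (.loop e c :: K, s) ℓ :=
  h.of_step (by simp [step, he])

theorem CostLE.rand {t : ℕ} {x : ℕ} {e : Expr} {K : List Cmd} {s : State} {v : ℕ}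
    (hv : e.eval W s = v) (hv0 : 0 < v) {ℓ : ℕ → ℝ}
    (h : ∀ i < v, CostLE W G g t (K, s.setReg x i) (ℓ i)) :
    CostLE W G g (t + 1) (.rand x e :: K, s) ((∑ i ∈ Finset.range v, ℓ i) / v) := by
  refine ⟨div_nonneg (Finset.sum_nonneg fun i hi => (h i (Finset.mem_range.1 hi)).1) (by simp), ?_⟩
  have hne : v ≠ 0 := hv0.ne'
  have hu : ∀ i, uniformBelow v i = if i ∈ Finset.range v then (v : ℝ≥0∞)⁻¹ else 0 := by
    intro i
    simp [uniformBelow, hne, PMF.uniformOfFinset_apply]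
  rw [cost]
  simp only [step, hv, tsum_map_mul, hu]
  rw [tsum_eq_sum (s := Finset.range v) (fun i hi => by simp [hi])]
  rw [ENNReal.ofReal_div_of_pos (by exact_mod_cast hv0),
    ENNReal.ofReal_sum_of_nonneg fun i hi => (h i (Finset.mem_range.1 hi)).1, div_eq_mul_inv,
    ENNReal.ofReal_natCast, mul_comm, Finset.mul_sum]
  refine Finset.sum_le_sum fun i hi => ?_
  rw [if_pos hi]
  gcongr
  exact (h i (Finset.mem_range.1 hi)).2

end

end RobustSort

namespace RobustSort

open scoped ENNReal

/-! ### Slices of arrays -/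

/-- The values of `a` at the positions `lo, …, hi - 1`. -/
def slice (a : ℕ → ℕ) (lo hi : ℕ) : List ℕ := (List.Ico lo hi).map a

@[simp] theorem slice_self (a : ℕ → ℕ) (lo : ℕ) : slice a lo lo = [] := by simp [slice]

theorem slice_succ (a : ℕ → ℕ) {lo k : ℕ} (h : lo ≤ k) :
    slice a lo (k + 1) = slice a lo k ++ [a k] := by
  simp [slice, List.Ico.succ_top h]

theorem slice_cons (a : ℕ → ℕ) {lo hi : ℕ} (h : lo < hi) :
    slice a lo hi = a lo :: slice a (lo + 1) hi := by
  simp [slice, List.Ico.eq_cons h]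

theorem slice_append (a : ℕ → ℕ) {lo mid hi : ℕ} (h : lo ≤ mid) (h' : mid ≤ hi) :
    slice a lo mid ++ slice a mid hi = slice a lo hi := by
  rw [slice, slice, slice, ← List.map_append, List.Ico.append_consecutive h h']

theorem slice_congr {a b : ℕ → ℕ} {lo hi : ℕ} (h : ∀ i, lo ≤ i → i < hi → a i = b i) :
    slice a lo hi = slice b lo hi :=
  List.map_congr_left fun i hi' => h i (List.Ico.mem.1 hi').1 (List.Ico.mem.1 hi').2

@[simp] theorem length_slice (a : ℕ → ℕ) (lo hi : ℕ) : (slice a lo hi).length = hi - lo := by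
  simp [slice]

theorem mem_slice {a : ℕ → ℕ} {lo hi x : ℕ} :
    x ∈ slice a lo hi ↔ ∃ i, lo ≤ i ∧ i < hi ∧ a i = x := by
  simp [slice, List.Ico.mem, and_assoc]

theorem getElem_slice (a : ℕ → ℕ) (lo hi i : ℕ) (h : i < (slice a lo hi).length) :
    (slice a lo hi)[i] = a (lo + i) := by
  simp [slice, List.Ico]

theorem slice_pairwise {a : ℕ → ℕ} {lo hi : ℕ} {r : ℕ → ℕ → Prop} :
    (slice a lo hi).Pairwise r ↔ ∀ x y, lo ≤ x → x < y → y < hi → r (a x) (a y) := by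
  rw [List.pairwise_iff_getElem]
  constructor
  · intro h x y hx hxy hy
    have := h (x - lo) (y - lo) (by simp; omega) (by simp; omega) (by omega)
    simp only [getElem_slice] at this
    rwa [show lo + (x - lo) = x by omega, show lo + (y - lo) = y by omega] at this
  · intro h i j hi hj hij
    simp only [getElem_slice]
    simp only [length_slice] at hi hj
    exact h _ _ (by omega) (by omega) (by omega)

theorem slice_eq_of_forall_getElem {a : ℕ → ℕ} {lo hi : ℕ} {l : List ℕ} (hl : l.length = hi - lo)
    (h : ∀ i (hi : i < l.length), a (lo + i) = l[i]) : slice a lo hi = l := by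
  apply List.ext_getElem (by simp [hl])
  intro i h₁ h₂
  rw [getElem_slice, h i h₂]

/-! ### States that differ in few places -/

/-- `s'` agrees with `s` except for the registers in `R` and the arrays in `A`. -/
def Same (R A : List ℕ) (s s' : State) : Prop :=
  (∀ x ∉ R, s'.reg x = s.reg x) ∧ ∀ a ∉ A, s'.mem a = s.mem a

theorem Same.refl (R A : List ℕ) (s : State) : Same R A s s := ⟨fun _ _ => rfl, fun _ _ => rfl⟩

theorem Same.trans {R A : List ℕ} {s s' s'' : State} (h : Same R A s s') (h' : Same R A s' s'') :
    Same R A s s'' :=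
  ⟨fun x hx => (h'.1 x hx).trans (h.1 x hx), fun a ha => (h'.2 a ha).trans (h.2 a ha)⟩

theorem Same.mono {R A R' A' : List ℕ} {s s' : State} (h : Same R A s s') (hR : R ⊆ R')
    (hA : A ⊆ A') : Same R' A' s s' :=
  ⟨fun x hx => h.1 x fun h => hx (hR h), fun a ha => h.2 a fun h => ha (hA h)⟩

theorem State.setReg_reg (s : State) (x v y : ℕ) :
    (s.setReg x v).reg y = if y = x then v else s.reg y := by
  simp [State.setReg, Function.update_apply]

theorem State.setReg_mem (s : State) (x v : ℕ) : (s.setReg x v).mem = s.mem := rfl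

theorem State.setMem_reg (s : State) (a i v : ℕ) : (s.setMem a i v).reg = s.reg := rfl

theorem State.setMem_mem (s : State) (a i v b j : ℕ) :
    (s.setMem a i v).mem b j = if b = a ∧ j = i then v else s.mem b j := by
  simp only [State.setMem, Function.update_apply]
  by_cases hb : b = a <;> by_cases hj : j = i <;> simp [hb, hj]

theorem Same.setReg {R A : List ℕ} {s s' : State} (h : Same R A s s') {x v : ℕ} (hx : x ∈ R) :
    Same R A s (s'.setReg x v) :=
  ⟨fun y hy => by
    rw [State.setReg_reg, if_neg (by rintro rfl; exact hy hx), h.1 y hy], h.2⟩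

theorem Same.setMem {R A : List ℕ} {s s' : State} (h : Same R A s s') {a i v : ℕ} (ha : a ∈ A) :
    Same R A s (s'.setMem a i v) :=
  ⟨h.1, fun b hb => by
    funext j
    rw [State.setMem_mem, if_neg (by rintro ⟨rfl, -⟩; exact hb ha), h.2 b hb]⟩

theorem Same.query {R A : List ℕ} {s s' : State} (h : Same R A s s') {q : ℕ} :
    Same R A s { s' with queries := q } := h

/-! ### The program -/

/-!
Registers: `0` number `n` of vertices, `1` accuracy `m`, `2` number of sorting passes plus one,
`3` block width, `4`, `5`, `6` bounds `lo`, `mid`, `hi` of segments, `7`, `8`, `9` loop counters,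
`10` flags and answers, `11` pivot vertex, `12`, `13` sample sizes, `14` remaining depth,
`15`, `16`, `17` sampled positions, `18` scratch.

Arrays: `0` the current ordering, `1` scratch, `2` and `3` right end and remaining depth of the
segment that begins at a given position.
-/

/-- Copy the segment from the scratch array to the ordering. -/
def copyBack : Cmd :=
  .seq (.assign 7 (.reg 4))
    (.loop (.lt (.reg 7) (.reg 6))
      (.seq (.store 0 (.reg 7) (.load 1 (.reg 7))) (.assign 7 (.add (.reg 7) (.lit 1)))))

/-- Move the smaller head of the two blocks to the scratch array. -/
def mergeStep : Cmd :=
  .seq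
    (.ite (.lt (.reg 7) (.reg 5))
      (.ite (.lt (.reg 8) (.reg 6))
        (.query 10 (.load 0 (.reg 8)) (.load 0 (.reg 7)))
        (.assign 10 (.lit 0)))
      (.assign 10 (.lit 1)))
    (.seq
      (.ite (.reg 10)
        (.seq (.store 1 (.reg 9) (.load 0 (.reg 8))) (.assign 8 (.add (.reg 8) (.lit 1))))
        (.seq (.store 1 (.reg 9) (.load 0 (.reg 7))) (.assign 7 (.add (.reg 7) (.lit 1)))))
      (.assign 9 (.add (.reg 9) (.lit 1))))

/-- Merge the adjacent blocks `[lo, mid)` and `[mid, hi)`. -/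
def mergeBlock : Cmd :=
  .seq
    (.seq (.assign 7 (.reg 4))
      (.seq (.assign 8 (.reg 5))
        (.seq (.assign 9 (.reg 4))
          (.loop (.lt (.reg 9) (.reg 6)) mergeStep))))
    copyBack

section

variable {n : ℕ} {W : ℕ} {G : Digraph (Fin n)}

theorem copyBack_runs {s : State} (hle : s.reg 4 ≤ s.reg 6) (hW : s.reg 6 < W) :
    ∃ s', Runs W G ((s.reg 6 - s.reg 4) * 4 + 3) copyBack s s' ∧ Same [7] [0] s s' ∧
      ∀ i, s'.mem 0 i = if s.reg 4 ≤ i ∧ i < s.reg 6 then s.mem 1 i else s.mem 0 i := by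
  obtain ⟨s', hs', h⟩ := Runs.for_loop (W := W) (G := G) (k := 3)
    (e := .lt (.reg 7) (.reg 6))
    (c := .seq (.store 0 (.reg 7) (.load 1 (.reg 7))) (.assign 7 (.add (.reg 7) (.lit 1))))
    (fun j s' => Same [7] [0] s s' ∧ s'.reg 7 = s.reg 4 + j ∧
      ∀ i, s'.mem 0 i = if s.reg 4 ≤ i ∧ i < s.reg 4 + j then s.mem 1 i else s.mem 0 i)
    (s.reg 6 - s.reg 4)
    (by
      rintro j hj s' ⟨hS, h7, hm⟩
      have h6 := hS.1 6 (by simp)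
      refine ⟨by simp [Expr.eval, h7, h6]; omega, _, runs_exec_of_size_le s' (by simp [Cmd.Straight]) (by simp [Cmd.size]), ?_⟩
      have e1 : (s.reg 4 + j + 1 % W) % W = s.reg 4 + j + 1 := by
        rw [Nat.mod_eq_of_lt (a := 1) (by omega), Nat.mod_eq_of_lt (by omega)]
      simp only [Cmd.exec, Expr.eval, State.setMem_reg, h7, e1]
      refine ⟨(hS.setMem (by simp)).setReg (by simp), by simp [State.setReg_reg]; ring, ?_⟩
      intro i
      rw [State.setReg_mem, State.setMem_mem, hm, hS.2 1 (by simp)]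
      by_cases hi : i = s.reg 4 + j
      · simp [hi]
      · have : (s.reg 4 ≤ i ∧ i < s.reg 4 + (j + 1)) ↔ (s.reg 4 ≤ i ∧ i < s.reg 4 + j) := by omega
        simp [hi, this])
    (by
      rintro s' ⟨hS, h7, -⟩
      have h6 := hS.1 6 (by simp)
      simp [Expr.eval, h7, h6]; omega)
    (s := s.setReg 7 (s.reg 4))
    ⟨(Same.refl _ _ _).setReg (by simp), by simp [State.setReg_reg], fun i => by
      rw [if_neg (by omega)]; rfl⟩
  refine ⟨s', ((runs_exec (c := .assign 7 (.reg 4)) trivial s).seq hs').mono ?_, h.1, ?_⟩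
  · simp [Cmd.size]; omega
  · rw [show s.reg 6 = s.reg 4 + (s.reg 6 - s.reg 4) by omega]
    exact h.2.2

theorem mergeBlock_runs {s : State} {le : ℕ → ℕ → Bool} (h45 : s.reg 4 ≤ s.reg 5)
    (h56 : s.reg 5 ≤ s.reg 6) (hW : s.reg 6 < W)
    (hle : ∀ i j, s.reg 4 ≤ i → i < s.reg 6 → s.reg 4 ≤ j → j < s.reg 6 →
      (le (s.mem 0 i) (s.mem 0 j) = true ↔ answer G (s.mem 0 j) (s.mem 0 i) = 0)) :
    ∃ s', Runs W G ((s.reg 6 - s.reg 4) * 20 + 20) mergeBlock s s' ∧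
      Same [7, 8, 9, 10] [0, 1] s s' ∧
      slice (s'.mem 0) (s.reg 4) (s.reg 6) =
        List.merge (slice (s.mem 0) (s.reg 4) (s.reg 5))
          (slice (s.mem 0) (s.reg 5) (s.reg 6)) le ∧
      ∀ i, ¬ (s.reg 4 ≤ i ∧ i < s.reg 6) → s'.mem 0 i = s.mem 0 i := by
  set lo := s.reg 4 with hlo
  set mid := s.reg 5 with hmid
  set hi := s.reg 6 with hhi
  set A := s.mem 0 with hA
  let I : ℕ → State → Prop := fun t s' => Same [7, 8, 9, 10] [1] s s' ∧ s'.reg 9 = lo + t ∧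
    ∃ i j, s'.reg 7 = i ∧ s'.reg 8 = j ∧ lo ≤ i ∧ i ≤ mid ∧ mid ≤ j ∧ j ≤ hi ∧
      i + j = lo + mid + t ∧
      slice (s'.mem 1) lo (lo + t) ++ List.merge (slice A i mid) (slice A j hi) le =
        List.merge (slice A lo mid) (slice A mid hi) le
  have e0 : 0 < hi → 0 % W = 0 := fun _ => Nat.mod_eq_of_lt (by omega)
  have e1 : ∀ x, x < hi → (x + 1 % W) % W = x + 1 := fun x hx => by
    rw [Nat.mod_eq_of_lt (a := 1) (by omega), Nat.mod_eq_of_lt (by omega)]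
  have e2 : 0 < hi → 1 % W = 1 := fun _ => Nat.mod_eq_of_lt (by omega)
  have ext : ∀ (f g : ℕ → ℕ) k v, lo ≤ k → (∀ x, g x = if x = k then v else f x) →
      slice g lo (k + 1) = slice f lo k ++ [v] := by
    intro f g k v hk hg
    rw [slice_succ _ hk, hg k, if_pos rfl]
    congr 1
    exact slice_congr fun x _ hx => by simp [hg, hx.ne]
  have hstep : ∀ t < hi - lo, ∀ s', I t s' → I (t + 1) (mergeStep.exec W G s') := by
    rintro t ht s' ⟨hS, h9, i, j, h7, h8, hi₁, hi₂, hj₁, hj₂, hij, hm⟩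
    have h6 : s'.reg 6 = hi := hS.1 6 (by simp)
    have h5 : s'.reg 5 = mid := hS.1 5 (by simp)
    have hM : s'.mem 0 = A := hS.2 0 (by simp)
    have e0 := e0 (by omega)
    have e2 := e2 (by omega)
    have e1i := e1 i
    have e1j := e1 j
    have e1k := e1 (lo + t) (by omega)
    have left : ∀ s'', Same [7, 8, 9, 10] [1] s s'' → s''.mem 1 = s'.mem 1 → s''.reg 8 = j →
        i < mid → (∀ y ys, slice A j hi = y :: ys → le (A i) y = true) →
        I (t + 1)
          (((s''.setMem 1 (lo + t) (A i)).setReg 7 (i + 1)).setReg 9 (lo + t + 1)) := by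
      intro s'' hS'' h1 h8'' him hlt
      refine ⟨((hS''.setMem (by simp)).setReg (by simp)).setReg (by simp),
        by simp [State.setReg_reg]; ring, i + 1, j, by simp [State.setReg_reg],
        by simp [State.setReg_reg, State.setMem_reg, h8''], by omega, by omega, hj₁, hj₂,
        by omega, ?_⟩
      rw [State.setReg_mem, State.setReg_mem, ← add_assoc,
        ext (s'.mem 1) _ _ (A i) (by omega) (fun x => by simp [State.setMem_mem, h1]),
        ← hm, slice_cons A him, List.append_assoc]
      congr 1
      cases hys : slice A j hi with
      | nil => simp
      | cons y ys => rw [List.cons_merge_cons_pos _ _ _ (hlt y ys hys)]; simp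
    have right : ∀ s'', Same [7, 8, 9, 10] [1] s s'' → s''.mem 1 = s'.mem 1 → s''.reg 7 = i →
        j < hi → (∀ x xs, slice A i mid = x :: xs → ¬ le x (A j) = true) →
        I (t + 1)
          (((s''.setMem 1 (lo + t) (A j)).setReg 8 (j + 1)).setReg 9 (lo + t + 1)) := by
      intro s'' hS'' h1 h7'' hjhi hlt
      refine ⟨((hS''.setMem (by simp)).setReg (by simp)).setReg (by simp),
        by simp [State.setReg_reg]; ring, i, j + 1,
        by simp [State.setReg_reg, State.setMem_reg, h7''], by simp [State.setReg_reg],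
        hi₁, hi₂, by omega, by omega, by omega, ?_⟩
      rw [State.setReg_mem, State.setReg_mem, ← add_assoc,
        ext (s'.mem 1) _ _ (A j) (by omega) (fun x => by simp [State.setMem_mem, h1]),
        ← hm, slice_cons A hjhi, List.append_assoc]
      congr 1
      cases hxs : slice A i mid with
      | nil => simp
      | cons x xs => rw [List.cons_merge_cons_neg _ _ _ (hlt x xs hxs)]; simp
    by_cases him : i < mid
    · by_cases hjhi : j < hi
      · have hle' := hle i j hi₁ (by omega) (by omega) (by omega)
        by_cases hq : answer G (A j) (A i) = 0
        · have := left { s'.setReg 10 0 with queries := s'.queries + 1 }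
            (hS.setReg (by simp)).query rfl (by simp [State.setReg_reg, h8]) him (by
              rw [slice_cons A hjhi]
              rintro y ys h
              rw [← (List.cons.inj h).1]
              exact hle'.2 hq)
          simpa [mergeStep, Cmd.exec, Expr.eval, State.setReg_reg, State.setReg_mem,
            State.setMem_reg, h7, h8, h9, h6, h5, hM, him, hjhi, hq, e1i (by omega), e1k]
            using this
        · have := right { s'.setReg 10 (answer G (A j) (A i)) with queries := s'.queries + 1 }
            (hS.setReg (by simp)).query rfl (by simp [State.setReg_reg, h7]) hjhi (by
              rw [slice_cons A him]
              rintro x xs h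
              rw [← (List.cons.inj h).1]
              exact fun h => hq (hle'.1 h))
          simpa [mergeStep, Cmd.exec, Expr.eval, State.setReg_reg, State.setReg_mem,
            State.setMem_reg, h7, h8, h9, h6, h5, hM, him, hjhi, hq, e1j hjhi, e1k]
            using this
      · obtain rfl : j = hi := by omega
        have := left (s'.setReg 10 0) (hS.setReg (by simp)) rfl
          (by simp [State.setReg_reg, h8]) him (by simp)
        simpa [mergeStep, Cmd.exec, Expr.eval, State.setReg_reg, State.setReg_mem,
          State.setMem_reg, h7, h8, h9, h6, h5, hM, him, e0, e1i (by omega), e1k] using this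
    · obtain rfl : i = mid := by omega
      have hjhi : j < hi := by omega
      have := right (s'.setReg 10 1) (hS.setReg (by simp)) rfl
        (by simp [State.setReg_reg, h7]) hjhi (by simp)
      simpa [mergeStep, Cmd.exec, Expr.eval, State.setReg_reg, State.setReg_mem,
        State.setMem_reg, h7, h8, h9, h6, h5, hM, e2, e2 ▸ e1j hjhi, e2 ▸ e1k] using this
  obtain ⟨s₁, hs₁, hS₁, -, i, j, -, -, hi₁, hi₂, hj₁, hj₂, hij, hm⟩ :=
    Runs.for_loop (W := W) (G := G) (k := 10) (e := .lt (.reg 9) (.reg 6)) (c := mergeStep) I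
      (hi - lo)
      (fun t ht s' hs' => by
        have h6 : s'.reg 6 = hi := hs'.1.1 6 (by simp)
        exact ⟨by simp [Expr.eval, hs'.2.1, h6]; omega, _,
          runs_exec_of_size_le s' (by simp [mergeStep, Cmd.Straight])
            (by simp [mergeStep, Cmd.size]), hstep t ht s' hs'⟩)
      (fun s' hs' => by
        have h6 : s'.reg 6 = hi := hs'.1.1 6 (by simp)
        simp [Expr.eval, hs'.2.1, h6]; omega)
      (s := ((s.setReg 7 lo).setReg 8 mid).setReg 9 lo)
      ⟨(((Same.refl _ _ _).setReg (by simp)).setReg (by simp)).setReg (by simp),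
        by simp [State.setReg_reg], lo, mid, by simp [State.setReg_reg],
        by simp [State.setReg_reg], le_rfl, h45, le_rfl, h56, by ring, by simp⟩
  obtain rfl : i = mid := by omega
  obtain rfl : j = hi := by omega
  have h4₁ : s₁.reg 4 = lo := hS₁.1 4 (by simp)
  have h6₁ : s₁.reg 6 = s.reg 6 := hS₁.1 6 (by simp)
  have hM₁ : s₁.mem 0 = A := hS₁.2 0 (by simp)
  obtain ⟨s₂, hs₂, hS₂, hm₂⟩ := copyBack_runs (G := G) (W := W) (s := s₁) (by omega) (by omega)
  simp only [slice_self, List.merge, List.append_nil] at hm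
  rw [show lo + (s.reg 6 - lo) = s.reg 6 by omega] at hm
  refine ⟨s₂, (Runs.seq ((runs_exec (c := .assign 7 (.reg 4)) trivial s).seq
    ((runs_exec (c := .assign 8 (.reg 5)) trivial _).seq
      ((runs_exec (c := .assign 9 (.reg 4)) trivial _).seq (s₂ := s₁) (k₂ := (hi - lo) * 11 + 1)
        ?_))) hs₂).mono ?_,
    (hS₁.mono (by simp) (by simp)).trans (hS₂.mono (by simp) (by simp)), ?_, ?_⟩
  · simpa [Cmd.exec, Expr.eval, State.setReg_reg] using hs₁
  · simp only [Cmd.size, h4₁, h6₁]; omega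
  · rw [← hm]
    refine slice_congr fun x hx hx' => ?_
    rw [hm₂, if_pos ⟨by omega, by omega⟩]
  · intro x hx
    rw [hm₂, if_neg (by omega), hM₁]

end

theorem slice_perm_of_segment {a b : ℕ → ℕ} {lo hi N : ℕ} (h : lo ≤ hi) (h' : hi ≤ N)
    (hout : ∀ i, ¬ (lo ≤ i ∧ i < hi) → b i = a i)
    (hin : (slice b lo hi).Perm (slice a lo hi)) : (slice b 0 N).Perm (slice a 0 N) := by
  rw [← slice_append b (Nat.zero_le hi) h', ← slice_append a (Nat.zero_le hi) h',
    ← slice_append b (Nat.zero_le lo) h, ← slice_append a (Nat.zero_le lo) h,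
    slice_congr (a := b) (b := a) (lo := 0) (hi := lo) fun i _ _ => hout i (by omega),
    slice_congr (a := b) (b := a) (lo := hi) (hi := N) fun i _ _ => hout i (by omega)]
  exact (List.Perm.append_left _ hin).append_right _

/-- The smaller of two numbers, by cut-off subtraction. -/
def Expr.min (e f : Expr) : Expr := .sub e (.sub e f)

/-- One pass of bottom-up merge sort: merge the blocks of width `w` in pairs. -/
def mergePass : Cmd :=
  .seq (.assign 4 (.lit 0))
    (.loop (.lt (.reg 4) (.reg 0))
      (.seq (.assign 5 (Expr.min (.add (.reg 4) (.reg 3)) (.reg 0)))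
        (.seq (.assign 6 (Expr.min (.add (.reg 5) (.reg 3)) (.reg 0)))
          (.seq mergeBlock (.assign 4 (.reg 6))))))

/-- Bottom-up merge sort, which also counts its passes. -/
def mergeSort : Cmd :=
  .seq (.assign 2 (.lit 1))
    (.seq (.assign 3 (.lit 1))
      (.loop (.lt (.reg 3) (.reg 0))
        (.seq mergePass
          (.seq (.assign 3 (.mul (.reg 3) (.lit 2))) (.assign 2 (.add (.reg 2) (.lit 1)))))))

/-- Write the vertices `0, …, n - 1` to the ordering. -/
def fillArray : Cmd :=
  .seq (.assign 7 (.lit 0))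
    (.loop (.lt (.reg 7) (.reg 0))
      (.seq (.store 0 (.reg 7) (.reg 7)) (.assign 7 (.add (.reg 7) (.lit 1)))))

/-- The values of `a` are sorted within the blocks of width `w` of `[lo, hi)`. -/
def BlockSorted (le : ℕ → ℕ → Bool) (a : ℕ → ℕ) (w lo hi : ℕ) : Prop :=
  ∀ x y, lo ≤ x → x < y → y < hi → x / w = y / w → le (a x) (a y) = true

section

variable {n : ℕ} {W : ℕ} {G : Digraph (Fin n)}

/-- The comparisons `le` agree with the tournament on all vertices. -/
def Agrees (G : Digraph (Fin n)) (le : ℕ → ℕ → Bool) : Prop :=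
  ∀ x y, x < n → y < n → (le x y = true ↔ answer G y x = 0)

theorem getElem_lt_of_perm {a : ℕ → ℕ} {N : ℕ} (h : (slice a 0 N).Perm (List.range N)) {i : ℕ}
    (hi : i < N) : a i < N := by
  rw [← List.mem_range, ← h.mem_iff, mem_slice]
  exact ⟨i, by omega, hi, rfl⟩

theorem mergePass_loop_runs {le : ℕ → ℕ → Bool} (hle : Agrees G le) {w : ℕ} (hw : 0 < w)
    (hwn : w < n) (hW : 2 * n < W) (r : ℕ) :
    ∀ s : State, r = n - s.reg 4 → s.reg 0 = n → s.reg 3 = w → s.reg 4 ≤ n →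
    (2 * w ∣ s.reg 4 ∨ s.reg 4 = n) → (slice (s.mem 0) 0 n).Perm (List.range n) →
    ∃ s', Runs W G (r * 60 + 1)
      (.loop (.lt (.reg 4) (.reg 0))
      (.seq (.assign 5 (Expr.min (.add (.reg 4) (.reg 3)) (.reg 0)))
        (.seq (.assign 6 (Expr.min (.add (.reg 5) (.reg 3)) (.reg 0)))
          (.seq mergeBlock (.assign 4 (.reg 6)))))) s s' ∧
      Same [4, 5, 6, 7, 8, 9, 10] [0, 1] s s' ∧ (slice (s'.mem 0) 0 n).Perm (List.range n) ∧
      ((∀ a b c, le a b → le b c → le a c) → (∀ a b, le a b || le b a) →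
        BlockSorted le (s.mem 0) (2 * w) 0 (s.reg 4) →
        BlockSorted le (s.mem 0) w (s.reg 4) n → BlockSorted le (s'.mem 0) (2 * w) 0 n) := by
  induction r using Nat.strong_induction_on with
  | _ r ih =>
  intro s hr h0 h3 h4 hdvd hperm
  by_cases hlt : s.reg 4 = n
  · refine ⟨s, (Runs.loop_done (by simp [Expr.eval, h0, hlt])).mono (by omega), .refl _ _ _, hperm,
      fun _ _ h _ => by rwa [hlt] at h⟩
  obtain ⟨c, hc⟩ : 2 * w ∣ s.reg 4 := hdvd.resolve_right hlt
  set lo := s.reg 4 with hlo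
  obtain ⟨mid, hmid⟩ : ∃ mid, mid = min (lo + w) n := ⟨_, rfl⟩
  obtain ⟨hi, hhi⟩ : ∃ hi, hi = min (mid + w) n := ⟨_, rfl⟩
  set s₁ := (s.setReg 5 mid).setReg 6 hi with hs₁
  have hS₁ : Same [4, 5, 6, 7, 8, 9, 10] [0, 1] s s₁ :=
    ((Same.refl _ _ _).setReg (by simp)).setReg (by simp)
  have h4₁ : s₁.reg 4 = lo := by simp [hs₁, State.setReg_reg, hlo]
  have h5₁ : s₁.reg 5 = mid := by simp [hs₁, State.setReg_reg]
  have h6₁ : s₁.reg 6 = hi := by simp [hs₁, State.setReg_reg]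
  have hM₁ : s₁.mem 0 = s.mem 0 := rfl
  have hA : ∀ i < n, s.mem 0 i < n := fun i hi => getElem_lt_of_perm hperm hi
  obtain ⟨s₂, hr₂, hS₂, hmerge, hout⟩ := mergeBlock_runs (G := G) (W := W) (s := s₁) (le := le)
    (by omega) (by omega) (by omega) (by
      intro i j hi₁ hi₂ hj₁ hj₂
      exact hle _ _ (hA i (by omega)) (hA j (by omega)))
  rw [h4₁, h5₁, h6₁, hM₁] at hmerge
  rw [h4₁, h6₁, hM₁] at hout
  have hS₂' : Same [4, 5, 6, 7, 8, 9, 10] [0, 1] s s₂ :=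
    hS₁.trans (hS₂.mono (by simp) (by simp))
  have hperm₂ : (slice (s₂.mem 0) 0 n).Perm (List.range n) := by
    refine (slice_perm_of_segment (lo := lo) (hi := hi) (by omega) (by omega) hout ?_).trans hperm
    rw [hmerge, ← slice_append (s.mem 0) (show lo ≤ mid by omega) (show mid ≤ hi by omega)]
    exact List.merge_perm_append _
  have h62 : s₂.reg 6 = hi := by rw [hS₂.1 6 (by simp), h6₁]
  set s₃ := s₂.setReg 4 hi with hs₃
  have hS₃ : Same [4, 5, 6, 7, 8, 9, 10] [0, 1] s s₃ := hS₂'.setReg (by simp)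
  have h4₃ : s₃.reg 4 = hi := by simp [hs₃, State.setReg_reg]
  have hM₃ : s₃.mem 0 = s₂.mem 0 := rfl
  have hhi' : hi = lo + 2 * w ∨ hi = n := by omega
  obtain ⟨s', hr', hS', hperm', hsort'⟩ := ih (n - s₃.reg 4) (by omega) s₃ rfl
    ((hS₃.1 0 (by simp)).trans h0) ((hS₃.1 3 (by simp)).trans h3) (by omega) (by
      rw [h4₃]
      rcases hhi' with h | h
      · left; rw [h, hc]; exact ⟨c + 1, by ring⟩
      · right; exact h) (by rwa [hM₃])
  refine ⟨s', ?_, hS₃.trans hS', hperm', ?_⟩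
  · have m1 : (s.reg 4 + w) % W = lo + w := Nat.mod_eq_of_lt (by omega)
    have m2 : (mid + w) % W = mid + w := Nat.mod_eq_of_lt (by omega)
    have a1 := runs_exec (W := W) (G := G)
      (c := .assign 5 (Expr.min (.add (.reg 4) (.reg 3)) (.reg 0))) trivial s
    have a2 := runs_exec (W := W) (G := G)
      (c := .assign 6 (Expr.min (.add (.reg 5) (.reg 3)) (.reg 0))) trivial (s.setReg 5 mid)
    have a3 := runs_exec (W := W) (G := G) (c := .assign 4 (.reg 6)) trivial s₂
    simp only [Cmd.exec, Expr.min, Expr.eval, h0, h3, m1, m2, h62, State.setReg_reg, if_true,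
      if_neg (show ¬ 3 = 5 by decide), if_neg (show ¬ 0 = 5 by decide)] at a1 a2 a3
    rw [show lo + w - (lo + w - n) = mid by omega] at a1
    rw [show mid + w - (mid + w - n) = hi by omega] at a2
    refine (Runs.loop_step (by simp [Expr.eval, h0]; omega)
      (a1.seq (a2.seq (hr₂.seq a3))) hr').mono ?_
    simp only [Cmd.size, h4₃, h4₁, h6₁]
    omega
  · intro htr htot hb₁ hb₂
    have hcw : 2 * c * w = lo := by rw [hc]; ring
    have hcw' : c * (2 * w) = lo := by rw [hc]; ring
    refine hsort' htr htot ?_ ?_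
    · rw [hM₃, h4₃]
      intro x y _ hxy hy hd
      by_cases hx : lo ≤ x
      · have hp := List.pairwise_merge htr htot (slice (s.mem 0) lo mid) (slice (s.mem 0) mid hi)
          (slice_pairwise.2 fun x y h1 h2 h3 => hb₂ x y h1 h2 (by omega) ?_)
          (slice_pairwise.2 fun x y h1 h2 h3 => hb₂ x y (by omega) h2 (by omega) ?_)
        · rw [← hmerge] at hp
          exact slice_pairwise.1 hp x y hx hxy hy
        · have e : ∀ z, lo ≤ z → z < mid → z / w = 2 * c := fun z h1 h2 =>
            Nat.div_eq_of_lt_le (by rw [hcw]; exact h1) (by rw [add_mul, hcw]; omega)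
          rw [e x h1 (by omega), e y (by omega) h3]
        · have e : ∀ z, mid ≤ z → z < hi → z / w = 2 * c + 1 := fun z h1 h2 => by
            have hm : mid = lo + w := by omega
            exact Nat.div_eq_of_lt_le (by rw [add_mul, hcw]; omega)
              (by rw [add_mul, add_mul, hcw]; omega)
          rw [e x h1 (by omega), e y (by omega) h3]
      · by_cases hy' : lo ≤ y
        · exfalso
          have h1 : x / (2 * w) < c := (Nat.div_lt_iff_lt_mul (by omega)).2 (by omega)
          have h2 : c ≤ y / (2 * w) := (Nat.le_div_iff_mul_le (by omega)).2 (by omega)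
          omega
        · rw [hout x (by omega), hout y (by omega)]
          exact hb₁ x y (by omega) hxy (by omega) hd
    · rw [hM₃, h4₃]
      intro x y hx hxy hy hd
      rw [hout x (by omega), hout y (by omega)]
      exact hb₂ x y (by omega) hxy hy hd

theorem mergePass_runs {le : ℕ → ℕ → Bool} (hle : Agrees G le) {w : ℕ} (hw : 0 < w)
    (hwn : w < n) (hW : 2 * n < W) {s : State} (h0 : s.reg 0 = n) (h3 : s.reg 3 = w)
    (hperm : (slice (s.mem 0) 0 n).Perm (List.range n)) :
    ∃ s', Runs W G (n * 60 + 3) mergePass s s' ∧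
      Same [4, 5, 6, 7, 8, 9, 10] [0, 1] s s' ∧ (slice (s'.mem 0) 0 n).Perm (List.range n) ∧
      ((∀ a b c, le a b → le b c → le a c) → (∀ a b, le a b || le b a) →
        BlockSorted le (s.mem 0) w 0 n → BlockSorted le (s'.mem 0) (2 * w) 0 n) := by
  obtain ⟨s', hr, hS, hp, hs⟩ := mergePass_loop_runs (W := W) hle hw hwn hW n (s.setReg 4 0)
    (by simp [State.setReg_reg]) (by simp [State.setReg_reg, h0])
    (by simp [State.setReg_reg, h3]) (by simp [State.setReg_reg])
    (by simp [State.setReg_reg]) hperm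
  have a1 := runs_exec (W := W) (G := G) (c := .assign 4 (.lit 0)) trivial s
  simp only [Cmd.exec, Expr.eval, Nat.zero_mod] at a1
  refine ⟨s', (a1.seq hr).mono (by simp only [Cmd.size]; omega),
    ((Same.refl _ _ _).setReg (by simp)).trans hS, hp, fun htr htot hb => hs htr htot ?_ ?_⟩
  · intro x y _ _ hy
    simp [State.setReg_reg] at hy
  · simpa [State.setReg_reg, State.setReg_mem] using hb

theorem mergeSort_runs {le : ℕ → ℕ → Bool} (hle : Agrees G le) (hW : 4 * n + 4 < W) {s : State}
    (h0 : s.reg 0 = n) (hperm : (slice (s.mem 0) 0 n).Perm (List.range n)) :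
    ∃ s', Runs W G (Nat.clog 2 n * (n * 60 + 9) + 5) mergeSort s s' ∧
      Same [2, 3, 4, 5, 6, 7, 8, 9, 10] [0, 1] s s' ∧
      s'.reg 2 = Nat.clog 2 n + 1 ∧
      (slice (s'.mem 0) 0 n).Perm (List.range n) ∧
      ((∀ a b c, le a b → le b c → le a c) → (∀ a b, le a b || le b a) →
        (slice (s'.mem 0) 0 n).Pairwise (fun x y => le x y = true)) := by
  have hpow : ∀ j, j < Nat.clog 2 n → 2 ^ j < n := fun j hj =>
    (Nat.lt_clog_iff_pow_lt (by norm_num)).1 hj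
  obtain ⟨s', hr, hS, h2, h3, hp, hs⟩ := Runs.for_loop (W := W) (G := G) (k := n * 60 + 8)
    (e := .lt (.reg 3) (.reg 0))
    (c := .seq mergePass
          (.seq (.assign 3 (.mul (.reg 3) (.lit 2))) (.assign 2 (.add (.reg 2) (.lit 1)))))
    (fun j s' => Same [2, 3, 4, 5, 6, 7, 8, 9, 10] [0, 1] s s' ∧ s'.reg 2 = j + 1 ∧
      s'.reg 3 = 2 ^ j ∧ (slice (s'.mem 0) 0 n).Perm (List.range n) ∧
      ((∀ a b c, le a b → le b c → le a c) → (∀ a b, le a b || le b a) →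
        BlockSorted le (s'.mem 0) (2 ^ j) 0 n))
    (Nat.clog 2 n)
    (by
      rintro j hj s₁ ⟨hS, h2, h3, hp, hs⟩
      have h0₁ : s₁.reg 0 = n := (hS.1 0 (by simp)).trans h0
      have hjn := hpow j hj
      have hjj : j < 2 ^ j := Nat.lt_two_pow_self
      refine ⟨by simp [Expr.eval, h0₁, h3, hjn], ?_⟩
      obtain ⟨s₂, hr₂, hS₂, hp₂, hs₂⟩ := mergePass_runs (W := W) hle (w := 2 ^ j) (by positivity)
        hjn (by omega) h0₁ h3 hp
      have h22 : s₂.reg 2 = j + 1 := (hS₂.1 2 (by simp)).trans h2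
      have h23 : s₂.reg 3 = 2 ^ j := (hS₂.1 3 (by simp)).trans h3
      have m0 : 2 % W = 2 := Nat.mod_eq_of_lt (by omega)
      have m0' : 1 % W = 1 := Nat.mod_eq_of_lt (by omega)
      have m1 : (2 ^ j * 2) % W = 2 ^ (j + 1) := by
        rw [Nat.mod_eq_of_lt (by omega), pow_succ]
      have m2 : (j + 1 + 1) % W = j + 1 + 1 := Nat.mod_eq_of_lt (by omega)
      have a1 := runs_exec (W := W) (G := G) (c := .assign 3 (.mul (.reg 3) (.lit 2))) trivial s₂
      simp only [Cmd.exec, Expr.eval, h23, m0, m1] at a1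
      have a2 := runs_exec (W := W) (G := G) (c := .assign 2 (.add (.reg 2) (.lit 1))) trivial
        (s₂.setReg 3 (2 ^ (j + 1)))
      simp only [Cmd.exec, Expr.eval, State.setReg_reg, if_neg (show ¬ (2 = 3) by decide), h22, m0', m2] at a2
      refine ⟨_, (hr₂.seq (a1.seq a2)).mono (by simp only [Cmd.size]; omega),
        ((hS.trans (hS₂.mono (by simp) (by simp))).setReg (by simp)).setReg (by simp),
        by simp [State.setReg_reg], by simp [State.setReg_reg], hp₂, fun htr htot => ?_⟩
      rw [pow_succ, mul_comm]
      exact hs₂ htr htot (hs htr htot))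
    (by
      rintro s₁ ⟨hS, h2, h3, -⟩
      have h0₁ : s₁.reg 0 = n := (hS.1 0 (by simp)).trans h0
      have := Nat.le_pow_clog (b := 2) (by norm_num) n
      simp [Expr.eval, h0₁, h3, this])
    (s := (s.setReg 2 1).setReg 3 1)
    ⟨((Same.refl _ _ _).setReg (by simp)).setReg (by simp), by simp [State.setReg_reg],
      by simp [State.setReg_reg], hperm, fun _ _ x y _ hxy _ hd => by simp at hd; omega⟩
  have m0' : 1 % W = 1 := Nat.mod_eq_of_lt (by omega)
  have a1 := runs_exec (W := W) (G := G) (c := .assign 2 (.lit 1)) trivial s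
  have a2 := runs_exec (W := W) (G := G) (c := .assign 3 (.lit 1)) trivial (s.setReg 2 1)
  simp only [Cmd.exec, Expr.eval, m0'] at a1 a2
  refine ⟨s', (a1.seq (a2.seq hr)).mono (by simp only [Cmd.size, add_assoc, Nat.reduceAdd]; omega), hS, h2, hp,
    fun htr htot => slice_pairwise.2 fun x y _ hxy hy => ?_⟩
  have hn := Nat.le_pow_clog (b := 2) (by norm_num) n
  exact hs htr htot x y (by omega) hxy hy (by
    rw [Nat.div_eq_of_lt (by omega), Nat.div_eq_of_lt (by omega)])

theorem fillArray_runs (hW : n < W) {s : State} (h0 : s.reg 0 = n) :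
    ∃ s', Runs W G (n * 4 + 3) fillArray s s' ∧ Same [7] [0] s s' ∧
      slice (s'.mem 0) 0 n = List.range n := by
  obtain ⟨s', hr, hS, h7, hm⟩ := Runs.for_loop (W := W) (G := G) (k := 3)
    (e := .lt (.reg 7) (.reg 0))
    (c := .seq (.store 0 (.reg 7) (.reg 7)) (.assign 7 (.add (.reg 7) (.lit 1))))
    (fun j s' => Same [7] [0] s s' ∧ s'.reg 7 = j ∧ ∀ i < j, s'.mem 0 i = i) n
    (by
      rintro j hj s₁ ⟨hS, h7, hm⟩
      have h0₁ : s₁.reg 0 = n := (hS.1 0 (by simp)).trans h0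
      have m0 : 1 % W = 1 := Nat.mod_eq_of_lt (by omega)
      have m1 : (j + 1) % W = j + 1 := Nat.mod_eq_of_lt (by omega)
      refine ⟨by simp [Expr.eval, h0₁, h7, hj], _,
        runs_exec_of_size_le s₁ (by simp [Cmd.Straight]) (by simp [Cmd.size]), ?_⟩
      simp only [Cmd.exec, Expr.eval, State.setMem_reg, h7, m0, m1]
      refine ⟨(hS.setMem (by simp)).setReg (by simp), by simp [State.setReg_reg], ?_⟩
      intro i hi
      rw [State.setReg_mem, State.setMem_mem]
      by_cases h : i = j
      · simp [h]
      · simp [h, hm i (by omega)])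
    (by
      rintro s₁ ⟨hS, h7, hm⟩
      have h0₁ : s₁.reg 0 = n := (hS.1 0 (by simp)).trans h0
      simp [Expr.eval, h0₁, h7])
    (s := s.setReg 7 0)
    ⟨(Same.refl _ _ _).setReg (by simp), by simp [State.setReg_reg], by simp⟩
  have a1 := runs_exec (W := W) (G := G) (c := .assign 7 (.lit 0)) trivial s
  simp only [Cmd.exec, Expr.eval, Nat.zero_mod] at a1
  refine ⟨s', (a1.seq hr).mono (by simp only [Cmd.size]; omega), hS, ?_⟩
  exact slice_eq_of_forall_getElem (by simp) fun i hi => by simpa using hm i (by simpa using hi)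

end

end RobustSort

namespace RobustSort

open Finset

/-! ### Triangles, pivots and misplaced vertices -/

section

variable {α : Type*}

/-- The relation `R` restricted to `S` is a tournament. -/
def TournamentOn (R : α → α → Prop) (S : Finset α) : Prop :=
  (∀ x ∈ S, ¬ R x x) ∧ ∀ x ∈ S, ∀ y ∈ S, x ≠ y → (R x y ↔ ¬ R y x)

/-- The arcs `p → u → v → p` form a directed triangle. -/
def Triangle (R : α → α → Prop) (p u v : α) : Prop := R p u ∧ R u v ∧ R v p

open Classical in
/-- The pairs that form a directed triangle with `p`. -/
noncomputable def triangles (R : α → α → Prop) (S : Finset α) (p : α) : Finset (α × α) :=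
  (S ×ˢ S).filter fun e => Triangle R p e.1 e.2

open Classical in
/-- The vertices that the pivot `p` puts to its left. -/
noncomputable def leftOf (R : α → α → Prop) (S : Finset α) (p : α) : Finset α :=
  S.filter fun u => R u p

open Classical in
/-- The vertices that the pivot `p` puts to its right. -/
noncomputable def rightOf (R : α → α → Prop) (S : Finset α) (p : α) : Finset α :=
  S.filter fun u => R p u

/-- The probability that a random pair forms a directed triangle with `p`. -/
noncomputable def density (R : α → α → Prop) (S : Finset α) (p : α) : ℝ :=
  (triangles R S p).card / (S.card : ℝ) ^ 2

/-- The probability that the pivot `p` separates a random pair, that is, does not put both members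
on the same side. -/
noncomputable def separation (R : α → α → Prop) (S : Finset α) (p : α) : ℝ :=
  1 - (((leftOf R S p).card : ℝ) ^ 2 + ((rightOf R S p).card : ℝ) ^ 2) / (S.card : ℝ) ^ 2

theorem density_nonneg (R : α → α → Prop) (S : Finset α) (p : α) : 0 ≤ density R S p := by
  unfold density; positivity

theorem density_le_one (R : α → α → Prop) (S : Finset α) (p : α) : density R S p ≤ 1 := by
  unfold density
  refine div_le_one_of_le₀ ?_ (by positivity)
  have : (triangles R S p).card ≤ S.card * S.card := by
    classical
    rw [← card_product]
    exact card_le_card (filter_subset _ _)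
  rw [sq]; exact_mod_cast this

theorem separation_le_one (R : α → α → Prop) (S : Finset α) (p : α) : separation R S p ≤ 1 := by
  unfold separation
  have : 0 ≤ (((leftOf R S p).card : ℝ) ^ 2 + ((rightOf R S p).card : ℝ) ^ 2) / (S.card : ℝ) ^ 2 := by
    positivity
  linarith

theorem card_leftOf_add_card_rightOf_lt {R : α → α → Prop} {S : Finset α} (h : TournamentOn R S)
    {p : α} (hp : p ∈ S) : (leftOf R S p).card + (rightOf R S p).card < S.card := by
  classical
  rw [← card_union_of_disjoint]
  · refine card_lt_card ⟨union_subset (filter_subset _ _) (filter_subset _ _), fun hsub => ?_⟩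
    have := hsub hp
    simp only [leftOf, rightOf, mem_union, mem_filter] at this
    rcases this with h' | h' <;> exact h.1 p hp h'.2
  · rw [disjoint_left]
    intro x hx hx'
    simp only [leftOf, rightOf, mem_filter] at hx hx'
    by_cases hxp : x = p
    · exact h.1 p hp (hxp ▸ hx.2)
    · exact (h.2 x hx.1 p hp hxp).1 hx.2 hx'.2

theorem separation_nonneg {R : α → α → Prop} {S : Finset α} (h : TournamentOn R S)
    {p : α} (hp : p ∈ S) : 0 ≤ separation R S p := by
  have h1 : ((leftOf R S p).card : ℝ) + (rightOf R S p).card ≤ S.card := by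
    exact_mod_cast (card_leftOf_add_card_rightOf_lt h hp).le
  unfold separation
  have : (((leftOf R S p).card : ℝ) ^ 2 + ((rightOf R S p).card : ℝ) ^ 2) / (S.card : ℝ) ^ 2 ≤ 1 := by
    refine div_le_one_of_le₀ ?_ (by positivity)
    have h2 : (0 : ℝ) ≤ (leftOf R S p).card := by positivity
    have h3 : (0 : ℝ) ≤ (rightOf R S p).card := by positivity
    nlinarith
  linarith

/-- A random pivot separates a random pair with probability at least `1/3`, because in every triple
some member separates the two others. -/
theorem card_div_three_le_sum_separation {R : α → α → Prop} {S : Finset α}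
    (h : TournamentOn R S) : (S.card : ℝ) / 3 ≤ ∑ p ∈ S, separation R S p := by
  classical
  let f : α → α → α → ℝ := fun p u v =>
    1 - (if R u p then 1 else 0) * (if R v p then 1 else 0)
      - (if R p u then 1 else 0) * (if R p v then 1 else 0)
  have hf : ∀ p, ∑ u ∈ S, ∑ v ∈ S, f p u v =
      (S.card : ℝ) ^ 2 - (((leftOf R S p).card : ℝ) ^ 2 + ((rightOf R S p).card : ℝ) ^ 2) := by
    intro p
    simp only [f, sum_sub_distrib, ← mul_sum, ← sum_mul, leftOf, rightOf, card_filter, sum_const,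
      nsmul_eq_mul]
    push_cast
    ring
  have h1 : ∑ x ∈ S, ∑ y ∈ S, ∑ z ∈ S, (f x y z + f y x z + f z x y) =
      3 * ∑ x ∈ S, ∑ y ∈ S, ∑ z ∈ S, f x y z := by
    simp only [sum_add_distrib]
    have e1 : ∑ x ∈ S, ∑ y ∈ S, ∑ z ∈ S, f y x z = ∑ x ∈ S, ∑ y ∈ S, ∑ z ∈ S, f x y z :=
      sum_comm
    have e2 : ∑ x ∈ S, ∑ y ∈ S, ∑ z ∈ S, f z x y = ∑ z ∈ S, ∑ x ∈ S, ∑ y ∈ S, f z x y :=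
      (sum_congr rfl fun x _ => sum_comm).trans sum_comm
    rw [e1, e2]; ring
  have h2 : (S.card : ℝ) ^ 3 ≤ ∑ x ∈ S, ∑ y ∈ S, ∑ z ∈ S, (f x y z + f y x z + f z x y) := by
    have : (S.card : ℝ) ^ 3 = ∑ x ∈ S, ∑ y ∈ S, ∑ z ∈ S, (1 : ℝ) := by
      simp; ring
    rw [this]
    refine sum_le_sum fun x hx => sum_le_sum fun y hy => sum_le_sum fun z hz => ?_
    have hxx := h.1 x hx
    have hyy := h.1 y hy
    have hzz := h.1 z hz
    by_cases hxy : x = y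
    · subst hxy; simp only [f, hxx, if_false]; split_ifs <;> norm_num
    by_cases hxz : x = z
    · subst hxz; simp only [f, hxx, if_false]; split_ifs <;> norm_num
    by_cases hyz : y = z
    · subst hyz; simp only [f, hyy, if_false]; split_ifs <;> norm_num
    have e1 := h.2 x hx y hy hxy
    have e2 := h.2 x hx z hz hxz
    have e3 := h.2 y hy z hz hyz
    by_cases c1 : R y x <;> by_cases c2 : R z x <;> by_cases c3 : R z y <;>
      simp only [c1, c2, c3, not_true, not_false_iff, iff_true, iff_false] at e1 e2 e3 <;>
      simp [f, c1, c2, c3, e1, e2, e3]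
  rcases S.eq_empty_or_nonempty with rfl | hS
  · simp
  have hs : (0 : ℝ) < S.card := by exact_mod_cast hS.card_pos
  have h3 : ∀ p, separation R S p = (∑ u ∈ S, ∑ v ∈ S, f p u v) / (S.card : ℝ) ^ 2 := by
    intro p
    rw [hf, separation]; field_simp
  simp_rw [h3]
  rw [← sum_div, div_le_div_iff₀ (by norm_num) (by positivity)]
  rw [h1] at h2
  nlinarith

/-- A sequence of left and right labels can be cut so that as many right labels precede the cut
as left labels follow it. -/
theorem exists_balanced_cut (f : α → Bool) (l : List α) (a : ℕ) (ha : a ≤ l.countP f) :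
    ∃ l₁ l₂, l = l₁ ++ l₂ ∧ a + l₁.countP (fun x => !f x) = l₂.countP f := by
  induction l generalizing a with
  | nil => exact ⟨[], [], rfl, by simpa using ha⟩
  | cons x t ih =>
    by_cases he : a = (x :: t).countP f
    · exact ⟨[], x :: t, rfl, by simpa using he⟩
    cases hx : f x with
    | true =>
      rw [List.countP_cons_of_pos hx] at ha he
      obtain ⟨l₁, l₂, h, h'⟩ := ih a (by omega)
      exact ⟨x :: l₁, l₂, by simp [h], by rw [List.countP_cons_of_neg (by simp [hx]), h']⟩
    | false =>
      rw [List.countP_cons_of_neg (by simp [hx])] at ha he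
      obtain ⟨l₁, l₂, h, h'⟩ := ih (a + 1) (by omega)
      exact ⟨x :: l₁, l₂, by simp [h], by
        rw [List.countP_cons_of_pos (by simp [hx]), ← h']; ring⟩

/-- If a pivot `p` outside of the correctly ordered vertices `T` is used, then removing `2j` of these
vertices makes the others consistent with the split, where `p` is on at least `j ^ 2` triangles. -/
theorem exists_misplaced {R : α → α → Prop} {S T : Finset α} (h : TournamentOn R S) (hTS : T ⊆ S)
    (rank : α → ℕ) (hrank : ∀ x ∈ T, ∀ y ∈ T, x ≠ y → (R x y ↔ rank x < rank y)) {p : α}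
    (hp : p ∈ S) : ∃ (Y : Finset α) (j : ℕ), Y.card ≤ 2 * j ∧
      j ^ 2 ≤ (triangles R S p).card ∧ (p ∈ T → j = 0) ∧
      ∀ x ∈ T, x ∉ Y → ∀ y ∈ T, y ∉ Y → R x p → R p y → rank x < rank y := by
  classical
  by_cases hpT : p ∈ T
  · refine ⟨∅, 0, by simp, by simp, fun _ => rfl, fun x hx _ y hy _ hxp hpy => ?_⟩
    have hx' : x ≠ p := by rintro rfl; exact h.1 x hp hxp
    have hy' : p ≠ y := by rintro rfl; exact h.1 p hp hpy
    exact ((hrank x hx p hpT hx').1 hxp).trans ((hrank p hpT y hy hy').1 hpy)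
  let l := T.toList.mergeSort fun x y => decide (rank x ≤ rank y)
  have hlp : l.Perm T.toList := List.mergeSort_perm _ _
  have hmem : ∀ x, x ∈ l ↔ x ∈ T := fun x => by rw [hlp.mem_iff, mem_toList]
  have hnd : l.Nodup := hlp.nodup_iff.2 T.nodup_toList
  have hsort : l.Pairwise fun x y => rank x ≤ rank y := by
    have := List.pairwise_mergeSort (le := fun x y => decide (rank x ≤ rank y))
      (by intro a b c; simp; omega) (by intro a b; simp; omega) T.toList
    exact this.imp (by simp)
  obtain ⟨l₁, l₂, hl, hcut⟩ := exists_balanced_cut (fun x => decide (R x p)) l 0 (Nat.zero_le _)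
  rw [hl] at hsort hnd
  have hle := (List.pairwise_append.1 hsort).2.2
  have hnd' := List.nodup_append.1 hnd
  have hmem₁ : ∀ x ∈ l₁, x ∈ T := fun x hx => (hmem x).1 (by rw [hl]; simp [hx])
  have hmem₂ : ∀ x ∈ l₂, x ∈ T := fun x hx => (hmem x).1 (by rw [hl]; simp [hx])
  have hne : ∀ x ∈ T, x ≠ p := fun x hx => by rintro rfl; exact hpT hx
  have hlt : ∀ x ∈ l₁, ∀ y ∈ l₂, x ≠ y → R x y := by
    intro x hx y hy hxy
    rw [h.2 x (hTS (hmem₁ x hx)) y (hTS (hmem₂ y hy)) hxy,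
      hrank y (hmem₂ y hy) x (hmem₁ x hx) hxy.symm]
    exact not_lt.2 (hle x hx y hy)
  let Y₁ := (l₁.filter fun x => !decide (R x p)).toFinset
  let Y₂ := (l₂.filter fun x => decide (R x p)).toFinset
  have hY₁ : Y₁.card = l₂.countP fun x => decide (R x p) := by
    rw [List.toFinset_card_of_nodup (hnd'.1.filter _), ← hcut, zero_add, List.countP_eq_length_filter]
  have hY₂ : Y₂.card = l₂.countP fun x => decide (R x p) := by
    rw [List.toFinset_card_of_nodup (hnd'.2.1.filter _), List.countP_eq_length_filter]
  refine ⟨Y₁ ∪ Y₂, l₂.countP fun x => decide (R x p), ?_, ?_, fun h => (hpT h).elim, ?_⟩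
  · exact (card_union_le _ _).trans (by omega)
  · calc (l₂.countP fun x => decide (R x p)) ^ 2 = (Y₁ ×ˢ Y₂).card := by
          rw [card_product, hY₁, hY₂, sq]
      _ ≤ _ := by
        refine card_le_card fun e he => ?_
        simp only [Y₁, Y₂, mem_product, List.mem_toFinset, List.mem_filter, Bool.not_eq_true',
          decide_eq_false_iff_not, decide_eq_true_eq] at he
        obtain ⟨⟨h1, h2⟩, h3, h4⟩ := he
        have t1 := hmem₁ _ h1
        have t2 := hmem₂ _ h3
        simp only [triangles, mem_filter, mem_product]
        exact ⟨⟨hTS t1, hTS t2⟩, (h.2 _ hp _ (hTS t1) (hne _ t1).symm).2 h2,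
          hlt _ h1 _ h3 (fun heq => h2 (heq ▸ h4)), h4⟩
  · intro x hx hxY y hy hyY hxp hpy
    have hyp : ¬ R y p := (h.2 p hp y (hTS hy) (hne y hy).symm).1 hpy
    have hxy : x ≠ y := by rintro rfl; exact hyp hxp
    have hx₁ : x ∈ l₁ := by
      have := (hmem x).2 hx
      rw [hl, List.mem_append] at this
      refine this.resolve_right fun hx₂ => hxY ?_
      simp [Y₂, hx₂, hxp]
    have hy₂ : y ∈ l₂ := by
      have := (hmem y).2 hy
      rw [hl, List.mem_append] at this
      refine this.resolve_left fun hy₁ => hyY ?_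
      simp [Y₁, hy₁, hyp]
    exact (hrank x hx y hy hxy).1 (hlt x hx₁ y hy₂ hxy)

/-! ### The expected change of the potential -/

theorem one_sub_pow_le (N : ℕ) {x : ℝ} (h0 : 0 ≤ x) (h1 : x ≤ 1) :
    (1 - x) ^ N ≤ 1 / (1 + N * x) := by
  rw [le_div_iff₀ (by positivity)]
  calc (1 - x) ^ N * (1 + N * x) ≤ (1 - x) ^ N * (1 + x) ^ N := by
        exact mul_le_mul_of_nonneg_left (one_add_mul_le_pow (by linarith) N)
          (pow_nonneg (by linarith) _)
    _ = (1 - x ^ 2) ^ N := by rw [← mul_pow]; ring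
    _ ≤ 1 := pow_le_one₀ (by nlinarith) (by nlinarith)

/-- A pivot that misplaces `2j` vertices passes all tests with probability at most proportional
to `1 / j`. -/
theorem pass_mul_misplaced_le {s δ j M : ℝ} (hs : 0 < s) (hM : 0 < M) (h0 : 0 ≤ δ) (h1 : δ ≤ 1)
    (hj : 0 ≤ j) (hδ : j ^ 2 / s ^ 2 ≤ δ) {N : ℕ} (hN : (N : ℝ) = M ^ 2) :
    (1 - δ) ^ N * (2 * j) ≤ s / M := by
  have hz : 0 ≤ M * j / s := by positivity
  calc (1 - δ) ^ N * (2 * j) ≤ 1 / (1 + N * δ) * (2 * j) := by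
        gcongr; exact one_sub_pow_le N h0 h1
    _ ≤ 1 / (1 + (M * j / s) ^ 2) * (2 * j) := by
        gcongr
        rw [hN, div_pow, mul_pow, mul_div_assoc]; gcongr
    _ = (s / M) * (2 * (M * j / s) / (1 + (M * j / s) ^ 2)) := by field_simp
    _ ≤ (s / M) * 1 := by
        gcongr
        rw [div_le_one (by positivity)]
        nlinarith [sq_nonneg (M * j / s - 1)]
    _ = s / M := mul_one _

theorem potential_change_le {Q A Γ β b M al η lam τ s N : ℝ} (hQ0 : 0 ≤ Q) (hQ1 : Q ≤ 1)
    (hA1 : A ≤ 1) (hΓ : 0 ≤ Γ) (hβ : β ≤ b / M) (hb : 0 ≤ b) (hM : 0 < M)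
    (hal : 8 ≤ al * M) (hη : 0 ≤ η) (hMη : 1 ≤ η * M) (hlam : 0 ≤ lam) (hτ : 0 ≤ τ) (hs : 0 ≤ s)
    (hbN : b ≤ N) (hsN : s ≤ N) (hN : 1 ≤ N) (hcase : 1 / 4 ≤ Γ ∨ Q ≤ 1 / (2 * N)) :
    Q * (β - al * b / 2 * Γ + lam * s ^ 2 * τ * (A / 4 - Γ)) -
      (1 - Q * A) * (η + 3 * lam * (τ * (3 / 4)) * s) ≤ 0 := by
  have hx : 0 ≤ η + 3 * lam * (τ * (3 / 4)) * s := by positivity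
  have hQA : Q * A ≤ Q := mul_le_of_le_one_right hQ0 hA1
  have hal0 : 0 < al := by
    by_contra hcon
    have : al * M ≤ 0 := mul_nonpos_of_nonpos_of_nonneg (not_lt.1 hcon) hM.le
    linarith
  have hbM : b / M ≤ al * b / 8 := by
    rw [div_le_div_iff₀ hM (by norm_num)]
    nlinarith
  rcases hcase with hc | hc
  · have h1 : β - al * b / 2 * Γ ≤ 0 := by
      have : al * b / 2 * (1 / 4) ≤ al * b / 2 * Γ := by gcongr
      linarith
    have h2 : lam * s ^ 2 * τ * (A / 4 - Γ) ≤ 0 :=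
      mul_nonpos_of_nonneg_of_nonpos (by positivity) (by linarith)
    have h3 : 0 ≤ (1 - Q * A) * (η + 3 * lam * (τ * (3 / 4)) * s) :=
      mul_nonneg (by linarith) hx
    nlinarith [mul_nonpos_of_nonneg_of_nonpos hQ0 (add_nonpos h1 h2)]
  · have hQN : Q * N ≤ 1 / 2 := by
      rw [le_div_iff₀ (by positivity)] at hc
      linarith
    have hQhalf : Q ≤ 1 / 2 := by nlinarith
    have h1 : Q * (β - al * b / 2 * Γ) ≤ η / 2 := by
      have : β - al * b / 2 * Γ ≤ N * η := by
        have h4 : 0 ≤ al * b / 2 * Γ := by positivity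
        have h5 : b / M ≤ b * η := by
          rw [div_le_iff₀ hM, mul_assoc]
          nlinarith
        have h6 : b * η ≤ N * η := by gcongr
        linarith
      calc Q * (β - al * b / 2 * Γ) ≤ Q * (N * η) := by gcongr
        _ = Q * N * η := by ring
        _ ≤ 1 / 2 * η := by gcongr
        _ = η / 2 := by ring
    have h2 : Q * (lam * s ^ 2 * τ * (A / 4 - Γ)) ≤ lam * τ * s / 8 := by
      calc Q * (lam * s ^ 2 * τ * (A / 4 - Γ)) ≤ Q * (lam * s ^ 2 * τ * (1 / 4)) := by
            gcongr; linarith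
        _ = (Q * s) * (lam * τ * s) * (1 / 4) := by ring
        _ ≤ 1 / 2 * (lam * τ * s) * (1 / 4) := by
            gcongr
            exact (mul_le_mul_of_nonneg_left hsN hQ0).trans hQN
        _ = lam * τ * s / 8 := by ring
    have h3 : 1 / 2 * (η + 3 * lam * (τ * (3 / 4)) * s) ≤
        (1 - Q * A) * (η + 3 * lam * (τ * (3 / 4)) * s) := by
      gcongr; linarith
    have h4 : 0 ≤ lam * τ * s := by positivity
    nlinarith

/-- The potential does not increase in expectation. Here `(1 - δ) ^ F` is the probability that the
random triples show no triangle, `(1 - density R S p) ^ N` the one that the pivot `p` passes. -/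
theorem expected_potential_le [DecidableEq α] {R : α → α → Prop} {S B : Finset α} (h : TournamentOn R S)
    (hS : S.Nonempty) (j : α → ℕ) (hj : ∀ p ∈ S, j p ^ 2 ≤ (triangles R S p).card)
    (hjB : ∀ p ∈ S, p ∉ B → j p = 0) {N F M nn : ℕ} {al η lam τ Φ : ℝ} (hM : 0 < M)
    (hN : N = M ^ 2) (hal : 8 ≤ al * M) (hη : 0 ≤ η) (hMη : 1 ≤ η * M) (hlam : 0 ≤ lam)
    (hτ : 0 ≤ τ) (hnn : S.card ≤ nn)
    (hF : ∀ x : ℝ, 1 / (12 * N) ≤ x → x ≤ 1 → (1 - x) ^ F ≤ 1 / (2 * nn)) :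
    (1 - (∑ p ∈ S, density R S p) / S.card) ^ F *
      ((∑ p ∈ S, ((1 - density R S p) ^ N *
          (Φ + 2 * j p - al * (S ∩ B).card / 2 * separation R S p +
            lam * (S.card : ℝ) ^ 2 * τ * (1 / 4 - separation R S p)) +
        (1 - (1 - density R S p) ^ N) * (Φ - (η + 3 * lam * (τ * (3 / 4)) * S.card)))) / S.card) +
      (1 - (1 - (∑ p ∈ S, density R S p) / S.card) ^ F) *
        (Φ - (η + 3 * lam * (τ * (3 / 4)) * S.card)) ≤ Φ := by
  have hs : (0 : ℝ) < S.card := by exact_mod_cast hS.card_pos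
  have hMr : (0 : ℝ) < M := by exact_mod_cast hM
  have hNr : (N : ℝ) = (M : ℝ) ^ 2 := by rw [hN]; push_cast; rfl
  set δ : ℝ := (∑ p ∈ S, density R S p) / S.card with hδ
  set b : ℝ := ((S ∩ B).card : ℝ) with hb
  set x : ℝ := η + 3 * lam * (τ * (3 / 4)) * S.card with hx
  set q : α → ℝ := fun p => (1 - density R S p) ^ N with hq
  have hq0 : ∀ p, 0 ≤ q p := fun p => pow_nonneg (by linarith [density_le_one R S p]) _
  have hq1 : ∀ p, q p ≤ 1 := fun p =>
    pow_le_one₀ (by linarith [density_le_one R S p]) (by linarith [density_nonneg R S p])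
  have hδ0 : 0 ≤ δ := div_nonneg (sum_nonneg fun p _ => density_nonneg R S p) hs.le
  have hδ1 : δ ≤ 1 := by
    rw [hδ, div_le_one hs]
    calc ∑ p ∈ S, density R S p ≤ ∑ p ∈ S, (1 : ℝ) := sum_le_sum fun p _ => density_le_one R S p
      _ = _ := by simp
  set A : ℝ := (∑ p ∈ S, q p) / S.card with hA
  set Γ : ℝ := (∑ p ∈ S, q p * separation R S p) / S.card with hΓ
  set β : ℝ := (∑ p ∈ S, q p * (2 * j p)) / S.card with hβ
  have hA0 : 0 ≤ A := div_nonneg (sum_nonneg fun p _ => hq0 p) hs.le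
  have hA1 : A ≤ 1 := by
    rw [hA, div_le_one hs]
    calc ∑ p ∈ S, q p ≤ ∑ p ∈ S, (1 : ℝ) := sum_le_sum fun p _ => hq1 p
      _ = _ := by simp
  have hΓ0 : 0 ≤ Γ := div_nonneg
    (sum_nonneg fun p hp => mul_nonneg (hq0 p) (separation_nonneg h hp)) hs.le
  have hβ' : β ≤ b / M := by
    rw [hβ, div_le_iff₀ hs]
    calc ∑ p ∈ S, q p * (2 * j p) = ∑ p ∈ S ∩ B, q p * (2 * j p) := by
          rw [← filter_mem_eq_inter, sum_filter]
          refine sum_congr rfl fun p hp => ?_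
          split_ifs with hpB
          · rfl
          · simp [hjB p hp hpB]
      _ ≤ ∑ p ∈ S ∩ B, (S.card : ℝ) / M := by
          refine sum_le_sum fun p hp => ?_
          refine pass_mul_misplaced_le hs hMr (density_nonneg R S p) (density_le_one R S p)
            (by positivity) ?_ hNr
          unfold density
          gcongr
          exact_mod_cast hj p (mem_inter.1 hp).1
      _ = b / M * S.card := by rw [sum_const, nsmul_eq_mul]; ring
  have hbs : b ≤ S.card := by
    rw [hb]; exact_mod_cast card_le_card inter_subset_left
  have hnnr : (S.card : ℝ) ≤ nn := by exact_mod_cast hnn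
  have hcase : 1 / 4 ≤ Γ ∨ (1 - δ) ^ F ≤ 1 / (2 * nn) := by
    by_cases hc : 1 / (12 * N) ≤ δ
    · exact Or.inr (hF δ hc hδ1)
    · left
      have hNpos : (0 : ℝ) < N := by rw [hNr]; positivity
      have h1 : N * ∑ p ∈ S, density R S p ≤ S.card / 12 := by
        have : δ ≤ 1 / (12 * N) := (not_le.1 hc).le
        rw [hδ, div_le_div_iff₀ hs (by positivity)] at this
        linarith
      rw [hΓ, le_div_iff₀ hs]
      have h2 : ∑ p ∈ S, (separation R S p - N * density R S p) ≤
          ∑ p ∈ S, q p * separation R S p := by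
        refine sum_le_sum fun p hp => ?_
        have h3 : 1 - N * density R S p ≤ q p := by
          have := one_add_mul_le_pow (a := - density R S p)
            (by linarith [density_le_one R S p]) N
          calc 1 - N * density R S p = 1 + N * (- density R S p) := by ring
            _ ≤ (1 + - density R S p) ^ N := this
            _ = q p := by simp only [hq, sub_eq_add_neg]
        have h4 := separation_le_one R S p
        have h5 := separation_nonneg h hp
        have h6 : 0 ≤ N * density R S p := mul_nonneg hNpos.le (density_nonneg R S p)
        nlinarith
      rw [sum_sub_distrib, ← mul_sum] at h2
      have h7 := card_div_three_le_sum_separation h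
      linarith
  have hfin := potential_change_le (pow_nonneg (by linarith) F : (0 : ℝ) ≤ (1 - δ) ^ F)
    (pow_le_one₀ (by linarith) (by linarith)) hA1 hΓ0 hβ' (by positivity : 0 ≤ b) hMr hal hη hMη
    hlam hτ hs.le (hbs.trans hnnr) hnnr
    (by have : (1 : ℝ) ≤ S.card := by exact_mod_cast hS.card_pos
        linarith) hcase
  have hsum : (∑ p ∈ S, (q p * (Φ + 2 * j p - al * b / 2 * separation R S p +
            lam * (S.card : ℝ) ^ 2 * τ * (1 / 4 - separation R S p)) +
        (1 - q p) * (Φ - x))) / S.card =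
      Φ - x + A * x + (β - al * b / 2 * Γ + lam * (S.card : ℝ) ^ 2 * τ * (A / 4 - Γ)) := by
    have : ∀ p, q p * (Φ + 2 * j p - al * b / 2 * separation R S p +
            lam * (S.card : ℝ) ^ 2 * τ * (1 / 4 - separation R S p)) +
        (1 - q p) * (Φ - x) = (Φ - x) + x * q p + q p * (2 * j p) -
          (al * b / 2 + lam * (S.card : ℝ) ^ 2 * τ) * (q p * separation R S p) +
          lam * (S.card : ℝ) ^ 2 * τ / 4 * q p := fun p => by ring
    simp_rw [this, sum_add_distrib, sum_sub_distrib, sum_add_distrib, ← mul_sum, sum_const,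
      nsmul_eq_mul]
    rw [hA, hΓ, hβ]
    field_simp
    ring_nf
  rw [hsum]
  rw [← hx] at hfin
  linarith

end

end RobustSort

namespace RobustSort

open scoped ENNReal

/-! ### Removing a triangle and splitting a segment on the machine -/

/-- Exchange the first vertex of the segment with the one whose position is in register `x`. -/
def swapFront (x : ℕ) : Cmd :=
  .seq (.assign 18 (.load 0 (.reg 4)))
    (.seq (.store 0 (.reg 4) (.load 0 (.reg x))) (.store 0 (.reg x) (.reg 18)))

/-- If register `y` points to the front of the segment, let it follow the exchange with `x`. -/
def redirect (y x : ℕ) : Cmd :=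
  .ite (.eq (.reg y) (.reg 4)) (.assign y (.reg x)) (.assign 18 (.lit 0))

/-- Drop the first vertex of the segment. -/
def advance : Cmd := .assign 4 (.add (.reg 4) (.lit 1))

/-- Record right end and remaining depth of the segment that begins at `lo`, if it is nonempty. -/
def recordRest : Cmd :=
  .ite (.lt (.reg 4) (.reg 6))
    (.seq (.store 2 (.reg 4) (.reg 6)) (.store 3 (.reg 4) (.reg 14)))
    (.assign 18 (.lit 0))

/-- Move the vertices at the three sampled positions to the front of the segment and drop them. -/
def removeTriangle : Cmd :=
  .seq (swapFront 15) (.seq (redirect 16 15) (.seq (redirect 17 15) (.seq advance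
    (.seq (swapFront 16) (.seq (redirect 17 16) (.seq advance
      (.seq (swapFront 17) (.seq advance recordRest))))))))

/-- Append the vertices of the segment that pass the query `e → f` to the scratch array. -/
def filterLoop (e f : Expr) : Cmd :=
  .seq (.assign 7 (.reg 4))
    (.loop (.lt (.reg 7) (.reg 6))
      (.seq (.query 10 e f)
        (.seq
          (.ite (.reg 10)
            (.seq (.store 1 (.reg 9) (.load 0 (.reg 7))) (.assign 9 (.add (.reg 9) (.lit 1))))
            (.assign 18 (.lit 0)))
          (.assign 7 (.add (.reg 7) (.lit 1))))))

/-- Record the segments to the left and to the right of the pivot, and the pivot itself as a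
segment that is done. -/
def recordSplit : Cmd :=
  .seq (.store 2 (.reg 4) (.reg 5))
    (.seq (.store 3 (.reg 4) (.sub (.reg 14) (.lit 1)))
      (.seq (.store 2 (.reg 5) (.add (.reg 5) (.lit 1)))
        (.seq (.store 3 (.reg 5) (.lit 0))
          (.ite (.lt (.add (.reg 5) (.lit 1)) (.reg 6))
            (.seq (.store 2 (.add (.reg 5) (.lit 1)) (.reg 6))
              (.store 3 (.add (.reg 5) (.lit 1)) (.sub (.reg 14) (.lit 1))))
            (.assign 18 (.lit 0))))))

/-- Split the segment at the pivot in position `p`, keeping the order on both sides. -/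
def splitSegment : Cmd :=
  .seq
    (.seq (.assign 11 (.load 0 (.reg 15)))
      (.seq (.assign 9 (.reg 4))
        (.seq (filterLoop (.load 0 (.reg 7)) (.reg 11))
          (.seq (.assign 5 (.reg 9))
            (.seq (.store 1 (.reg 9) (.reg 11))
              (.seq (.assign 9 (.add (.reg 9) (.lit 1)))
                (filterLoop (.reg 11) (.load 0 (.reg 7)))))))))
    (.seq copyBack recordSplit)

theorem slice_swap_perm (a : ℕ → ℕ) {lo hi x y : ℕ} (hx : lo ≤ x ∧ x < hi) (hy : lo ≤ y ∧ y < hi) :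
    (slice (fun i => a (Equiv.swap x y i)) lo hi).Perm (slice a lo hi) := by
  have : slice (fun i => a (Equiv.swap x y i)) lo hi =
      ((List.Ico lo hi).map (Equiv.swap x y)).map a := by simp [slice]
  rw [this]
  refine List.Perm.map a ?_
  rw [List.perm_ext_iff_of_nodup ((List.Ico.nodup lo hi).map (Equiv.injective _))
    (List.Ico.nodup lo hi)]
  have hmem : ∀ z, lo ≤ z ∧ z < hi → lo ≤ Equiv.swap x y z ∧ Equiv.swap x y z < hi := by
    intro z hz
    rw [Equiv.swap_apply_def]
    split_ifs <;> assumption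
  intro z
  simp only [List.mem_map, List.Ico.mem]
  constructor
  · rintro ⟨z, hz, rfl⟩
    exact hmem z hz
  · intro hz
    exact ⟨Equiv.swap x y z, hmem z hz, by simp⟩

section

variable {n : ℕ} {W : ℕ} {G : Digraph (Fin n)}

theorem swapFront_runs (s : State) {x : ℕ} (hx : x ≠ 18) :
    ∃ s', Runs W G 5 (swapFront x) s s' ∧ Same [18] [0] s s' ∧
      s'.mem 0 = fun i => s.mem 0 (Equiv.swap (s.reg 4) (s.reg x) i) := by
  refine ⟨_, runs_exec_of_size_le s (by simp [swapFront, Cmd.Straight])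
    (by simp [swapFront, Cmd.size]), ?_, ?_⟩
  · exact (((Same.refl _ _ _).setReg (by simp)).setMem (by simp)).setMem (by simp)
  · funext i
    simp only [swapFront, Cmd.exec, Expr.eval, State.setMem_mem, State.setReg_mem,
      State.setMem_reg, State.setReg_reg, hx, if_false, if_true, true_and,
      if_neg (show ¬ 4 = 18 by decide), Equiv.swap_apply_def]
    by_cases h1 : i = s.reg x
    · by_cases h2 : i = s.reg 4
      · have : s.reg x = s.reg 4 := by rw [← h1, h2]
        simp [h2, this]
      · simp [h1]
        grind
    · by_cases h2 : i = s.reg 4 <;> simp [h1, h2]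
      grind

theorem redirect_runs (s : State) {x y : ℕ} (hne : s.reg y ≠ s.reg x) (hy : y ≠ 18) :
    ∃ s', Runs W G 2 (redirect y x) s s' ∧ Same [18, y] [] s s' ∧
      s'.reg y = Equiv.swap (s.reg 4) (s.reg x) (s.reg y) := by
  refine ⟨_, runs_exec_of_size_le s (by simp [redirect, Cmd.Straight])
    (by simp [redirect, Cmd.size]), ?_, ?_⟩
  · simp only [redirect, Cmd.exec]
    split_ifs
    · exact (Same.refl _ _ _).setReg (by simp)
    · exact (Same.refl _ _ _).setReg (by simp)
  · by_cases h : s.reg y = s.reg 4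
    · simp [redirect, Cmd.exec, Expr.eval, State.setReg_reg, h]
    · simp [redirect, Cmd.exec, Expr.eval, State.setReg_reg, h, hy,
        Equiv.swap_apply_of_ne_of_ne h hne]

theorem advance_runs {s : State} (h : s.reg 4 + 1 < W) :
    ∃ s', Runs W G 1 advance s s' ∧ Same [4] [] s s' ∧ s'.reg 4 = s.reg 4 + 1 := by
  refine ⟨_, runs_exec_of_size_le s trivial le_rfl, (Same.refl _ _ _).setReg (by simp), ?_⟩
  simp only [advance, Cmd.exec, State.setReg_reg, if_true, Expr.eval]
  rw [Nat.mod_eq_of_lt (a := 1) (by omega), Nat.mod_eq_of_lt h]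

theorem recordRest_runs (s : State) :
    ∃ s', Runs W G 4 recordRest s s' ∧ Same [18] [2, 3] s s' ∧
      (s.reg 4 < s.reg 6 → s'.mem 2 (s.reg 4) = s.reg 6 ∧ s'.mem 3 (s.reg 4) = s.reg 14) ∧
      ∀ a i, i ≠ s.reg 4 ∨ s.reg 6 ≤ s.reg 4 → s'.mem a i = s.mem a i := by
  refine ⟨_, runs_exec_of_size_le s (by simp [recordRest, Cmd.Straight])
    (by simp [recordRest, Cmd.size]), ?_⟩
  by_cases h : s.reg 4 < s.reg 6
  · simp only [recordRest, Cmd.exec, Expr.eval, h, if_true, ne_eq, one_ne_zero, not_false_eq_true,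
      State.setMem_reg]
    refine ⟨((Same.refl _ _ _).setMem (by simp)).setMem (by simp), by simp [State.setMem_mem], ?_⟩
    intro a i hi
    have : i ≠ s.reg 4 := by omega
    simp [State.setMem_mem, this]
  · simp only [recordRest, Cmd.exec, Expr.eval, h, if_false, ne_eq, not_true_eq_false]
    exact ⟨(Same.refl _ _ _).setReg (by simp), by simp, fun a i _ => by rw [State.setReg_mem]⟩

theorem removeTriangle_runs {s : State} {lo hi p u v : ℕ} (h4 : s.reg 4 = lo) (h6 : s.reg 6 = hi)
    (h15 : s.reg 15 = p) (h16 : s.reg 16 = u) (h17 : s.reg 17 = v) (hp : lo ≤ p ∧ p < hi)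
    (hu : lo ≤ u ∧ u < hi) (hv : lo ≤ v ∧ v < hi) (hpu : p ≠ u) (huv : u ≠ v) (hvp : v ≠ p)
    (hW : hi + 1 < W) :
    lo + 3 ≤ hi ∧
    ∃ s', Runs W G 40 removeTriangle s s' ∧ Same [4, 16, 17, 18] [0, 2, 3] s s' ∧
      s'.reg 4 = lo + 3 ∧ s'.mem 0 lo = s.mem 0 p ∧ s'.mem 0 (lo + 1) = s.mem 0 u ∧
      s'.mem 0 (lo + 2) = s.mem 0 v ∧ (slice (s'.mem 0) lo hi).Perm (slice (s.mem 0) lo hi) ∧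
      (lo + 3 < hi → s'.mem 2 (lo + 3) = hi ∧ s'.mem 3 (lo + 3) = s.reg 14) ∧
      (∀ i, ¬ (lo ≤ i ∧ i < hi) → s'.mem 0 i = s.mem 0 i) ∧
      ∀ a i, a ≠ 0 → hi ≤ i → s'.mem a i = s.mem a i := by
  have h3 : lo + 3 ≤ hi := by omega
  refine ⟨h3, ?_⟩
  obtain ⟨s₁, r₁, S₁, m₁⟩ := swapFront_runs (W := W) (G := G) s (x := 15) (by decide)
  have e4₁ : s₁.reg 4 = lo := (S₁.1 4 (by simp)).trans h4
  have e15₁ : s₁.reg 15 = p := (S₁.1 15 (by simp)).trans h15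
  have e16₁ : s₁.reg 16 = u := (S₁.1 16 (by simp)).trans h16
  obtain ⟨s₂, r₂, S₂, e16₂⟩ := redirect_runs (W := W) (G := G) s₁ (x := 15) (y := 16)
    (by rw [e15₁, e16₁]; exact hpu.symm) (by decide)
  rw [e4₁, e15₁, e16₁] at e16₂
  have e4₂ : s₂.reg 4 = lo := (S₂.1 4 (by simp)).trans e4₁
  have e15₂ : s₂.reg 15 = p := (S₂.1 15 (by simp)).trans e15₁
  have e17₂ : s₂.reg 17 = v := (S₂.1 17 (by simp)).trans ((S₁.1 17 (by simp)).trans h17)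
  obtain ⟨s₃, r₃, S₃, e17₃⟩ := redirect_runs (W := W) (G := G) s₂ (x := 15) (y := 17)
    (by rw [e15₂, e17₂]; exact hvp) (by decide)
  rw [e4₂, e15₂, e17₂] at e17₃
  have e4₃ : s₃.reg 4 = lo := (S₃.1 4 (by simp)).trans e4₂
  have e16₃ : s₃.reg 16 = Equiv.swap lo p u := (S₃.1 16 (by simp)).trans e16₂
  obtain ⟨s₄, r₄, S₄, e4₄⟩ := advance_runs (W := W) (G := G) (s := s₃) (by omega)
  rw [e4₃] at e4₄
  have e16₄ : s₄.reg 16 = Equiv.swap lo p u := (S₄.1 16 (by simp)).trans e16₃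
  have e17₄ : s₄.reg 17 = Equiv.swap lo p v := (S₄.1 17 (by simp)).trans e17₃
  obtain ⟨s₅, r₅, S₅, m₅⟩ := swapFront_runs (W := W) (G := G) s₄ (x := 16) (by decide)
  have e4₅ : s₅.reg 4 = lo + 1 := (S₅.1 4 (by simp)).trans e4₄
  have e16₅ : s₅.reg 16 = Equiv.swap lo p u := (S₅.1 16 (by simp)).trans e16₄
  have e17₅ : s₅.reg 17 = Equiv.swap lo p v := (S₅.1 17 (by simp)).trans e17₄
  obtain ⟨s₆, r₆, S₆, e17₆⟩ := redirect_runs (W := W) (G := G) s₅ (x := 16) (y := 17)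
    (by rw [e16₅, e17₅]; exact fun h => huv ((Equiv.injective _ h).symm)) (by decide)
  rw [e4₅, e16₅, e17₅] at e17₆
  have e4₆ : s₆.reg 4 = lo + 1 := (S₆.1 4 (by simp)).trans e4₅
  obtain ⟨s₇, r₇, S₇, e4₇⟩ := advance_runs (W := W) (G := G) (s := s₆) (by omega)
  rw [e4₆] at e4₇
  have e17₇ := (S₇.1 17 (by simp)).trans e17₆
  obtain ⟨s₈, r₈, S₈, m₈⟩ := swapFront_runs (W := W) (G := G) s₇ (x := 17) (by decide)
  have e4₈ : s₈.reg 4 = lo + 1 + 1 := (S₈.1 4 (by simp)).trans e4₇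
  obtain ⟨s₉, r₉, S₉, e4₉⟩ := advance_runs (W := W) (G := G) (s := s₈) (by omega)
  rw [e4₈] at e4₉
  obtain ⟨s', r', S', hrec, hframe⟩ := recordRest_runs (W := W) (G := G) s₉
  obtain ⟨u', hu'⟩ : ∃ x, x = Equiv.swap lo p u := ⟨_, rfl⟩
  obtain ⟨v', hv'⟩ : ∃ x, x = Equiv.swap lo p v := ⟨_, rfl⟩
  obtain ⟨v'', hv''⟩ : ∃ x, x = Equiv.swap (lo + 1) u' v' := ⟨_, rfl⟩
  rw [← hu'] at e16₄
  rw [← hu', ← hv', ← hv''] at e17₇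
  have M₄ : s₄.mem 0 = fun i => s.mem 0 (Equiv.swap lo p i) := by
    rw [S₄.2 0 (by simp), S₃.2 0 (by simp), S₂.2 0 (by simp), m₁, h4, h15]
  have M₇ : s₇.mem 0 = fun i => s₄.mem 0 (Equiv.swap (lo + 1) u' i) := by
    rw [S₇.2 0 (by simp), S₆.2 0 (by simp), m₅, e4₄, e16₄]
  have M' : s'.mem 0 = fun i => s₇.mem 0 (Equiv.swap (lo + 1 + 1) v'' i) := by
    rw [S'.2 0 (by simp), S₉.2 0 (by simp), m₈, e4₇, e17₇]
  have hu'r : lo < u' ∧ u' < hi := by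
    clear * - hu' hp hu hv hpu huv hvp h3 
    rw [hu', Equiv.swap_apply_def]; split_ifs <;> omega
  have hv'r : lo < v' ∧ v' < hi := by
    clear * - hv' hp hu hv hpu huv hvp h3 
    rw [hv', Equiv.swap_apply_def]; split_ifs <;> omega
  have huv' : v' ≠ u' := fun h => huv (Equiv.injective _ (hv'.symm.trans (h.trans hu'))).symm
  have hv''r : lo + 1 < v'' ∧ v'' < hi := by
    clear * - hv'' hp hu hv hpu huv hvp h3 hu'r hv'r huv'
    rw [hv'', Equiv.swap_apply_def]; split_ifs <;> omega
  have hS9 : Same [4, 16, 17, 18] [0, 2, 3] s s₉ :=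
    ((((((((S₁.mono (by simp) (by simp)).trans (S₂.mono (by simp) (by simp))).trans
      (S₃.mono (by simp) (by simp))).trans (S₄.mono (by simp) (by simp))).trans
      (S₅.mono (by simp) (by simp))).trans (S₆.mono (by simp) (by simp))).trans
      (S₇.mono (by simp) (by simp))).trans (S₈.mono (by simp) (by simp))).trans
      (S₉.mono (by simp) (by simp))
  have h6₉ : s₉.reg 6 = hi := (hS9.1 6 (by simp)).trans h6
  have hmem9 : ∀ a ≠ 0, s₉.mem a = s.mem a := by
    intro a ha
    rw [S₉.2 a (by simp), S₈.2 a (by simp [ha]), S₇.2 a (by simp), S₆.2 a (by simp),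
      S₅.2 a (by simp [ha]), S₄.2 a (by simp), S₃.2 a (by simp), S₂.2 a (by simp),
      S₁.2 a (by simp [ha])]
  refine ⟨s', (r₁.seq (r₂.seq (r₃.seq (r₄.seq (r₅.seq (r₆.seq (r₇.seq (r₈.seq
    (r₉.seq r'))))))))).mono (by norm_num), hS9.trans (S'.mono (by simp) (by simp)), ?_, ?_, ?_, ?_,
    ?_, ?_, ?_, ?_⟩
  · rw [S'.1 4 (by simp), e4₉]
  · rw [M', M₇, M₄]
    simp only
    rw [Equiv.swap_apply_of_ne_of_ne (x := lo) (a := lo + 1 + 1) (by omega) (by omega),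
      Equiv.swap_apply_of_ne_of_ne (x := lo) (a := lo + 1) (by omega) (by omega),
      Equiv.swap_apply_left]
  · rw [M', M₇, M₄]
    simp only
    rw [Equiv.swap_apply_of_ne_of_ne (x := lo + 1) (by omega) (by omega),
      Equiv.swap_apply_left, hu',
      Equiv.swap_apply_self]
  · rw [M', M₇, M₄]
    simp only
    rw [Equiv.swap_apply_left, hv'', Equiv.swap_apply_self, hv', Equiv.swap_apply_self]
  · rw [M', M₇, M₄]
    refine (slice_swap_perm (fun i => s.mem 0 (Equiv.swap lo p (Equiv.swap (lo + 1) u' i)))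
      (x := lo + 1 + 1) (y := v'') (by omega) (by omega)).trans ?_
    refine (slice_swap_perm (fun i => s.mem 0 (Equiv.swap lo p i))
      (x := lo + 1) (y := u') (by omega) (by omega)).trans ?_
    exact slice_swap_perm _ (by omega) (by omega)
  · intro h
    have := hrec (by omega)
    rw [e4₉, h6₉, hS9.1 14 (by simp)] at this
    exact this
  · intro i hi'
    rw [M', M₇, M₄]
    simp only
    rw [Equiv.swap_apply_of_ne_of_ne (x := i) (a := lo + 1 + 1) (by omega) (by omega),
      Equiv.swap_apply_of_ne_of_ne (x := i) (a := lo + 1) (by omega) (by omega),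
      Equiv.swap_apply_of_ne_of_ne (x := i) (by omega) (by omega)]
  · intro a i ha hi'
    rw [hframe a i (by omega), hmem9 a ha]

theorem filterLoop_runs {e f : Expr} {s : State} {lo hi k : ℕ} (h : ℕ → Bool)
    (h4 : s.reg 4 = lo) (h6 : s.reg 6 = hi) (h9 : s.reg 9 = k) (hlo : lo ≤ hi)
    (hW : k + (hi - lo) + hi < W)
    (hq : ∀ s', Same [7, 9, 10, 18] [1] s s' →
      (answer G (e.eval W s') (f.eval W s') ≠ 0 ↔ h (s.mem 0 (s'.reg 7)) = true)) :
    ∃ s', Runs W G ((hi - lo) * 12 + 5) (filterLoop e f) s s' ∧ Same [7, 9, 10, 18] [1] s s' ∧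
      s'.reg 9 = k + ((slice (s.mem 0) lo hi).filter h).length ∧
      slice (s'.mem 1) k (s'.reg 9) = (slice (s.mem 0) lo hi).filter h ∧
      ∀ i < k, s'.mem 1 i = s.mem 1 i := by
  let I : ℕ → State → Prop := fun t s' => Same [7, 9, 10, 18] [1] s s' ∧ s'.reg 7 = lo + t ∧
    s'.reg 9 = k + ((slice (s.mem 0) lo (lo + t)).filter h).length ∧
    slice (s'.mem 1) k (s'.reg 9) = (slice (s.mem 0) lo (lo + t)).filter h ∧
    ∀ i < k, s'.mem 1 i = s.mem 1 i
  obtain ⟨s', hr, hS, h7, h9', hm, hi'⟩ := Runs.for_loop (W := W) (G := G) (k := 10)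
    (e := .lt (.reg 7) (.reg 6))
    (c := (.seq (.query 10 e f)
        (.seq
          (.ite (.reg 10)
            (.seq (.store 1 (.reg 9) (.load 0 (.reg 7))) (.assign 9 (.add (.reg 9) (.lit 1))))
            (.assign 18 (.lit 0)))
          (.assign 7 (.add (.reg 7) (.lit 1)))))) I (hi - lo)
    (by
      rintro t ht s₁ ⟨hS, h7, h9', hm, hfr⟩
      have h6₁ : s₁.reg 6 = hi := (hS.1 6 (by simp)).trans h6
      have hM : s₁.mem 0 = s.mem 0 := hS.2 0 (by simp)
      refine ⟨by simp [Expr.eval, h7, h6₁]; omega, _,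
        runs_exec_of_size_le s₁ (by simp [Cmd.Straight]) (by simp [Cmd.size]), ?_⟩
      have hqa := hq s₁ hS
      rw [h7] at hqa
      have hlen := List.length_filter_le h (slice (s.mem 0) lo (lo + t))
      rw [length_slice] at hlen
      have hsucc : slice (s.mem 0) lo (lo + (t + 1)) =
          slice (s.mem 0) lo (lo + t) ++ [s.mem 0 (lo + t)] := by
        rw [← add_assoc, slice_succ _ (by omega)]
      have m0 : 1 % W = 1 := Nat.mod_eq_of_lt (by omega)
      have m1 : (lo + t + 1) % W = lo + t + 1 := Nat.mod_eq_of_lt (by omega)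
      set k' := k + ((slice (s.mem 0) lo (lo + t)).filter h).length with hk'
      have m2 : (k' + 1) % W = k' + 1 := Nat.mod_eq_of_lt (by omega)
      by_cases ha : answer G (e.eval W s₁) (f.eval W s₁) = 0
      · have hh : h (s.mem 0 (lo + t)) = false := by simpa [ha] using hqa
        simp only [Cmd.exec, Expr.eval, State.setReg_reg, State.setReg_mem, if_true, ha, ne_eq,
          not_true_eq_false, if_false, if_neg (show ¬ 7 = 18 by decide),
          if_neg (show ¬ 7 = 10 by decide), h7, m0, m1]
        refine ⟨(((hS.setReg (by simp)).query.setReg (by simp))).setReg (by simp),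
          by simp [State.setReg_reg]; ring, ?_, ?_, ?_⟩
        · simp [State.setReg_reg, hsucc, List.filter_append, hh, h9', hk']
        · simp only [State.setReg_reg, State.setReg_mem, hsucc, List.filter_append,
            if_neg (show ¬ 9 = 7 by decide), if_neg (show ¬ 9 = 18 by decide),
            if_neg (show ¬ 9 = 10 by decide)]
          rw [hm]; simp [hh]
        · exact hfr
      · have hh : h (s.mem 0 (lo + t)) = true := hqa.1 ha
        simp only [Cmd.exec, Expr.eval, State.setReg_reg, State.setReg_mem, if_true, ha, ne_eq,
          not_false_eq_true, State.setMem_reg, if_neg (show ¬ 7 = 9 by decide),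
          if_neg (show ¬ 9 = 10 by decide),
          if_neg (show ¬ 7 = 10 by decide), h7, m0, m1, hM, h9', m2]
        refine ⟨(((hS.setReg (by simp)).query.setMem (by simp)).setReg (by simp)).setReg (by simp),
          by simp [State.setReg_reg]; ring, ?_, ?_, ?_⟩
        · simp [State.setReg_reg, hsucc, List.filter_append, hh, hk', add_assoc]
        · simp only [State.setReg_reg, State.setReg_mem, hsucc, List.filter_append, if_true,
            if_neg (show ¬ 9 = 7 by decide)]
          rw [slice_succ _ (by omega)]
          congr 1
          · rw [h9'] at hm
            rw [← hm]
            refine slice_congr fun x hx hx' => ?_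
            rw [State.setMem_mem, if_neg (by omega)]
          · rw [State.setMem_mem, if_pos (by simp)]; simp [hh]
        · intro i hi'
          rw [State.setReg_mem, State.setReg_mem, State.setMem_mem, if_neg (by omega)]
          exact hfr i hi')
    (by
      rintro s₁ ⟨hS, h7, -⟩
      have h6₁ : s₁.reg 6 = hi := (hS.1 6 (by simp)).trans h6
      simp [Expr.eval, h7, h6₁]; omega)
    (s := s.setReg 7 lo)
    ⟨(Same.refl _ _ _).setReg (by simp), by simp [State.setReg_reg],
      by simp [State.setReg_reg, h9], by simp [State.setReg_reg, h9], fun _ _ => rfl⟩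
  have a1 := runs_exec (W := W) (G := G) (c := .assign 7 (.reg 4)) trivial s
  simp only [Cmd.exec, Expr.eval, h4] at a1
  rw [show lo + (hi - lo) = hi by omega] at h9' hm
  exact ⟨s', (a1.seq hr).mono (by simp only [Cmd.size]; omega), hS, h9', hm, hi'⟩

end

section

variable {n : ℕ} {W : ℕ} {G : Digraph (Fin n)}

theorem recordSplit_runs {s : State} {lo mid hi : ℕ} (h4 : s.reg 4 = lo) (h5 : s.reg 5 = mid)
    (h6 : s.reg 6 = hi) (hlo : lo ≤ mid) (hmid : mid < hi) (hW : hi + 1 < W) :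
    ∃ s', Runs W G 15 recordSplit s s' ∧ Same [18] [2, 3] s s' ∧
      (lo < mid → s'.mem 2 lo = mid ∧ s'.mem 3 lo = s.reg 14 - 1) ∧
      (s'.mem 2 mid = mid + 1 ∧ s'.mem 3 mid = 0) ∧
      (mid + 1 < hi → s'.mem 2 (mid + 1) = hi ∧ s'.mem 3 (mid + 1) = s.reg 14 - 1) ∧
      ∀ a i, hi ≤ i → s'.mem a i = s.mem a i := by
  refine ⟨_, runs_exec_of_size_le s (by simp [recordSplit, Cmd.Straight])
    (by simp [recordSplit, Cmd.size]), ?_⟩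
  have m0 : 1 % W = 1 := Nat.mod_eq_of_lt (by omega)
  have m1 : (mid + 1) % W = mid + 1 := Nat.mod_eq_of_lt (by omega)
  by_cases h : mid + 1 < hi
  · simp only [recordSplit, Cmd.exec, Expr.eval, State.setMem_reg, h4, h5, h6, m0, m1, h,
      if_true, ne_eq, one_ne_zero, not_false_eq_true, Nat.zero_mod]
    refine ⟨((((((Same.refl _ _ _).setMem (by simp)).setMem (by simp)).setMem (by simp)).setMem
      (by simp)).setMem (by simp)).setMem (by simp), fun hlt => ?_, ?_, fun _ => ?_,
      fun a i hi => ?_⟩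
    · have e1 : lo ≠ mid := by omega
      have e2 : lo ≠ mid + 1 := by omega
      simp [State.setMem_mem, e1, e2]
    · simp [State.setMem_mem]
    · simp [State.setMem_mem]
    · have e1 : i ≠ mid := by omega
      have e2 : i ≠ mid + 1 := by omega
      have e3 : i ≠ lo := by omega
      simp [State.setMem_mem, e1, e2, e3]
  · simp only [recordSplit, Cmd.exec, Expr.eval, State.setMem_reg, h4, h5, h6, m0, m1, h,
      if_false, ne_eq, not_true_eq_false, Nat.zero_mod]
    refine ⟨((((((Same.refl _ _ _).setMem (by simp)).setMem (by simp)).setMem (by simp)).setMem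
      (by simp))).setReg (by simp), fun hlt => ?_, ?_, fun hf => hf.elim,
      fun a i hi => ?_⟩
    · have e1 : lo ≠ mid := by omega
      simp [State.setMem_mem, State.setReg_mem, e1]
    · simp [State.setMem_mem, State.setReg_mem]
    · have e1 : i ≠ mid := by omega
      have e3 : i ≠ lo := by omega
      simp [State.setMem_mem, State.setReg_mem, e1, e3]

theorem splitSegment_runs {s : State} {lo hi p : ℕ} (h4 : s.reg 4 = lo) (h6 : s.reg 6 = hi)
    (h15 : s.reg 15 = p) (hlo : lo ≤ hi) (hW : 3 * hi + 3 < W) {L R : List ℕ}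
    (hL : L = (slice (s.mem 0) lo hi).filter fun x => decide (answer G x (s.mem 0 p) ≠ 0))
    (hR : R = (slice (s.mem 0) lo hi).filter fun x => decide (answer G (s.mem 0 p) x ≠ 0))
    (hlen : L.length + 1 + R.length = hi - lo) :
    ∃ s', Runs W G ((hi - lo) * 28 + 50) splitSegment s s' ∧
      Same [5, 7, 9, 10, 11, 18] [0, 1, 2, 3] s s' ∧
      slice (s'.mem 0) lo hi = L ++ s.mem 0 p :: R ∧
      (∀ i, ¬ (lo ≤ i ∧ i < hi) → s'.mem 0 i = s.mem 0 i) ∧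
      (0 < L.length → s'.mem 2 lo = lo + L.length ∧ s'.mem 3 lo = s.reg 14 - 1) ∧
      (s'.mem 2 (lo + L.length) = lo + L.length + 1 ∧ s'.mem 3 (lo + L.length) = 0) ∧
      (lo + L.length + 1 < hi → s'.mem 2 (lo + L.length + 1) = hi ∧
        s'.mem 3 (lo + L.length + 1) = s.reg 14 - 1) ∧
      ∀ a i, a = 2 ∨ a = 3 → hi ≤ i → s'.mem a i = s.mem a i := by
  set pv := s.mem 0 p with hpv
  set s₁ := (s.setReg 11 pv).setReg 9 lo with hs₁
  have S₁ : Same [5, 7, 9, 10, 11, 18] [1] s s₁ :=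
    ((Same.refl _ _ _).setReg (by simp)).setReg (by simp)
  have e11₁ : s₁.reg 11 = pv := by simp [hs₁, State.setReg_reg]
  have M₁ : s₁.mem 0 = s.mem 0 := rfl
  obtain ⟨s₂, r₂, S₂, e9₂, hm₂, -⟩ := filterLoop_runs (W := W) (G := G) (s := s₁)
    (e := .load 0 (.reg 7)) (f := .reg 11) (lo := lo) (hi := hi) (k := lo)
    (fun x => decide (answer G x pv ≠ 0)) ((S₁.1 4 (by simp)).trans h4)
    ((S₁.1 6 (by simp)).trans h6) (by simp [hs₁, State.setReg_reg]) hlo (by omega) (by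
      intro s' hS'
      simp only [Expr.eval, decide_eq_true_eq]
      rw [hS'.2 0 (by simp), hS'.1 11 (by simp), e11₁])
  rw [M₁, ← hL] at hm₂ e9₂
  obtain ⟨mid, hmid⟩ : ∃ mid, mid = lo + L.length := ⟨_, rfl⟩
  rw [← hmid] at e9₂ ⊢
  rw [e9₂] at hm₂
  have S₂' : Same [5, 7, 9, 10, 11, 18] [1] s s₂ := S₁.trans (S₂.mono (by simp) (by simp))
  have e11₂ : s₂.reg 11 = pv := (S₂.1 11 (by simp)).trans e11₁
  set s₃ := ((s₂.setReg 5 mid).setMem 1 mid pv).setReg 9 (mid + 1) with hs₃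
  have S₃ : Same [5, 7, 9, 10, 11, 18] [1] s s₃ :=
    ((S₂'.setReg (by simp)).setMem (by simp)).setReg (by simp)
  have e11₃ : s₃.reg 11 = pv := by
    simp [hs₃, State.setReg_reg, State.setMem_reg, e11₂]
  have M₃ : s₃.mem 0 = s.mem 0 := S₃.2 0 (by simp)
  obtain ⟨s₄, r₄, S₄, e9₄, hm₄, hfr₄⟩ := filterLoop_runs (W := W) (G := G) (s := s₃)
    (e := .reg 11) (f := .load 0 (.reg 7)) (lo := lo) (hi := hi) (k := mid + 1)
    (fun x => decide (answer G pv x ≠ 0)) ((S₃.1 4 (by simp)).trans h4)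
    ((S₃.1 6 (by simp)).trans h6) (by simp [hs₃, State.setReg_reg]) hlo (by omega) (by
      intro s' hS'
      simp only [Expr.eval, decide_eq_true_eq]
      rw [hS'.2 0 (by simp), hS'.1 11 (by simp), e11₃])
  rw [M₃, ← hR] at hm₄ e9₄
  rw [e9₄, show mid + 1 + R.length = hi by omega] at hm₄
  have S₄' : Same [5, 7, 9, 10, 11, 18] [1] s s₄ := S₃.trans (S₄.mono (by simp) (by simp))
  have e5₄ : s₄.reg 5 = mid := by
    rw [S₄.1 5 (by simp)]; simp [hs₃, State.setReg_reg, State.setMem_reg]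
  have e4₄ : s₄.reg 4 = lo := (S₄'.1 4 (by simp)).trans h4
  have e6₄ : s₄.reg 6 = hi := (S₄'.1 6 (by simp)).trans h6
  obtain ⟨s₅, r₅, S₅, hm₅⟩ := copyBack_runs (G := G) (W := W) (s := s₄) (by omega) (by omega)
  rw [e4₄, e6₄] at hm₅ r₅
  have e5₅ : s₅.reg 5 = mid := (S₅.1 5 (by simp)).trans e5₄
  have e4₅ : s₅.reg 4 = lo := (S₅.1 4 (by simp)).trans e4₄
  have e6₅ : s₅.reg 6 = hi := (S₅.1 6 (by simp)).trans e6₄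
  obtain ⟨s', r', S', hl, hp, hr, hfr⟩ := recordSplit_runs (G := G) (W := W) e4₅ e5₅ e6₅
    (by omega) (by omega) (by omega)
  have e14 : s₅.reg 14 = s.reg 14 := (S₅.1 14 (by simp)).trans (S₄'.1 14 (by simp))
  rw [e14] at hl hr
  have M' : ∀ i, s'.mem 0 i = if lo ≤ i ∧ i < hi then s₄.mem 1 i else s.mem 0 i := by
    intro i
    rw [S'.2 0 (by simp), hm₅, S₄'.2 0 (by simp)]
  refine ⟨s', ?_, (S₄'.mono (by simp) (by simp)).trans
    ((S₅.mono (by simp) (by simp)).trans (S'.mono (by simp) (by simp))), ?_, ?_,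
    fun h => hl (by omega), hp, hr, ?_⟩
  · have m0 : 1 % W = 1 := Nat.mod_eq_of_lt (by omega)
    have m1 : (mid + 1) % W = mid + 1 := Nat.mod_eq_of_lt (by omega)
    have a1 := runs_exec (W := W) (G := G) (c := .assign 11 (.load 0 (.reg 15))) trivial s
    have a2 := runs_exec (W := W) (G := G) (c := .assign 9 (.reg 4)) trivial (s.setReg 11 pv)
    have a3 := runs_exec (W := W) (G := G) (c := .assign 5 (.reg 9)) trivial s₂
    have a4 := runs_exec (W := W) (G := G) (c := .store 1 (.reg 9) (.reg 11)) trivial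
      (s₂.setReg 5 mid)
    have a5 := runs_exec (W := W) (G := G) (c := .assign 9 (.add (.reg 9) (.lit 1))) trivial
      ((s₂.setReg 5 mid).setMem 1 mid pv)
    simp only [Cmd.exec, Expr.eval, State.setReg_reg, State.setMem_reg, h15, ← hpv, e9₂, e11₂, m0,
      m1, h4, if_neg (show ¬ 4 = 11 by decide), if_neg (show ¬ 9 = 5 by decide),
      if_neg (show ¬ 11 = 5 by decide)] at a1 a2 a3 a4 a5
    refine ((a1.seq (a2.seq (r₂.seq (a3.seq (a4.seq (a5.seq r₄)))))).seq (r₅.seq r')).mono ?_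
    simp only [Cmd.size]
    omega
  · rw [slice_congr (b := s₄.mem 1) fun i h1 h2 => by rw [M', if_pos ⟨h1, h2⟩],
      ← slice_append (s₄.mem 1) (show lo ≤ mid by omega) (show mid ≤ hi by omega),
      slice_cons (s₄.mem 1) (show mid < hi by omega), hm₄, hfr₄ mid (by omega)]
    congr 1
    · rw [← hm₂]
      refine slice_congr fun i h1 h2 => ?_
      rw [hfr₄ i (by omega), hs₃, State.setReg_mem, State.setMem_mem, if_neg (by omega)]
      rfl
    · rw [hs₃, State.setReg_mem, State.setMem_mem, if_pos (by simp)]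
  · intro i hi'
    rw [M', if_neg hi']
  · intro a i ha hi'
    rw [hfr a i hi', S₅.2 a (by rcases ha with rfl | rfl <;> simp),
      S₄'.2 a (by rcases ha with rfl | rfl <;> simp)]

end

end RobustSort

namespace RobustSort

open scoped ENNReal
open Finset (Ico)

/-! ### Sampling for triangles on the machine -/

/-- Sample a position of the segment. -/
def pickPosition (x : ℕ) : Cmd :=
  .seq (.rand x (.sub (.reg 6) (.reg 4))) (.assign x (.add (.reg 4) (.reg x)))

/-- Test the sampled triple; a triangle stops the sampling. -/
def checkTriple : Cmd :=
  .seq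
    (.seq (.query 10 (.load 0 (.reg 15)) (.load 0 (.reg 16)))
      (.ite (.reg 10)
        (.seq (.query 10 (.load 0 (.reg 16)) (.load 0 (.reg 17)))
          (.ite (.reg 10) (.query 10 (.load 0 (.reg 17)) (.load 0 (.reg 15)))
            (.assign 18 (.lit 0))))
        (.assign 18 (.lit 0))))
    (.ite (.reg 10) (.assign 7 (.lit 0)) (.assign 7 (.sub (.reg 7) (.lit 1))))

/-- Sample a pair and test it with the current pivot. -/
def testPivot : Cmd := .seq (pickPosition 16) (.seq (pickPosition 17) checkTriple)

/-- One round of sampling; the pivot is not changed any more in the last rounds. -/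
def sampleRound : Cmd :=
  .seq (.ite (.lt (.reg 7) (.reg 12)) (.assign 18 (.lit 0)) (pickPosition 15)) testPivot

/-- Sample triples until a triangle has been found or the sample size has been reached. The last
pivot is the one that is used if there was no triangle. -/
def sampling : Cmd :=
  .seq (.assign 7 (.reg 13)) (.seq (.assign 10 (.lit 0)) (.loop (.reg 7) sampleRound))

section

variable {n : ℕ} {W : ℕ} {G : Digraph (Fin n)} {g : State → ℝ≥0∞}

/-- The arcs between positions, when position `i` is occupied by the vertex `a i`. -/
def arc (G : Digraph (Fin n)) (a : ℕ → ℕ) (i j : ℕ) : Prop := answer G (a i) (a j) ≠ 0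

theorem CostLE.pick {t x lo hi : ℕ} {K : List Cmd} {s : State} {ℓ : ℕ → ℝ} (h4 : s.reg 4 = lo)
    (h6 : s.reg 6 = hi) (hx : x ≠ 4) (hlo : lo < hi) (hW : hi < W)
    (h : ∀ p ∈ Ico lo hi, ∀ s', Same [x] [] s s' → s'.reg x = p → CostLE W G g t (K, s') (ℓ p)) :
    CostLE W G g (t + 3) (pickPosition x :: K, s) ((∑ p ∈ Ico lo hi, ℓ p) / (Ico lo hi).card) := by
  rw [Finset.sum_Ico_eq_sum_range, Nat.card_Ico]
  refine CostLE.seq (CostLE.rand (t := t + 1) (v := hi - lo) (by simp [Expr.eval, h4, h6])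
    (by omega) fun i hi' => ?_)
  have a1 := runs_exec (W := W) (G := G) (c := .assign x (.add (.reg 4) (.reg x))) trivial
    (s.setReg x i)
  refine CostLE.of_runs a1 (h _ (by simp; omega) _ ?_ ?_)
  · exact ((Same.refl _ _ _).setReg (by simp)).setReg (by simp)
  · simp only [Cmd.exec, Expr.eval, State.setReg_reg, if_true, if_neg hx.symm, h4]
    exact Nat.mod_eq_of_lt (by omega)

theorem checkTriple_runs (s : State) (hW : 1 < W) :
    ∃ s', Runs W G 20 checkTriple s s' ∧ Same [7, 10, 18] [] s s' ∧
      (Triangle (arc G (s.mem 0)) (s.reg 15) (s.reg 16) (s.reg 17) →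
        s'.reg 10 ≠ 0 ∧ s'.reg 7 = 0) ∧
      (¬ Triangle (arc G (s.mem 0)) (s.reg 15) (s.reg 16) (s.reg 17) →
        s'.reg 10 = 0 ∧ s'.reg 7 = s.reg 7 - 1) := by
  refine ⟨_, runs_exec_of_size_le s (by simp [checkTriple, Cmd.Straight])
    (by simp [checkTriple, Cmd.size]), ?_⟩
  have m0 : 1 % W = 1 := Nat.mod_eq_of_lt hW
  unfold Triangle arc
  by_cases h1 : answer G (s.mem 0 (s.reg 15)) (s.mem 0 (s.reg 16)) = 0
  · simp [checkTriple, Cmd.exec, Expr.eval, State.setReg_reg, State.setReg_mem, h1, m0]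
    exact (((Same.refl _ _ _).setReg (by simp)).query.setReg (by simp)).setReg (by simp)
  by_cases h2 : answer G (s.mem 0 (s.reg 16)) (s.mem 0 (s.reg 17)) = 0
  · simp [checkTriple, Cmd.exec, Expr.eval, State.setReg_reg, State.setReg_mem, h1, h2, m0]
    exact ((((Same.refl _ _ _).setReg (by simp)).query.setReg (by simp)).query.setReg
      (by simp)).setReg (by simp)
  by_cases h3 : answer G (s.mem 0 (s.reg 17)) (s.mem 0 (s.reg 15)) = 0
  · simp [checkTriple, Cmd.exec, Expr.eval, State.setReg_reg, State.setReg_mem, h1, h2, h3, m0]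
    exact ((((Same.refl _ _ _).setReg (by simp)).query.setReg (by simp)).query.setReg
      (by simp)).query.setReg (by simp)
  · simp [checkTriple, Cmd.exec, Expr.eval, State.setReg_reg, State.setReg_mem, h1, h2, h3]
    exact ((((Same.refl _ _ _).setReg (by simp)).query.setReg (by simp)).query.setReg
      (by simp)).query.setReg (by simp)

open Classical in
theorem sum_sum_triangle (R : ℕ → ℕ → Prop) (S : Finset ℕ) (hS : S.Nonempty) (p : ℕ) (ℓ x : ℝ) :
    (∑ u ∈ S, (∑ v ∈ S, if Triangle R p u v then x else ℓ) / S.card) / S.card =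
      (1 - density R S p) * ℓ + density R S p * x := by
  have hs : (0 : ℝ) < S.card := by exact_mod_cast hS.card_pos
  have h1 : ∑ u ∈ S, ∑ v ∈ S, (if Triangle R p u v then x else ℓ) =
      (S.card : ℝ) ^ 2 * ℓ + (triangles R S p).card * (x - ℓ) := by
    rw [← Finset.sum_product' S S fun u v => if Triangle R p u v then x else ℓ]
    have : ∀ e : ℕ × ℕ, (if Triangle R p e.1 e.2 then x else ℓ) =
        ℓ + if Triangle R p e.1 e.2 then x - ℓ else 0 := by
      intro e; split_ifs <;> ring
    simp_rw [this, Finset.sum_add_distrib, ← Finset.sum_filter, Finset.sum_const,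
      Finset.card_product, nsmul_eq_mul, triangles]
    push_cast
    ring
  rw [← Finset.sum_div, h1, density]
  field_simp
  ring

theorem CostLE.testPivot {t lo hi i p : ℕ} {K : List Cmd} {s : State} {ℓ x : ℝ}
    (h4 : s.reg 4 = lo) (h6 : s.reg 6 = hi) (h15 : s.reg 15 = p) (h7 : s.reg 7 = i + 1)
    (hlo : lo < hi) (hW : hi < W)
    (hnext : ∀ s', Same [7, 10, 16, 17, 18] [] s s' → s'.reg 7 = i → s'.reg 10 = 0 →
      CostLE W G g t (K, s') ℓ)
    (hfound : ∀ s', Same [7, 10, 16, 17, 18] [] s s' → s'.reg 7 = 0 → s'.reg 10 ≠ 0 →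
      s'.reg 16 ∈ Ico lo hi → s'.reg 17 ∈ Ico lo hi →
      Triangle (arc G (s.mem 0)) p (s'.reg 16) (s'.reg 17) → CostLE W G g t (K, s') x) :
    CostLE W G g (t + 28) (testPivot :: K, s)
      ((1 - density (arc G (s.mem 0)) (Ico lo hi) p) * ℓ +
        density (arc G (s.mem 0)) (Ico lo hi) p * x) := by
  classical
  rw [← sum_sum_triangle _ _ (by simpa using hlo)]
  refine (CostLE.seq (CostLE.pick h4 h6 (by decide) hlo hW (t := t + 24) ?_)).mono (by omega) le_rfl
  intro u hu s₁ S₁ h16₁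
  refine (CostLE.seq (CostLE.pick ((S₁.1 4 (by simp)).trans h4) ((S₁.1 6 (by simp)).trans h6)
    (by decide) hlo hW (t := t + 20) ?_)).mono (by omega) le_rfl
  intro v hv s₂ S₂ h17₂
  obtain ⟨s₃, r₃, S₃, htri, hno⟩ := checkTriple_runs (G := G) s₂ (W := W) (by omega)
  refine CostLE.of_runs r₃ ?_
  have S₂' : Same [7, 10, 16, 17, 18] [] s s₂ :=
    (S₁.mono (by simp) (by simp)).trans (S₂.mono (by simp) (by simp))
  have S₃' : Same [7, 10, 16, 17, 18] [] s s₃ := S₂'.trans (S₃.mono (by simp) (by simp))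
  have h16₂ : s₂.reg 16 = u := (S₂.1 16 (by simp)).trans h16₁
  have h16₃ : s₃.reg 16 = u := (S₃.1 16 (by simp)).trans h16₂
  have h17₃ : s₃.reg 17 = v := (S₃.1 17 (by simp)).trans h17₂
  rw [S₂'.2 0 (by simp), (S₂'.1 15 (by simp)).trans h15, h16₂, h17₂] at htri hno
  split_ifs with hT
  · have := htri hT
    exact hfound s₃ S₃' this.2 this.1 (by rwa [h16₃]) (by rwa [h17₃]) (by rwa [h16₃, h17₃])
  · have := hno hT
    refine hnext s₃ S₃' ?_ this.1
    rw [this.2, S₂.1 7 (by simp), S₁.1 7 (by simp), h7, Nat.add_sub_cancel]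

/-- The expected cost of sampling. If `x` bounds the cost after a triangle has been found and `Y p`
the one after the pivot `p` has been accepted, then a fixed pivot contributes these costs with the
probability of its failing or passing `N` tests, and the `F` rounds before stop at a triangle with
the average density in each round. -/
theorem CostLE.sampling {t lo hi N F : ℕ} {K : List Cmd} {s : State} {Y : ℕ → ℝ} {x : ℝ}
    (h4 : s.reg 4 = lo) (h6 : s.reg 6 = hi) (h12 : s.reg 12 = N) (h13 : s.reg 13 = F + N)
    (hN : 0 < N) (hlo : lo < hi) (hW : hi < W)
    (haccept : ∀ s', Same [7, 10, 15, 16, 17, 18] [] s s' → s'.reg 10 = 0 →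
      s'.reg 15 ∈ Ico lo hi → CostLE W G g t (K, s') (Y (s'.reg 15)))
    (hfound : ∀ s', Same [7, 10, 15, 16, 17, 18] [] s s' → s'.reg 10 ≠ 0 →
      s'.reg 15 ∈ Ico lo hi → s'.reg 16 ∈ Ico lo hi → s'.reg 17 ∈ Ico lo hi →
      Triangle (arc G (s.mem 0)) (s'.reg 15) (s'.reg 16) (s'.reg 17) → CostLE W G g t (K, s') x) :
    CostLE W G g (t + 36 * (F + N) + 5) (sampling :: K, s)
      ((1 - (∑ p ∈ Ico lo hi, density (arc G (s.mem 0)) (Ico lo hi) p) / (Ico lo hi).card) ^ F *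
        ((∑ p ∈ Ico lo hi, ((1 - density (arc G (s.mem 0)) (Ico lo hi) p) ^ N * Y p +
          (1 - (1 - density (arc G (s.mem 0)) (Ico lo hi) p) ^ N) * x)) / (Ico lo hi).card) +
        (1 - (1 - (∑ p ∈ Ico lo hi, density (arc G (s.mem 0)) (Ico lo hi) p) /
          (Ico lo hi).card) ^ F) * x) := by
  set q : ℕ → ℝ := fun p => 1 - density (arc G (s.mem 0)) (Ico lo hi) p with hq
  have hqd : ∀ p, density (arc G (s.mem 0)) (Ico lo hi) p = 1 - q p := fun p => by simp [hq]
  have hs : (0 : ℝ) < (Ico lo hi).card := by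
    rw [Nat.card_Ico]; exact_mod_cast (by omega : 0 < hi - lo)
  have hend : ∀ (p : ℕ) (hp : p ∈ Ico lo hi) (s₁ : State),
      Same [7, 10, 15, 16, 17, 18] [] s s₁ → s₁.reg 15 = p →
      ∀ k s₂, Same [7, 10, 16, 17, 18] [] s₁ s₂ → s₂.reg 7 = 0 → s₂.reg 10 ≠ 0 →
      s₂.reg 16 ∈ Ico lo hi → s₂.reg 17 ∈ Ico lo hi →
      Triangle (arc G (s₁.mem 0)) p (s₂.reg 16) (s₂.reg 17) →
      CostLE W G g (t + k + 1) (.loop (.reg 7) sampleRound :: K, s₂) x := by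
    intro p hp s₁ hS h15 k s₂ S₂ h7 h10 h16 h17 hT
    have h15₂ : s₂.reg 15 = p := (S₂.1 15 (by simp)).trans h15
    rw [hS.2 0 (by simp)] at hT
    exact (CostLE.loop_done (by simpa [Expr.eval] using h7) (hfound s₂ (hS.trans (S₂.mono (by simp) (by simp))) h10
      (by rwa [h15₂]) h16 h17 (by rwa [h15₂]))).mono (by omega) le_rfl
  have hfixed : ∀ i < N, ∀ s₁, Same [7, 10, 15, 16, 17, 18] [] s s₁ → s₁.reg 15 ∈ Ico lo hi →
      s₁.reg 7 = i → s₁.reg 10 = 0 →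
      CostLE W G g (t + 36 * i + 1) (.loop (.reg 7) sampleRound :: K, s₁)
        (q (s₁.reg 15) ^ i * Y (s₁.reg 15) + (1 - q (s₁.reg 15) ^ i) * x) := by
    intro i
    induction i with
    | zero =>
      intro _ s₁ hS h15 h7 h10
      simpa using CostLE.loop_done (by simpa [Expr.eval] using h7) (haccept s₁ hS h10 h15)
    | succ i ih =>
      intro hi' s₁ hS h15 h7 h10
      obtain ⟨p, hp⟩ : ∃ p, s₁.reg 15 = p := ⟨_, rfl⟩
      rw [hp] at h15 ⊢
      have h12₁ : s₁.reg 12 = N := (hS.1 12 (by simp)).trans h12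
      have a1 := runs_exec (W := W) (G := G) (c := .assign 18 (.lit 0)) trivial s₁
      simp only [Cmd.exec, Expr.eval, Nat.zero_mod] at a1
      have hS₂ : Same [7, 10, 15, 16, 17, 18] [] s (s₁.setReg 18 0) := hS.setReg (by simp)
      have h15₂ : (s₁.setReg 18 0).reg 15 = p := by simp [State.setReg_reg, hp]
      have key := CostLE.testPivot (W := W) (G := G) (g := g) (t := t + 36 * i + 1)
        (K := .loop (.reg 7) sampleRound :: K)
        (s := s₁.setReg 18 0) (i := i) ((hS₂.1 4 (by simp)).trans h4)
        ((hS₂.1 6 (by simp)).trans h6) h15₂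
        (by simp [State.setReg_reg, h7]) hlo hW (fun s₂ S₂ h7₂ h10₂ => by
          have h15₃ : s₂.reg 15 = p := (S₂.1 15 (by simp)).trans h15₂
          have := ih (by omega) s₂ (hS₂.trans (S₂.mono (by simp) (by simp))) (by rwa [h15₃]) h7₂ h10₂
          rwa [h15₃] at this)
        (fun s₂ S₂ h7₂ h10₂ h16₂ h17₂ hT => hend p h15 _ hS₂ h15₂ _ s₂ S₂ h7₂ h10₂ h16₂ h17₂ hT)
      refine (CostLE.loop_step (by simp [Expr.eval, h7]) (CostLE.seq (CostLE.of_runs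
        (Runs.ite_true (d := pickPosition 15) (by simp [Expr.eval, h7, h12₁, hi']) a1)
        key))).mono (by simp only [Cmd.size]; omega) (le_of_eq ?_)
      rw [hS₂.2 0 (by simp), hqd]
      ring
  set V₀ : ℝ := (∑ p ∈ Ico lo hi, (q p ^ N * Y p + (1 - q p ^ N) * x)) / (Ico lo hi).card with hV₀
  set δ : ℝ := (∑ p ∈ Ico lo hi, density (arc G (s.mem 0)) (Ico lo hi) p) / (Ico lo hi).card
    with hδ
  have hround : ∀ k (ℓ : ℕ → ℝ), (∀ s₁, Same [7, 10, 15, 16, 17, 18] [] s s₁ →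
      s₁.reg 15 ∈ Ico lo hi → s₁.reg 7 = N + k - 1 → s₁.reg 10 = 0 →
      CostLE W G g (t + 36 * (N + k - 1) + 1) (.loop (.reg 7) sampleRound :: K, s₁)
        (ℓ (s₁.reg 15))) →
      ∀ s₁, Same [7, 10, 15, 16, 17, 18] [] s s₁ → s₁.reg 7 = N + k →
      CostLE W G g (t + 36 * (N + k) + 1) (.loop (.reg 7) sampleRound :: K, s₁)
        ((∑ p ∈ Ico lo hi, (q p * ℓ p + (1 - q p) * x)) / (Ico lo hi).card) := by
    intro k ℓ hnext s₁ hS h7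
    have h12₁ : s₁.reg 12 = N := (hS.1 12 (by simp)).trans h12
    refine (CostLE.loop_step (by simp [Expr.eval, h7]; omega) (CostLE.seq (CostLE.ite_false
      (by simp [Expr.eval, h7, h12₁]) (CostLE.pick ((hS.1 4 (by simp)).trans h4)
        ((hS.1 6 (by simp)).trans h6) (by decide) hlo hW
        (t := t + 36 * (N + k - 1) + 1 + 28) (fun p hp s₂ S₂ h15 => ?_))))).mono
        (by omega) le_rfl
    have hS₂ : Same [7, 10, 15, 16, 17, 18] [] s s₂ := hS.trans (S₂.mono (by simp) (by simp))
    have key := CostLE.testPivot (W := W) (G := G) (g := g) (t := t + 36 * (N + k - 1) + 1)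
        (K := .loop (.reg 7) sampleRound :: K) (s := s₂) (i := N + k - 1)
        ((hS₂.1 4 (by simp)).trans h4) ((hS₂.1 6 (by simp)).trans h6) h15
        (by rw [S₂.1 7 (by simp), h7]; omega) hlo hW (fun s₃ S₃ h7₃ h10₃ => by
          have h15₃ : s₃.reg 15 = p := (S₃.1 15 (by simp)).trans h15
          have := hnext s₃ (hS₂.trans (S₃.mono (by simp) (by simp))) (by rwa [h15₃]) h7₃ h10₃
          rwa [h15₃] at this)
        (fun s₃ S₃ h7₃ h10₃ h16₃ h17₃ hT => hend p hp _ hS₂ h15 _ s₃ S₃ h7₃ h10₃ h16₃ h17₃ hT)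
    rw [hS₂.2 0 (by simp), hqd] at key
    rw [sub_sub_cancel] at key
    exact key
  have hfresh : ∀ k, ∀ s₁, Same [7, 10, 15, 16, 17, 18] [] s s₁ → s₁.reg 7 = N + k →
      CostLE W G g (t + 36 * (N + k) + 1) (.loop (.reg 7) sampleRound :: K, s₁)
        ((1 - δ) ^ k * V₀ + (1 - (1 - δ) ^ k) * x) := by
    intro k
    induction k with
    | zero =>
      intro s₁ hS h7
      refine (hround 0 (fun p => q p ^ (N - 1) * Y p + (1 - q p ^ (N - 1)) * x)
        (fun s₂ S₂ h15 h7₂ h10 => hfixed (N - 1) (by omega) s₂ S₂ h15 h7₂ h10) s₁ hS h7).mono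
        le_rfl (le_of_eq ?_)
      rw [pow_zero, one_mul, sub_self, zero_mul, add_zero, hV₀]
      congr 1
      refine Finset.sum_congr rfl fun p _ => ?_
      obtain ⟨N', rfl⟩ : ∃ N', N = N' + 1 := ⟨N - 1, by omega⟩
      simp only [Nat.add_sub_cancel, pow_succ]
      ring
    | succ k ih =>
      intro s₁ hS h7
      refine (hround (k + 1) (fun p => (1 - δ) ^ k * V₀ + (1 - (1 - δ) ^ k) * x)
        (fun s₂ S₂ h15 h7₂ h10 => ih s₂ S₂ h7₂) s₁ hS h7).mono
        le_rfl (le_of_eq ?_)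
      have hsum : ∑ p ∈ Ico lo hi, q p = (Ico lo hi).card * (1 - δ) := by
        rw [hδ, mul_sub, mul_div_cancel₀ _ hs.ne', Finset.sum_sub_distrib]
        simp
      have : ∀ p, q p * ((1 - δ) ^ k * V₀ + (1 - (1 - δ) ^ k) * x) + (1 - q p) * x =
          q p * ((1 - δ) ^ k * V₀ + (1 - (1 - δ) ^ k) * x - x) + x := fun p => by ring
      simp_rw [this, Finset.sum_add_distrib, ← Finset.sum_mul, hsum, Finset.sum_const, nsmul_eq_mul]
      rw [div_eq_iff hs.ne', pow_succ]
      ring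
  have a1 := runs_exec (W := W) (G := G) (c := .assign 7 (.reg 13)) trivial s
  have a2 := runs_exec (W := W) (G := G) (c := .assign 10 (.lit 0)) trivial
    (s.setReg 7 (F + N))
  simp only [Cmd.exec, Expr.eval, h13, Nat.zero_mod] at a1 a2
  refine (CostLE.seq (CostLE.of_runs a1 (CostLE.seq (CostLE.of_runs a2
    (hfresh F _ (((Same.refl _ _ _).setReg (by simp)).setReg (by simp))
      (by simp [State.setReg_reg]; ring)))))).mono (by simp only [Cmd.size]; omega) le_rfl

end

end RobustSort

namespace RobustSort

open scoped ENNReal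
open Finset (Ico)

/-! ### Segments, their potential and their time budget -/

/-- One step of the main loop: finish the first segment, or remove a triangle from it, or
split it. -/
def mainStep : Cmd :=
  .seq (.assign 6 (.load 2 (.reg 4)))
    (.seq (.assign 14 (.load 3 (.reg 4)))
      (.ite (.reg 14) (.seq sampling (.ite (.reg 10) removeTriangle splitSegment))
        (.assign 4 (.reg 6))))

/-- Treat the segments from left to right until there are none left. -/
def mainLoop : Cmd := .loop (.lt (.reg 4) (.reg 0)) mainStep

/-- The arrays `ends` and `deps` describe consecutive nonempty segments that cover `[lo, n)`, given
by their right ends and remaining depths. -/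
def Segments (ends deps : ℕ → ℕ) (n : ℕ) : ℕ → List (ℕ × ℕ) → Prop
  | lo, [] => lo = n
  | lo, e :: l => lo < e.1 ∧ ends lo = e.1 ∧ deps lo = e.2 ∧ Segments ends deps n e.1 l

/-- The number of bad vertices in a segment. -/
def badCount (B : Finset ℕ) (a : ℕ → ℕ) (lo hi : ℕ) : ℕ :=
  (slice a lo hi).countP fun x => decide (x ∈ B)

/-- Bound for the expected loss in an active segment with `b` bad ones among its `len` vertices:
a triangle costs two good vertices for each bad one, misplacement by bad pivots is paid for by the
logarithmic term, and the last term pays for segments whose depth is exhausted. -/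
noncomputable def activePotential (al η lam : ℝ) (b len d : ℕ) : ℝ :=
  (2 + η) * b + al * b * (1 + Real.log len) + lam * (len : ℝ) ^ 2 * (3 / 4) ^ d

/-- Bound for the expected loss in a segment; a segment of remaining depth `0` is not treated any
more, and one of its vertices is not lost. -/
noncomputable def segPotential (B : Finset ℕ) (al η lam : ℝ) (a : ℕ → ℕ) (lo hi d : ℕ) : ℝ :=
  if d = 0 then lam * (((hi - lo : ℕ) : ℝ) - 1)
  else activePotential al η lam (badCount B a lo hi) (hi - lo) d

/-- Bound for the expected loss in a sequence of segments. -/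
noncomputable def potential (B : Finset ℕ) (al η lam : ℝ) (a : ℕ → ℕ) : ℕ → List (ℕ × ℕ) → ℝ
  | _, [] => 0
  | lo, e :: l => segPotential B al η lam a lo e.1 e.2 + potential B al η lam a e.1 l

/-- Time for a segment, when `M` triples are sampled for each pivot. -/
def segTime (M len d : ℕ) : ℕ := len * (if d = 0 then 10 else 36 * M + 100 + 28 * d)

/-- Time for a sequence of segments. -/
def totalTime (M : ℕ) : ℕ → List (ℕ × ℕ) → ℕ
  | _, [] => 0
  | lo, e :: l => segTime M (e.1 - lo) e.2 + totalTime M e.1 l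

theorem Segments.le {ends deps : ℕ → ℕ} {n lo : ℕ} {l : List (ℕ × ℕ)}
    (h : Segments ends deps n lo l) : lo ≤ n := by
  induction l generalizing lo with
  | nil => exact le_of_eq h
  | cons e l ih => exact h.1.le.trans (ih h.2.2.2)

theorem Segments.lt_of_mem {ends deps : ℕ → ℕ} {n lo : ℕ} {l : List (ℕ × ℕ)}
    (h : Segments ends deps n lo l) : ∀ e ∈ l, lo < e.1 := by
  induction l generalizing lo with
  | nil => simp
  | cons e l ih =>
    intro e' he'
    rcases List.mem_cons.1 he' with rfl | he'
    · exact h.1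
    · exact h.1.trans (ih h.2.2.2 e' he')

theorem Segments.congr {ends deps ends' deps' : ℕ → ℕ} {n lo : ℕ} {l : List (ℕ × ℕ)}
    (h : Segments ends deps n lo l) (he : ∀ i, lo ≤ i → ends' i = ends i)
    (hd : ∀ i, lo ≤ i → deps' i = deps i) : Segments ends' deps' n lo l := by
  induction l generalizing lo with
  | nil => exact h
  | cons e l ih =>
    exact ⟨h.1, (he lo le_rfl).trans h.2.1, (hd lo le_rfl).trans h.2.2.1,
      ih h.2.2.2 (fun i hi => he i (h.1.le.trans hi)) fun i hi => hd i (h.1.le.trans hi)⟩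

theorem potential_congr {B : Finset ℕ} {al η lam : ℝ} {a a' : ℕ → ℕ} {ends deps : ℕ → ℕ}
    {n lo : ℕ} {l : List (ℕ × ℕ)} (h : Segments ends deps n lo l)
    (ha : ∀ i, lo ≤ i → a' i = a i) :
    potential B al η lam a' lo l = potential B al η lam a lo l := by
  induction l generalizing lo with
  | nil => rfl
  | cons e l ih =>
    rw [potential, potential, ih h.2.2.2 fun i hi => ha i (h.1.le.trans hi), segPotential,
      segPotential, badCount, badCount, slice_congr fun i hi _ => ha i hi]

theorem card_filter_Ico (a : ℕ → ℕ) (f : ℕ → Bool) (lo hi : ℕ) :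
    ((Ico lo hi).filter fun i => f (a i) = true).card = (slice a lo hi).countP f := by
  rw [slice, List.countP_map, List.countP_eq_length_filter,
    ← List.toFinset_card_of_nodup ((List.Ico.nodup lo hi).filter _)]
  congr 1
  ext i
  simp [List.Ico.mem]

theorem segTime_le (M len d : ℕ) : segTime M len d ≤ len * (36 * M + 100 + 28 * d) := by
  unfold segTime
  gcongr
  split_ifs <;> omega

theorem activePotential_nonneg {al η lam : ℝ} (hal : 0 ≤ al) (hη : 0 ≤ η) (hlam : 0 ≤ lam)
    (b : ℕ) {len : ℕ} (d : ℕ) : 0 ≤ activePotential al η lam b len d := by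
  unfold activePotential
  have := Real.log_natCast_nonneg len
  positivity

theorem segPotential_le {B : Finset ℕ} {al η lam : ℝ} (hal : 0 ≤ al) (hη : 0 ≤ η)
    (hlam : 0 ≤ lam) (a : ℕ → ℕ) {lo hi : ℕ} (d : ℕ) (h : lo < hi) :
    segPotential B al η lam a lo hi d ≤
      activePotential al η lam (badCount B a lo hi) (hi - lo) d := by
  unfold segPotential
  split_ifs with hd
  · subst hd
    unfold activePotential
    have h1 : (1 : ℝ) ≤ ((hi - lo : ℕ) : ℝ) := by exact_mod_cast (by omega : 1 ≤ hi - lo)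
    have h2 := Real.log_natCast_nonneg (hi - lo)
    have h3 : 0 ≤ (2 + η) * (badCount B a lo hi : ℝ) +
      al * (badCount B a lo hi : ℝ) * (1 + Real.log ((hi - lo : ℕ) : ℝ)) := by positivity
    have h4 : lam * (((hi - lo : ℕ) : ℝ) - 1) ≤ lam * ((hi - lo : ℕ) : ℝ) ^ 2 := by
      gcongr; nlinarith
    rw [pow_zero, mul_one]
    linarith
  · exact le_rfl

/-- The potential after the removal of a triangle. -/
theorem activePotential_remove {al η lam : ℝ} (hal : 0 ≤ al) (hη : 0 ≤ η)
    (hlam : 0 ≤ lam) {b b' len : ℕ} (d : ℕ) (hb : b' + 1 ≤ b) (hlen : 3 ≤ len) :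
    2 + activePotential al η lam b' (len - 3) d ≤
      activePotential al η lam b len d - (η + 3 * lam * (3 / 4) ^ d * len) := by
  unfold activePotential
  have hbr : (b' : ℝ) + 1 ≤ b := by exact_mod_cast hb
  have hl : (((len - 3 : ℕ) : ℝ)) = len - 3 := by push_cast [hlen]; ring
  have hlr : (3 : ℝ) ≤ len := by exact_mod_cast hlen
  have h1 : Real.log ((len - 3 : ℕ) : ℝ) ≤ Real.log len := by
    rcases Nat.eq_zero_or_pos (len - 3) with h | h
    · rw [h]; simpa using Real.log_natCast_nonneg len
    · exact Real.log_le_log (by exact_mod_cast h) (by rw [hl]; linarith)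
  have h2 := Real.log_natCast_nonneg (len - 3)
  have h3 : al * b' * (1 + Real.log ((len - 3 : ℕ) : ℝ)) ≤ al * b * (1 + Real.log len) := by
    gcongr
    linarith
  have h4 : (2 + η) * (b' + 1 : ℝ) ≤ (2 + η) * b := by gcongr
  have h5 : 0 ≤ lam * (3 / 4 : ℝ) ^ d := by positivity
  have h6 : lam * (3 / 4 : ℝ) ^ d * (((len - 3 : ℕ) : ℝ)) ^ 2 ≤
      lam * (3 / 4 : ℝ) ^ d * ((len : ℝ) ^ 2 - 3 * len) := by
    refine mul_le_mul_of_nonneg_left ?_ h5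
    rw [hl]; nlinarith
  nlinarith

/-- The potential after a segment has been split into parts of lengths `l` and `r`. -/
theorem activePotential_split {al η lam : ℝ} (hal : 0 ≤ al) (hη : 0 ≤ η) {b bl br len l r : ℕ}
    (d : ℕ) (hb : bl + br ≤ b) (hl : bl ≤ l) (hr : br ≤ r) (hlr : l + r < len) :
    activePotential al η lam bl l d + activePotential al η lam br r d ≤
      activePotential al η lam b len (d + 1) -
        al * b / 2 * (1 - ((l : ℝ) ^ 2 + (r : ℝ) ^ 2) / (len : ℝ) ^ 2) +
        lam * (len : ℝ) ^ 2 * (3 / 4) ^ d *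
          (1 / 4 - (1 - ((l : ℝ) ^ 2 + (r : ℝ) ^ 2) / (len : ℝ) ^ 2)) := by
  have hlen : (0 : ℝ) < len := by exact_mod_cast (by omega : 0 < len)
  obtain ⟨γ, hγ⟩ : ∃ γ : ℝ, γ = 1 - ((l : ℝ) ^ 2 + (r : ℝ) ^ 2) / (len : ℝ) ^ 2 := ⟨_, rfl⟩
  have hγ' : (l : ℝ) ^ 2 + (r : ℝ) ^ 2 = (len : ℝ) ^ 2 * (1 - γ) := by
    rw [hγ]; field_simp; ring
  rw [← hγ]
  have hγ1 : γ ≤ 1 := by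
    have : 0 ≤ ((l : ℝ) ^ 2 + (r : ℝ) ^ 2) / (len : ℝ) ^ 2 := by positivity
    linarith
  -- `2 * log (x / len) ≤ (x / len) ^ 2 - 1`
  have key : ∀ x c : ℕ, c ≤ x → (x : ℝ) ^ 2 ≤ (l : ℝ) ^ 2 + (r : ℝ) ^ 2 →
      (c : ℝ) * (1 + Real.log x) ≤ c * (1 + Real.log len - γ / 2) := by
    intro x c hcx hx
    rcases Nat.eq_zero_or_pos c with rfl | hc
    · simp
    have hx0 : (0 : ℝ) < x := by exact_mod_cast (by omega : 0 < x)
    have h1 : Real.log (((x : ℝ) / len) ^ 2) ≤ ((x : ℝ) / len) ^ 2 - 1 :=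
      Real.log_le_sub_one_of_pos (by positivity)
    rw [Real.log_pow, Real.log_div hx0.ne' hlen.ne'] at h1
    have h2 : ((x : ℝ) / len) ^ 2 ≤ 1 - γ := by
      rw [div_pow, div_le_iff₀ (by positivity)]; linarith
    push_cast at h1
    gcongr
    linarith
  have kl := key l bl hl (by nlinarith [sq_nonneg (r : ℝ)])
  have kr := key r br hr (by nlinarith [sq_nonneg (l : ℝ)])
  have hbr : (bl : ℝ) + br ≤ b := by exact_mod_cast hb
  have hpos : 0 ≤ 1 + Real.log len - γ / 2 := by
    have := Real.log_natCast_nonneg len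
    linarith
  have h3 : al * (bl * (1 + Real.log l) + br * (1 + Real.log r)) ≤
      al * (b * (1 + Real.log len - γ / 2)) := by
    gcongr
    calc _ ≤ ((bl : ℝ) + br) * (1 + Real.log len - γ / 2) := by linarith
      _ ≤ _ := by gcongr
  have h4 : (2 + η) * ((bl : ℝ) + br) ≤ (2 + η) * b := by gcongr
  have h5 : lam * (l : ℝ) ^ 2 * (3 / 4) ^ d + lam * (r : ℝ) ^ 2 * (3 / 4) ^ d =
      lam * (3 / 4) ^ d * ((len : ℝ) ^ 2 * (1 - γ)) := by rw [← hγ']; ring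
  unfold activePotential
  rw [pow_succ (3 / 4 : ℝ) d]
  linarith

end RobustSort

namespace RobustSort

open scoped ENNReal
open Finset (Ico)

/-! ### The invariant of the main loop -/

/-- The vertices `x` and `y` are in the right order if both belong to the set `X` of survivors. -/
def Ordered (rank : ℕ → ℕ) (X : Finset ℕ) (x y : ℕ) : Prop := x ∈ X → y ∈ X → rank x < rank y

theorem Ordered.mono {rank : ℕ → ℕ} {X X' : Finset ℕ} {x y : ℕ} (h : Ordered rank X x y)
    (hX : X' ⊆ X) : Ordered rank X' x y := fun hx hy => h (hX hx) (hX hy)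

/-- The tournament agrees with `rank` outside of `B`. -/
structure Represents {n : ℕ} (G : Digraph (Fin n)) (B : Finset ℕ) (rank : ℕ → ℕ) : Prop where
  tournament : TournamentOn (fun x y => answer G x y ≠ 0) (Finset.range n)
  good : ∀ x < n, ∀ y < n, x ∉ B → y ∉ B → x ≠ y → (answer G x y ≠ 0 ↔ rank x < rank y)

/-- Invariant of the main loop, with list `l` of segments and set `X` of vertices that have not been
lost: survivors in distinct segments, or among the vertices that are done, are in the right order.
Without bad vertices everything is in the right order. -/
structure MainInv (n N F : ℕ) (B : Finset ℕ) (rank : ℕ → ℕ) (X : Finset ℕ) (s : State)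
    (l : List (ℕ × ℕ)) : Prop where
  reg0 : s.reg 0 = n
  reg12 : s.reg 12 = N
  reg13 : s.reg 13 = F + N
  perm : (slice (s.mem 0) 0 n).Perm (List.range n)
  segs : Segments (s.mem 2) (s.mem 3) n (s.reg 4) l
  survivors : ∀ x ∈ X, x < n ∧ x ∉ B
  done : ∀ i j, i < s.reg 4 → i < j → j < n → Ordered rank X (s.mem 0 i) (s.mem 0 j)
  cross : ∀ e ∈ l, ∀ i j, i < e.1 → e.1 ≤ j → j < n → Ordered rank X (s.mem 0 i) (s.mem 0 j)
  all : B = ∅ → ∀ i j, i < j → j < n → Ordered rank X (s.mem 0 i) (s.mem 0 j)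

section

variable {n N F : ℕ} {B X : Finset ℕ} {rank : ℕ → ℕ} {s s' : State} {l : List (ℕ × ℕ)}

theorem MainInv.of_same {R : List ℕ} (h : MainInv n N F B rank X s l) (hS : Same R [] s s')
    (h0 : 0 ∉ R) (h4 : 4 ∉ R) (h12 : 12 ∉ R) (h13 : 13 ∉ R) : MainInv n N F B rank X s' l := by
  have hm : ∀ a, s'.mem a = s.mem a := fun a => hS.2 a (by simp)
  have e4 : s'.reg 4 = s.reg 4 := hS.1 4 h4
  exact ⟨(hS.1 0 h0).trans h.reg0, (hS.1 12 h12).trans h.reg12, (hS.1 13 h13).trans h.reg13,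
    by rw [hm]; exact h.perm, by rw [hm, hm, e4]; exact h.segs, h.survivors,
    by rw [hm, e4]; exact h.done, by rw [hm]; exact h.cross, by rw [hm]; exact h.all⟩

theorem MainInv.injOn (h : MainInv n N F B rank X s l) {i j : ℕ} (hi : i < n) (hj : j < n)
    (hij : s.mem 0 i = s.mem 0 j) : i = j := by
  have hnd : (slice (s.mem 0) 0 n).Nodup := h.perm.nodup_iff.2 List.nodup_range
  have hp := slice_pairwise.1 hnd
  rcases lt_trichotomy i j with hlt | heq | hgt
  · exact (hp i j (by omega) hlt hj hij).elim
  · exact heq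
  · exact (hp j i (by omega) hgt hi hij.symm).elim

theorem MainInv.lt (h : MainInv n N F B rank X s l) {i : ℕ} (hi : i < n) : s.mem 0 i < n :=
  getElem_lt_of_perm h.perm hi

theorem Represents.arc_tournamentOn {G : Digraph (Fin n)} (hG : Represents G B rank)
    (h : MainInv n N F B rank X s l) {lo hi : ℕ} (hhi : hi ≤ n) :
    TournamentOn (arc G (s.mem 0)) (Ico lo hi) := by
  have hlt : ∀ i ∈ Ico lo hi, i < n := fun i hi' => by
    have := (Finset.mem_Ico.1 hi').2; omega
  refine ⟨fun i hi' => hG.tournament.1 _ (Finset.mem_range.2 (h.lt (hlt i hi'))),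
    fun i hi' j hj' hij => hG.tournament.2 _ (Finset.mem_range.2 (h.lt (hlt i hi'))) _
      (Finset.mem_range.2 (h.lt (hlt j hj'))) fun he => hij (h.injOn (hlt i hi') (hlt j hj') he)⟩

/-- The first segment is finished. If there are bad vertices, then all of its vertices but one
count as lost. -/
theorem MainInv.skip {hi d : ℕ} (h : MainInv n N F B rank X s ((hi, d) :: l))
    (h4 : s'.reg 4 = hi) (h0 : s'.reg 0 = s.reg 0) (h12 : s'.reg 12 = s.reg 12)
    (h13 : s'.reg 13 = s.reg 13) (hm : s'.mem = s.mem) {X' : Finset ℕ}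
    (hX' : X' = if B = ∅ then X else X \ (Ico (s.reg 4 + 1) hi).image (s.mem 0)) :
    MainInv n N F B rank X' s' l := by
  have hsub : X' ⊆ X := by
    rw [hX']; split_ifs
    · exact subset_rfl
    · exact Finset.sdiff_subset
  refine ⟨h0.trans h.reg0, h12.trans h.reg12, h13.trans h.reg13, by rw [hm]; exact h.perm,
    by rw [hm, h4]; exact h.segs.2.2.2, fun x hx => h.survivors x (hsub hx), ?_,
    fun e he i j hi hj hjn => by
      rw [hm]; exact (h.cross e (List.mem_cons_of_mem _ he) i j hi hj hjn).mono hsub,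
    fun hB i j hij hj => by rw [hm]; exact (h.all hB i j hij hj).mono hsub⟩
  rw [hm, h4]
  intro i j hi' hij hj
  by_cases h1 : i < s.reg 4
  · exact (h.done i j h1 hij hj).mono hsub
  by_cases h2 : hi ≤ j
  · exact (h.cross _ List.mem_cons_self i j hi' h2 hj).mono hsub
  by_cases hB : B = ∅
  · exact (h.all hB i j hij hj).mono hsub
  · intro _ hjX
    rw [hX', if_neg hB, Finset.mem_sdiff] at hjX
    exact (hjX.2 (Finset.mem_image_of_mem _ (Finset.mem_Ico.2 ⟨by omega, by omega⟩))).elim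

theorem exists_of_segment_perm {a a' : ℕ → ℕ} {lo hi : ℕ}
    (hperm : (slice a' lo hi).Perm (slice a lo hi))
    (hout : ∀ i, ¬ (lo ≤ i ∧ i < hi) → a' i = a i) (i : ℕ) :
    ∃ j, a' i = a j ∧ (lo ≤ i ∧ i < hi ∧ lo ≤ j ∧ j < hi ∨ ¬ (lo ≤ i ∧ i < hi) ∧ j = i) := by
  by_cases h : lo ≤ i ∧ i < hi
  · have : a' i ∈ slice a lo hi := hperm.mem_iff.1 (mem_slice.2 ⟨i, h.1, h.2, rfl⟩)
    obtain ⟨j, hj₁, hj₂, hj⟩ := mem_slice.1 this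
    exact ⟨j, hj.symm, Or.inl ⟨h.1, h.2, hj₁, hj₂⟩⟩
  · exact ⟨i, hout i h, Or.inr ⟨h, rfl⟩⟩

/-- A triangle is moved to the front of the first segment and dropped from it. -/
theorem MainInv.remove {hi d lo : ℕ} (h : MainInv n N F B rank X s ((hi, d) :: l))
    (hlo : s.reg 4 = lo) (h3 : lo + 3 ≤ hi)
    (h4 : s'.reg 4 = lo + 3) (h0 : s'.reg 0 = s.reg 0) (h12 : s'.reg 12 = s.reg 12)
    (h13 : s'.reg 13 = s.reg 13)
    (hperm : (slice (s'.mem 0) lo hi).Perm (slice (s.mem 0) lo hi))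
    (hout : ∀ i, ¬ (lo ≤ i ∧ i < hi) → s'.mem 0 i = s.mem 0 i)
    (hrec : lo + 3 < hi → s'.mem 2 (lo + 3) = hi ∧ s'.mem 3 (lo + 3) = d)
    (hfr : ∀ a i, a ≠ 0 → hi ≤ i → s'.mem a i = s.mem a i) (hB : B ≠ ∅) {X' : Finset ℕ}
    (hX' : X' ⊆ X) (hdrop : ∀ i, lo ≤ i → i < lo + 3 → s'.mem 0 i ∉ X') :
    MainInv n N F B rank X' s' (if lo + 3 < hi then (hi, d) :: l else l) := by
  have hin := h.segs.2.2.2.le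
  simp only at hin
  have htr := exists_of_segment_perm hperm hout
  have hsegs : Segments (s'.mem 2) (s'.mem 3) n hi l :=
    h.segs.2.2.2.congr (fun i hi' => hfr 2 i (by decide) hi') fun i hi' => hfr 3 i (by decide) hi'
  refine ⟨h0.trans h.reg0, h12.trans h.reg12, h13.trans h.reg13,
    (slice_perm_of_segment (by omega) hin hout hperm).trans h.perm, ?_,
    fun x hx => h.survivors x (hX' hx), ?_, ?_, fun hB' => (hB hB').elim⟩
  · rw [h4]
    split_ifs with hlt
    · exact ⟨hlt, (hrec hlt).1, (hrec hlt).2, hsegs⟩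
    · rwa [show lo + 3 = hi by omega]
  · rw [h4]
    intro i j hi' hij hj
    by_cases h1 : i < lo
    · obtain ⟨j', hj', hcase⟩ := htr j
      rw [hj', hout i (by omega)]
      exact (h.done i j' (by omega) (by omega) (by omega)).mono hX'
    · intro hiX
      exact (hdrop i (by omega) hi' hiX).elim
  · intro e he i j hi' hj hjn
    have he' : e ∈ (hi, d) :: l := by
      split_ifs at he
      · exact he
      · exact List.mem_cons_of_mem _ he
    have hle : hi ≤ e.1 := by
      rcases List.mem_cons.1 he' with rfl | he''
      · exact le_rfl
      · exact (h.segs.2.2.2.lt_of_mem e he'').le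
    obtain ⟨i', hi'', hcase⟩ := htr i
    obtain ⟨j', hj', hcase'⟩ := htr j
    rw [hi'', hj']
    exact (h.cross e he' i' j' (by omega) (by omega) (by omega)).mono hX'

theorem slice_split {a : ℕ → ℕ} {lo hi v : ℕ} {L R : List ℕ} (h : slice a lo hi = L ++ v :: R) :
    slice a lo (lo + L.length) = L ∧ a (lo + L.length) = v ∧
      slice a (lo + L.length + 1) hi = R := by
  have hlen := congrArg List.length h
  rw [length_slice, List.length_append, List.length_cons] at hlen
  rw [← slice_append a (show lo ≤ lo + L.length by omega) (show lo + L.length ≤ hi by omega)] at h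
  obtain ⟨h1, h2⟩ := List.append_inj h (by simp)
  rw [slice_cons a (by omega)] at h2
  exact ⟨h1, (List.cons.inj h2).1, (List.cons.inj h2).2⟩

/-- The segments that replace the first one when it is split at position `mid`; the pivot is done,
and empty parts are left out. -/
def splitList (lo mid hi d : ℕ) (l : List (ℕ × ℕ)) : List (ℕ × ℕ) :=
  (if lo < mid then [(mid, d)] else []) ++
    (mid + 1, 0) :: ((if mid + 1 < hi then [(hi, d)] else []) ++ l)

/-- The first segment is split at the pivot `p`; the vertices in the positions `Y` are lost. -/
theorem MainInv.split {G : Digraph (Fin n)} (hG : Represents G B rank) {hi d d' lo p : ℕ}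
    (h : MainInv n N F B rank X s ((hi, d) :: l)) (hlo : s.reg 4 = lo) (hp : lo ≤ p ∧ p < hi)
    {L R : List ℕ}
    (hL : L = (slice (s.mem 0) lo hi).filter fun x => decide (answer G x (s.mem 0 p) ≠ 0))
    (hR : R = (slice (s.mem 0) lo hi).filter fun x => decide (answer G (s.mem 0 p) x ≠ 0))
    (hsplit : slice (s'.mem 0) lo hi = L ++ s.mem 0 p :: R)
    (hperm : (slice (s'.mem 0) lo hi).Perm (slice (s.mem 0) lo hi))
    (hout : ∀ i, ¬ (lo ≤ i ∧ i < hi) → s'.mem 0 i = s.mem 0 i)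
    (hrecL : 0 < L.length → s'.mem 2 lo = lo + L.length ∧ s'.mem 3 lo = d')
    (hrecp : s'.mem 2 (lo + L.length) = lo + L.length + 1 ∧ s'.mem 3 (lo + L.length) = 0)
    (hrecR : lo + L.length + 1 < hi → s'.mem 2 (lo + L.length + 1) = hi ∧
        s'.mem 3 (lo + L.length + 1) = d')
    (hfr : ∀ a i, a = 2 ∨ a = 3 → hi ≤ i → s'.mem a i = s.mem a i)
    (h4 : s'.reg 4 = lo) (h0 : s'.reg 0 = s.reg 0) (h12 : s'.reg 12 = s.reg 12)
    (h13 : s'.reg 13 = s.reg 13) {Y : Finset ℕ}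
    (hY : ∀ x ∈ (Ico lo hi).filter (fun i => s.mem 0 i ∉ B), x ∉ Y →
      ∀ y ∈ (Ico lo hi).filter (fun i => s.mem 0 i ∉ B), y ∉ Y →
      arc G (s.mem 0) x p → arc G (s.mem 0) p y → rank (s.mem 0 x) < rank (s.mem 0 y))
    {X' : Finset ℕ} (hX' : X' = X \ Y.image (s.mem 0)) :
    MainInv n N F B rank X' s' (splitList lo (lo + L.length) hi d' l) := by
  have hsub : X' ⊆ X := by rw [hX']; exact Finset.sdiff_subset
  have hin := h.segs.2.2.2.le
  simp only at hin
  have htr := exists_of_segment_perm hperm hout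
  have hlen := congrArg List.length hsplit
  rw [length_slice, List.length_append, List.length_cons] at hlen
  obtain ⟨hsL, hsp, hsR⟩ := slice_split hsplit
  obtain ⟨mid, hmid⟩ : ∃ mid, mid = lo + L.length := ⟨_, rfl⟩
  rw [← hmid] at hsL hsp hsR hrecp hrecR hrecL ⊢
  have hsegs : Segments (s'.mem 2) (s'.mem 3) n hi l :=
    h.segs.2.2.2.congr (fun i hi' => hfr 2 i (by simp) hi') fun i hi' => hfr 3 i (by simp) hi'
  have hgood : ∀ i < n, ∀ j < n, s.mem 0 i ∈ X' → s.mem 0 j ∈ X' → arc G (s.mem 0) i j →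
      rank (s.mem 0 i) < rank (s.mem 0 j) := by
    intro i hi' j hj' hiX hjX harc
    refine (hG.good _ (h.lt hi') _ (h.lt hj') (h.survivors _ (hsub hiX)).2
      (h.survivors _ (hsub hjX)).2 ?_).1 harc
    intro he
    refine hG.tournament.1 _ (Finset.mem_range.2 (h.lt hi')) ?_
    unfold arc at harc
    rwa [← he] at harc
  have hleft : ∀ i, lo ≤ i → i < mid → ∃ i₀, lo ≤ i₀ ∧ i₀ < hi ∧ s'.mem 0 i = s.mem 0 i₀ ∧
      arc G (s.mem 0) i₀ p := by
    intro i h1 h2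
    have : s'.mem 0 i ∈ L := by rw [← hsL]; exact mem_slice.2 ⟨i, h1, h2, rfl⟩
    rw [hL, List.mem_filter, decide_eq_true_eq] at this
    obtain ⟨i₀, h3, h4, h5⟩ := mem_slice.1 this.1
    exact ⟨i₀, h3, h4, h5.symm, by unfold arc; rw [h5]; exact this.2⟩
  have hright : ∀ i, mid + 1 ≤ i → i < hi → ∃ i₀, lo ≤ i₀ ∧ i₀ < hi ∧ s'.mem 0 i = s.mem 0 i₀ ∧
      arc G (s.mem 0) p i₀ := by
    intro i h1 h2
    have : s'.mem 0 i ∈ R := by rw [← hsR]; exact mem_slice.2 ⟨i, h1, h2, rfl⟩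
    rw [hR, List.mem_filter, decide_eq_true_eq] at this
    obtain ⟨i₀, h3, h4, h5⟩ := mem_slice.1 this.1
    exact ⟨i₀, h3, h4, h5.symm, by unfold arc; rw [h5]; exact this.2⟩
  have hT : ∀ i, lo ≤ i → i < hi → s.mem 0 i ∈ X' →
      i ∈ (Ico lo hi).filter (fun i => s.mem 0 i ∉ B) ∧ i ∉ Y := by
    intro i h1 h2 hX
    refine ⟨Finset.mem_filter.2 ⟨Finset.mem_Ico.2 ⟨h1, h2⟩, (h.survivors _ (hsub hX)).2⟩, ?_⟩
    intro hiY
    rw [hX', Finset.mem_sdiff] at hX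
    exact hX.2 (Finset.mem_image_of_mem _ hiY)
  -- the order across the two new boundaries, inside of the segment
  have hinner : ∀ i j, lo ≤ i → i ≤ mid → i < j → mid ≤ j → j < hi →
      Ordered rank X' (s'.mem 0 i) (s'.mem 0 j) := by
    intro i j h1 h2 hij h3 h4 hiX hjX
    rcases h2.eq_or_lt with rfl | hi'
    · obtain ⟨j₀, h5, h6, h7, h8⟩ := hright j (by omega) h4
      rw [hsp] at hiX ⊢
      rw [h7] at hjX ⊢
      exact hgood p (by omega) j₀ (by omega) hiX hjX h8
    · obtain ⟨i₀, h5, h6, h7, h8⟩ := hleft i h1 hi'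
      rw [h7] at hiX ⊢
      rcases h3.eq_or_lt with rfl | hj'
      · rw [hsp] at hjX ⊢
        exact hgood i₀ (by omega) p (by omega) hiX hjX h8
      · obtain ⟨j₀, h9, h10, h11, h12⟩ := hright j (by omega) h4
        rw [h11] at hjX ⊢
        have t1 := hT i₀ h5 h6 hiX
        have t2 := hT j₀ h9 h10 hjX
        exact hY i₀ t1.1 t1.2 j₀ t2.1 t2.2 h8 h12
  have hdone : ∀ i j, i < lo → i < j → j < n → Ordered rank X' (s'.mem 0 i) (s'.mem 0 j) := by
    intro i j hi' hij hj
    obtain ⟨j', hj', hcase⟩ := htr j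
    rw [hj', hout i (by omega)]
    exact (h.done i j' (by omega) (by omega) (by omega)).mono hsub
  have hcross : ∀ e ∈ (hi, d) :: l, ∀ i j, i < e.1 → e.1 ≤ j → j < n →
      Ordered rank X' (s'.mem 0 i) (s'.mem 0 j) := by
    intro e he i j hi' hj hjn
    have hle : hi ≤ e.1 := by
      rcases List.mem_cons.1 he with rfl | he''
      · exact le_rfl
      · exact (h.segs.2.2.2.lt_of_mem e he'').le
    obtain ⟨i', hi'', hcase⟩ := htr i
    obtain ⟨j', hj', hcase'⟩ := htr j
    rw [hi'', hj']
    exact (h.cross e he i' j' (by omega) (by omega) (by omega)).mono hsub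
  have hbound : ∀ i j, i ≤ mid → i < j → mid ≤ j → j < n →
      Ordered rank X' (s'.mem 0 i) (s'.mem 0 j) := by
    intro i j h1 h2 h3 h4
    by_cases hi' : i < lo
    · exact hdone i j hi' h2 h4
    by_cases hj' : j < hi
    · exact hinner i j (by omega) h1 h2 h3 hj'
    · exact hcross _ List.mem_cons_self i j (by simp only; omega) (by simp only; omega) h4
  refine ⟨h0.trans h.reg0, h12.trans h.reg12, h13.trans h.reg13,
    (slice_perm_of_segment (by omega) hin hout hperm).trans h.perm, ?_,
    fun x hx => h.survivors x (hsub hx), by rw [h4]; exact hdone, ?_, ?_⟩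
  · have hR' : Segments (s'.mem 2) (s'.mem 3) n (mid + 1)
        ((if mid + 1 < hi then [(hi, d')] else []) ++ l) := by
      split_ifs with hlt
      · exact ⟨hlt, (hrecR hlt).1, (hrecR hlt).2, hsegs⟩
      · rw [show mid + 1 = hi by omega]; exact hsegs
    have hP : Segments (s'.mem 2) (s'.mem 3) n mid
        ((mid + 1, 0) :: ((if mid + 1 < hi then [(hi, d')] else []) ++ l)) :=
      ⟨by simp, hrecp.1, hrecp.2, hR'⟩
    rw [h4, splitList]
    by_cases hlt : lo < mid
    · rw [if_pos hlt, List.singleton_append]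
      exact ⟨hlt, (hrecL (by omega)).1, (hrecL (by omega)).2, hP⟩
    · obtain rfl : lo = mid := by omega
      rw [if_neg hlt, List.nil_append]
      exact hP
  · intro e he i j hi' hj hjn
    have he' : e.1 = mid ∨ e.1 = mid + 1 ∨ ∃ e' ∈ (hi, d) :: l, e'.1 = e.1 := by
      unfold splitList at he
      rcases List.mem_append.1 he with he | he
      · split_ifs at he
        · rw [List.mem_singleton.1 he]; simp
        · simp at he
      · rcases List.mem_cons.1 he with rfl | he
        · simp
        · right; right
          rcases List.mem_append.1 he with he | he
          · split_ifs at he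
            · exact ⟨(hi, d), List.mem_cons_self, by rw [List.mem_singleton.1 he]⟩
            · simp at he
          · exact ⟨e, List.mem_cons_of_mem _ he, rfl⟩
    rcases he' with he' | he' | ⟨e', he', heq⟩
    · exact hbound i j (by omega) (by omega) (by omega) hjn
    · exact hbound i j (by omega) (by omega) (by omega) hjn
    · exact hcross e' he' i j (by omega) (by omega) hjn
  · intro hB i j hij hj
    by_cases h1 : i ≤ mid ∧ mid ≤ j
    · exact hbound i j h1.1 hij h1.2 hj
    by_cases h2 : i < lo
    · exact hdone i j h2 hij hj
    by_cases h3 : hi ≤ j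
    · by_cases h4 : i < hi
      · exact hcross _ List.mem_cons_self i j h4 h3 hj
      · rw [hout i (by omega), hout j (by omega)]
        exact (h.all hB i j hij hj).mono hsub
    have hpw : (slice (s.mem 0) lo hi).Pairwise (Ordered rank X') :=
      slice_pairwise.2 fun x y _ hxy hy => (h.all hB x y hxy (by omega)).mono hsub
    by_cases h4 : j < mid
    · have : (slice (s'.mem 0) lo mid).Pairwise (Ordered rank X') := by
        rw [hsL, hL]; exact hpw.sublist List.filter_sublist
      exact slice_pairwise.1 this i j (by omega) hij h4
    · have : (slice (s'.mem 0) (mid + 1) hi).Pairwise (Ordered rank X') := by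
        rw [hsR, hR]; exact hpw.sublist List.filter_sublist
      exact slice_pairwise.1 this i j (by omega) hij (by omega)

end

end RobustSort

namespace RobustSort

open scoped ENNReal
open Finset (Ico)

/-! ### The expected loss in the main loop -/

theorem badCount_perm {B : Finset ℕ} {a a' : ℕ → ℕ} {lo hi : ℕ}
    (h : (slice a' lo hi).Perm (slice a lo hi)) : badCount B a' lo hi = badCount B a lo hi :=
  h.countP_eq _

/-- The requirements on the parameters of the algorithm and of the analysis: a pivot is accepted
after `N = M ^ 2` triples that are not directed triangles, `F` triples with random pivots are sampled
before, and `η`, `al`, `lam` are the weights in the potential. -/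
structure Admissible (n N F M : ℕ) (B : Finset ℕ) (al η lam : ℝ) : Prop where
  M_pos : 0 < M
  N_eq : N = M ^ 2
  al_nonneg : 0 ≤ al
  al_mul : 8 ≤ al * M
  η_nonneg : 0 ≤ η
  η_mul : 1 ≤ η * M
  lam_nonneg : 0 ≤ lam
  one_le_lam : B ≠ ∅ → 1 ≤ lam
  fail : 0 < n → ∀ x : ℝ, 1 / (12 * N) ≤ x → x ≤ 1 → (1 - x) ^ F ≤ 1 / (2 * n)

section

variable {n N F M : ℕ} {B X : Finset ℕ} {rank : ℕ → ℕ} {s s' : State} {l : List (ℕ × ℕ)}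
  {al η lam : ℝ}

theorem card_sdiff_ge {X Z : Finset ℕ} : (X.card : ℝ) - Z.card ≤ (X \ Z).card := by
  have : (X.card : ℝ) ≤ (X \ Z).card + Z.card := by
    exact_mod_cast Finset.card_le_card_sdiff_add_card
  linarith

theorem MainInv.exists_skip (ha : Admissible n N F M B al η lam) {hi lo : ℕ}
    (h : MainInv n N F B rank X s ((hi, 0) :: l)) (hlo : s.reg 4 = lo)
    (h4 : s'.reg 4 = hi) (h0 : s'.reg 0 = s.reg 0) (h12 : s'.reg 12 = s.reg 12)
    (h13 : s'.reg 13 = s.reg 13) (hm : s'.mem = s.mem) :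
    ∃ X', MainInv n N F B rank X' s' l ∧
      (n - X'.card : ℝ) + potential B al η lam (s'.mem 0) hi l ≤
        n - X.card + potential B al η lam (s.mem 0) lo ((hi, 0) :: l) := by
  refine ⟨_, h.skip h4 h0 h12 h13 hm rfl, ?_⟩
  have hlt : lo < hi := hlo ▸ h.segs.1
  rw [potential, hm, segPotential, if_pos rfl, hlo]
  have h1 : (1 : ℝ) ≤ ((hi - lo : ℕ) : ℝ) := by exact_mod_cast (by omega : 1 ≤ hi - lo)
  split_ifs with hB
  · have := mul_nonneg ha.lam_nonneg (sub_nonneg.2 h1)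
    simp only
    linarith
  · have h2 := card_sdiff_ge (X := X) (Z := (Ico (lo + 1) hi).image (s.mem 0))
    have h3 : (((Ico (lo + 1) hi).image (s.mem 0)).card : ℝ) ≤ ((hi - lo : ℕ) : ℝ) - 1 := by
      have h4 : ((Ico (lo + 1) hi).image (s.mem 0)).card ≤ hi - lo - 1 := by
        refine Finset.card_image_le.trans ?_
        rw [Nat.card_Ico]; omega
      have h5 : (((hi - lo - 1 : ℕ)) : ℝ) = ((hi - lo : ℕ) : ℝ) - 1 := by
        rw [Nat.cast_sub (by omega)]; simp
      rw [← h5]; exact_mod_cast h4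
    have h6 : 1 * (((hi - lo : ℕ) : ℝ) - 1) ≤ lam * (((hi - lo : ℕ) : ℝ) - 1) :=
      mul_le_mul_of_nonneg_right (ha.one_le_lam hB) (by linarith)
    simp only
    linarith

theorem MainInv.exists_remove (ha : Admissible n N F M B al η lam) {hi d lo : ℕ}
    (h : MainInv n N F B rank X s ((hi, d) :: l))
    (hlo : s.reg 4 = lo) (hd : d ≠ 0) (h3 : lo + 3 ≤ hi)
    (h4 : s'.reg 4 = lo + 3) (h0 : s'.reg 0 = s.reg 0) (h12 : s'.reg 12 = s.reg 12)
    (h13 : s'.reg 13 = s.reg 13)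
    (hperm : (slice (s'.mem 0) lo hi).Perm (slice (s.mem 0) lo hi))
    (hout : ∀ i, ¬ (lo ≤ i ∧ i < hi) → s'.mem 0 i = s.mem 0 i)
    (hrec : lo + 3 < hi → s'.mem 2 (lo + 3) = hi ∧ s'.mem 3 (lo + 3) = d)
    (hfr : ∀ a i, a ≠ 0 → hi ≤ i → s'.mem a i = s.mem a i)
    (hbad : ∃ i, lo ≤ i ∧ i < lo + 3 ∧ s'.mem 0 i ∈ B) :
    ∃ X', MainInv n N F B rank X' s' (if lo + 3 < hi then (hi, d) :: l else l) ∧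
      (n - X'.card : ℝ) +
          potential B al η lam (s'.mem 0) (lo + 3) (if lo + 3 < hi then (hi, d) :: l else l) ≤
        n - X.card + potential B al η lam (s.mem 0) lo ((hi, d) :: l) -
          (η + 3 * lam * (3 / 4) ^ d * ((hi - lo : ℕ) : ℝ)) := by
  obtain ⟨z, hz₁, hz₂, hzB⟩ := hbad
  refine ⟨X \ (Ico lo (lo + 3)).image (s'.mem 0), h.remove hlo h3 h4 h0 h12 h13 hperm hout hrec
    hfr (Finset.ne_empty_of_mem hzB) Finset.sdiff_subset
    (fun i h1 h2 hi' => (Finset.mem_sdiff.1 hi').2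
      (Finset.mem_image_of_mem _ (Finset.mem_Ico.2 ⟨h1, h2⟩))), ?_⟩
  -- only two of the three vertices are good
  have hX : X \ (Ico lo (lo + 3)).image (s'.mem 0) =
      X \ ((Ico lo (lo + 3)).image (s'.mem 0)).erase (s'.mem 0 z) := by
    ext x
    simp only [Finset.mem_sdiff, Finset.mem_erase, not_and, and_congr_right_iff]
    intro hx
    exact ⟨fun h _ => h, fun h' => h' (by rintro rfl; exact (h.survivors _ hx).2 hzB)⟩
  have hcard : (((Ico lo (lo + 3)).image (s'.mem 0)).erase (s'.mem 0 z)).card ≤ 2 := by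
    rw [Finset.card_erase_of_mem (Finset.mem_image_of_mem _ (Finset.mem_Ico.2 ⟨hz₁, hz₂⟩))]
    have : ((Ico lo (lo + 3)).image (s'.mem 0)).card ≤ 3 :=
      Finset.card_image_le.trans (by simp)
    omega
  have hcard' : ((((Ico lo (lo + 3)).image (s'.mem 0)).erase (s'.mem 0 z)).card : ℝ) ≤ 2 := by
    exact_mod_cast hcard
  have hXc := card_sdiff_ge (X := X)
    (Z := ((Ico lo (lo + 3)).image (s'.mem 0)).erase (s'.mem 0 z))
  rw [← hX] at hXc
  have hb : badCount B (s'.mem 0) (lo + 3) hi + 1 ≤ badCount B (s.mem 0) lo hi := by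
    rw [← badCount_perm hperm, badCount, badCount,
      ← slice_append (s'.mem 0) (show lo ≤ lo + 3 by omega) h3, List.countP_append]
    have : 0 < (slice (s'.mem 0) lo (lo + 3)).countP fun x => decide (x ∈ B) :=
      List.countP_pos_iff.2 ⟨_, mem_slice.2 ⟨z, hz₁, hz₂, rfl⟩, by simpa using hzB⟩
    omega
  have hrest : potential B al η lam (s'.mem 0) hi l = potential B al η lam (s.mem 0) hi l :=
    potential_congr h.segs.2.2.2 fun i hi' => hout i (by omega)
  have hact := activePotential_remove ha.al_nonneg ha.η_nonneg ha.lam_nonneg d hb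
    (show 3 ≤ hi - lo by omega)
  have hpot : potential B al η lam (s'.mem 0) (lo + 3) (if lo + 3 < hi then (hi, d) :: l else l) ≤
      activePotential al η lam (badCount B (s'.mem 0) (lo + 3) hi) (hi - lo - 3) d +
        potential B al η lam (s.mem 0) hi l := by
    split_ifs with hlt
    · rw [potential]
      simp only
      rw [hrest, segPotential, if_neg hd, Nat.sub_sub]
    · rw [show lo + 3 = hi by omega, hrest]
      have := activePotential_nonneg ha.al_nonneg ha.η_nonneg ha.lam_nonneg
        (badCount B (s'.mem 0) hi hi) (len := hi - lo - 3) d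
      linarith
  rw [potential, segPotential, if_neg hd]
  simp only
  linarith

theorem potential_optional_le (ha : Admissible n N F M B al η lam) (a : ℕ → ℕ) {lo mid : ℕ}
    (d : ℕ) (hlo : lo ≤ mid) (l : List (ℕ × ℕ)) :
    potential B al η lam a lo ((if lo < mid then [(mid, d)] else []) ++ l) ≤
      activePotential al η lam (badCount B a lo mid) (mid - lo) d + potential B al η lam a mid l := by
  by_cases h : lo < mid
  · rw [if_pos h, List.singleton_append, potential]
    have := segPotential_le (B := B) ha.al_nonneg ha.η_nonneg ha.lam_nonneg a d h
    simp only
    linarith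
  · obtain rfl : lo = mid := by omega
    rw [if_neg h, List.nil_append]
    have := activePotential_nonneg ha.al_nonneg ha.η_nonneg ha.lam_nonneg
      (badCount B a lo lo) (len := lo - lo) d
    linarith

theorem badCount_le (B : Finset ℕ) (a : ℕ → ℕ) (lo hi : ℕ) : badCount B a lo hi ≤ hi - lo := by
  have := List.countP_le_length (p := fun x => decide (x ∈ B)) (l := slice a lo hi)
  rwa [length_slice] at this

theorem potential_splitList_le (ha : Admissible n N F M B al η lam) {a a' : ℕ → ℕ}
    {lo mid hi d : ℕ} (h₁ : lo ≤ mid) (h₂ : mid < hi)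
    (hperm : (slice a' lo hi).Perm (slice a lo hi)) {ends deps : ℕ → ℕ}
    (hl : Segments ends deps n hi l) (hout : ∀ i, hi ≤ i → a' i = a i) :
    potential B al η lam a' lo (splitList lo mid hi d l) ≤
      potential B al η lam a lo ((hi, d + 1) :: l) -
        al * badCount B a lo hi / 2 * (1 - (((mid - lo : ℕ) : ℝ) ^ 2 +
          ((hi - (mid + 1) : ℕ) : ℝ) ^ 2) / ((hi - lo : ℕ) : ℝ) ^ 2) +
        lam * ((hi - lo : ℕ) : ℝ) ^ 2 * (3 / 4) ^ d * (1 / 4 - (1 - (((mid - lo : ℕ) : ℝ) ^ 2 +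
          ((hi - (mid + 1) : ℕ) : ℝ) ^ 2) / ((hi - lo : ℕ) : ℝ) ^ 2)) := by
  have e1 := potential_optional_le ha a' d h₁
    ((mid + 1, 0) :: ((if mid + 1 < hi then [(hi, d)] else []) ++ l))
  have e2 := potential_optional_le ha a' (lo := mid + 1) d h₂ l
  rw [potential_congr hl hout] at e2
  rw [potential, segPotential, if_pos rfl, show mid + 1 - mid = 1 by omega] at e1
  simp only [Nat.cast_one, sub_self, mul_zero, zero_add] at e1
  have hb : badCount B a' lo mid + badCount B a' (mid + 1) hi ≤ badCount B a lo hi := by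
    rw [← badCount_perm hperm, badCount, badCount, badCount,
      ← slice_append a' h₁ h₂.le, slice_cons a' h₂, List.countP_append, List.countP_cons]
    omega
  have hs := activePotential_split (η := η) (lam := lam) ha.al_nonneg ha.η_nonneg d hb
    (badCount_le B a' lo mid) (badCount_le B a' (mid + 1) hi)
    (show mid - lo + (hi - (mid + 1)) < hi - lo by omega)
  rw [splitList, potential.eq_2 (e := (hi, d + 1)), segPotential, if_neg (Nat.succ_ne_zero d)]
  simp only
  linarith

theorem totalTime_optional_le (M : ℕ) {lo mid : ℕ} (d : ℕ) (hlo : lo ≤ mid) (l : List (ℕ × ℕ)) :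
    totalTime M lo ((if lo < mid then [(mid, d)] else []) ++ l) ≤
      (mid - lo) * (36 * M + 100 + 28 * d) + totalTime M mid l := by
  by_cases h : lo < mid
  · rw [if_pos h, List.singleton_append, totalTime]
    exact Nat.add_le_add_right (segTime_le _ _ _) _
  · obtain rfl : lo = mid := by omega
    rw [if_neg h, List.nil_append]
    omega

theorem totalTime_splitList_le (M : ℕ) {lo mid hi d : ℕ} (h₁ : lo ≤ mid) (h₂ : mid < hi) :
    totalTime M lo (splitList lo mid hi d l) + (hi - lo) * 28 + 62 ≤
      (hi - lo - 1) * (36 * M + 100 + 28 * (d + 1)) + 100 + totalTime M hi l := by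
  have e1 := totalTime_optional_le M d h₁
    ((mid + 1, 0) :: ((if mid + 1 < hi then [(hi, d)] else []) ++ l))
  have e2 := totalTime_optional_le M (lo := mid + 1) d h₂ l
  rw [totalTime, segTime, if_pos rfl, show mid + 1 - mid = 1 by omega] at e1
  rw [splitList]
  simp only at e1
  obtain ⟨x, rfl⟩ := Nat.exists_eq_add_of_le h₁
  obtain ⟨y, rfl⟩ := Nat.exists_eq_add_of_lt h₂
  simp only [show lo + x - lo = x by omega, show lo + x + y + 1 - (lo + x + 1) = y by omega] at e1 e2
  rw [show lo + x + y + 1 - lo = x + y + 1 by omega]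
  simp only [Nat.add_sub_cancel]
  nlinarith

theorem Represents.rank_iff {G : Digraph (Fin n)} (hG : Represents G B rank)
    (h : MainInv n N F B rank X s l) {i j : ℕ} (hi : i < n) (hj : j < n)
    (hiB : s.mem 0 i ∉ B) (hjB : s.mem 0 j ∉ B) (hij : i ≠ j) :
    arc G (s.mem 0) i j ↔ rank (s.mem 0 i) < rank (s.mem 0 j) :=
  hG.good _ (h.lt hi) _ (h.lt hj) hiB hjB fun he => hij (h.injOn hi hj he)

/-- A directed triangle contains a bad vertex. -/
theorem Represents.exists_bad {G : Digraph (Fin n)} (hG : Represents G B rank)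
    (h : MainInv n N F B rank X s l) {p u v : ℕ} (hp : p < n) (hu : u < n) (hv : v < n)
    (hpu : p ≠ u) (huv : u ≠ v) (hvp : v ≠ p)
    (hT : Triangle (arc G (s.mem 0)) p u v) : s.mem 0 p ∈ B ∨ s.mem 0 u ∈ B ∨ s.mem 0 v ∈ B := by
  by_contra! hc
  have h1 := (hG.rank_iff h hp hu hc.1 hc.2.1 hpu).1 hT.1
  have h2 := (hG.rank_iff h hu hv hc.2.1 hc.2.2 huv).1 hT.2.1
  have h3 := (hG.rank_iff h hv hp hc.2.2 hc.1 hvp).1 hT.2.2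
  omega

end

section

variable {n N F M W : ℕ} {G : Digraph (Fin n)} {B X : Finset ℕ} {rank : ℕ → ℕ} {s s' : State}
  {l : List (ℕ × ℕ)} {al η lam : ℝ} {g : State → ℝ≥0∞}

theorem card_le_card_leftOf_add_card_rightOf {α : Type*} {R : α → α → Prop} {S : Finset α}
    (h : TournamentOn R S) {p : α} (hp : p ∈ S) :
    S.card ≤ (leftOf R S p).card + (rightOf R S p).card + 1 := by
  classical
  have : S ⊆ insert p (leftOf R S p ∪ rightOf R S p) := by
    intro x hx
    by_cases hxp : x = p
    · simp [hxp]
    · simp only [Finset.mem_insert, Finset.mem_union, leftOf, rightOf, Finset.mem_filter, hx,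
        true_and, hxp, false_or]
      by_cases hR : R x p
      · exact Or.inl hR
      · exact Or.inr (not_not.1 (mt (h.2 x hx p hp hxp).2 hR))
  have h1 := Finset.card_le_card this
  have h2 := Finset.card_insert_le p (leftOf R S p ∪ rightOf R S p)
  have h3 := Finset.card_union_le (leftOf R S p) (rightOf R S p)
  omega

open Classical in
theorem mem_leftOf {α : Type*} {R : α → α → Prop} {S : Finset α} {p x : α} :
    x ∈ leftOf R S p ↔ x ∈ S ∧ R x p := Finset.mem_filter

theorem card_leftOf_arc (G : Digraph (Fin n)) (a : ℕ → ℕ) (lo hi p : ℕ) :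
    (leftOf (arc G a) (Ico lo hi) p).card =
      ((slice a lo hi).filter fun x => decide (answer G x (a p) ≠ 0)).length := by
  rw [← List.countP_eq_length_filter, ← card_filter_Ico]
  congr 1
  ext i
  simp only [mem_leftOf, Finset.mem_filter, arc, decide_eq_true_eq]

open Classical in
theorem mem_rightOf {α : Type*} {R : α → α → Prop} {S : Finset α} {p x : α} :
    x ∈ rightOf R S p ↔ x ∈ S ∧ R p x := Finset.mem_filter

theorem card_rightOf_arc (G : Digraph (Fin n)) (a : ℕ → ℕ) (lo hi p : ℕ) :
    (rightOf (arc G a) (Ico lo hi) p).card =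
      ((slice a lo hi).filter fun x => decide (answer G (a p) x ≠ 0)).length := by
  rw [← List.countP_eq_length_filter, ← card_filter_Ico]
  congr 1
  ext i
  simp only [mem_rightOf, Finset.mem_filter, arc, decide_eq_true_eq]

/-- One step of the main loop on an active segment. The hypothesis `ih` is the bound for the rest of
the computation. -/
theorem costLE_activeStep (hG : Represents G B rank) (ha : Admissible n N F M B al η lam)
    (hW : 3 * n + 3 < W) {hi d lo : ℕ} (h : MainInv n N F B rank X s ((hi, d + 1) :: l))
    (hlo : s.reg 4 = lo) (h6 : s.reg 6 = hi) (h14 : s.reg 14 = d + 1) {t : ℕ}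
    (ht : (hi - lo - 1) * (36 * (F + N) + 100 + 28 * (d + 1)) + 80 + 28 * (d + 1) +
      totalTime (F + N) hi l ≤ t)
    (ih : ∀ s' l' X', MainInv n N F B rank X' s' l' →
      totalTime (F + N) (s'.reg 4) l' <
        totalTime (F + N) lo ((hi, d + 1) :: l) → CostLE W G g (totalTime (F + N) (s'.reg 4) l' + 1)
          ([mainLoop], s') (n - X'.card + potential B al η lam (s'.mem 0) (s'.reg 4) l')) :
    CostLE W G g (t + 36 * (F + N) + 5)
      (sampling :: .ite (.reg 10) removeTriangle splitSegment :: [mainLoop], s)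
      (n - X.card + potential B al η lam (s.mem 0) lo ((hi, d + 1) :: l)) := by
  have hlt : lo < hi := hlo ▸ h.segs.1
  have hin : hi ≤ n := h.segs.2.2.2.le
  have htour : TournamentOn (arc G (s.mem 0)) (Ico lo hi) := hG.arc_tournamentOn h hin
  have hNpos : 0 < N := by rw [ha.N_eq]; exact pow_pos ha.M_pos 2
  obtain ⟨Φ, hΦ⟩ : ∃ Φ, Φ = (n - X.card : ℝ) +
    potential B al η lam (s.mem 0) lo ((hi, d + 1) :: l) := ⟨_, rfl⟩
  have hchoose : ∀ p ∈ Ico lo hi, ∃ (Y : Finset ℕ) (j : ℕ), Y.card ≤ 2 * j ∧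
      j ^ 2 ≤ (triangles (arc G (s.mem 0)) (Ico lo hi) p).card ∧
      (p ∈ (Ico lo hi).filter (fun i => s.mem 0 i ∉ B) → j = 0) ∧
      ∀ x ∈ (Ico lo hi).filter (fun i => s.mem 0 i ∉ B), x ∉ Y →
        ∀ y ∈ (Ico lo hi).filter (fun i => s.mem 0 i ∉ B), y ∉ Y →
        arc G (s.mem 0) x p → arc G (s.mem 0) p y → rank (s.mem 0 x) < rank (s.mem 0 y) := by
    intro p hp
    refine exists_misplaced htour (Finset.filter_subset _ _) (fun i => rank (s.mem 0 i)) ?_ hp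
    intro x hx y hy hxy
    rw [Finset.mem_filter, Finset.mem_Ico] at hx hy
    exact hG.rank_iff h (by omega) (by omega) hx.2 hy.2 hxy
  choose! Y j hY hj hjT hsep using hchoose
  have hb : (Ico lo hi ∩ (Ico lo hi).filter fun i => s.mem 0 i ∈ B).card =
      badCount B (s.mem 0) lo hi := by
    rw [Finset.inter_eq_right.2 (Finset.filter_subset _ _), badCount, ← card_filter_Ico]
    simp
  have hcost := expected_potential_le (B := (Ico lo hi).filter fun i => s.mem 0 i ∈ B)
    (nn := n) (τ := (3 / 4) ^ d) (Φ := Φ) htour ⟨lo, Finset.mem_Ico.2 ⟨le_rfl, hlt⟩⟩ j hj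
    (fun p hp hpB => hjT p hp (Finset.mem_filter.2 ⟨hp, fun hpB' => hpB
      (Finset.mem_filter.2 ⟨hp, hpB'⟩)⟩)) ha.M_pos ha.N_eq ha.al_mul ha.η_nonneg ha.η_mul
    ha.lam_nonneg (by positivity) (by rw [Nat.card_Ico]; omega) (ha.fail (by omega))
  rw [← hΦ]
  refine (CostLE.sampling hlo h6 h.reg12 h.reg13 hNpos hlt (by omega) ?_ ?_).mono le_rfl hcost
  -- the pivot is accepted
  · intro s₁ hS h10 hp
    obtain ⟨p, hp15⟩ : ∃ p, s₁.reg 15 = p := ⟨_, rfl⟩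
    rw [hp15] at hp ⊢
    have hm : s₁.mem 0 = s.mem 0 := hS.2 0 (by simp)
    have h1 : MainInv n N F B rank X s₁ ((hi, d + 1) :: l) :=
      h.of_same hS (by simp) (by simp) (by simp) (by simp)
    have e4 : s₁.reg 4 = lo := (hS.1 4 (by simp)).trans hlo
    have e6 : s₁.reg 6 = hi := (hS.1 6 (by simp)).trans h6
    have e14 : s₁.reg 14 = d + 1 := (hS.1 14 (by simp)).trans h14
    obtain ⟨L, hL⟩ : ∃ L, L = (slice (s₁.mem 0) lo hi).filter
      fun x => decide (answer G x (s₁.mem 0 p) ≠ 0) := ⟨_, rfl⟩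
    obtain ⟨R, hR⟩ : ∃ R, R = (slice (s₁.mem 0) lo hi).filter
      fun x => decide (answer G (s₁.mem 0 p) x ≠ 0) := ⟨_, rfl⟩
    have cL : (leftOf (arc G (s.mem 0)) (Ico lo hi) p).card = L.length := by
      rw [card_leftOf_arc, hL, hm]
    have cR : (rightOf (arc G (s.mem 0)) (Ico lo hi) p).card = R.length := by
      rw [card_rightOf_arc, hR, hm]
    have hlen : L.length + 1 + R.length = hi - lo := by
      have h1 := card_leftOf_add_card_rightOf_lt htour hp
      have h2 := card_le_card_leftOf_add_card_rightOf htour hp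
      rw [Nat.card_Ico, cL, cR] at h1 h2
      omega
    obtain ⟨s₂, r₂, S₂, hsplit, hout, hrecL, hrecp, hrecR, hfr⟩ := splitSegment_runs
      (W := W) (G := G) e4 e6 hp15 hlt.le (by omega) hL hR hlen
    have hperm : (slice (s₂.mem 0) lo hi).Perm (slice (s₁.mem 0) lo hi) := by
      refine List.Perm.symm (List.Subperm.perm_of_length_le
        (List.subperm_of_subset ?_ fun x hx => ?_) (by simp))
      · exact slice_pairwise.2 fun x y _ hxy hy he =>
          hxy.ne (h1.injOn (by omega) (by omega) he)
      · obtain ⟨i, hi₁, hi₂, rfl⟩ := mem_slice.1 hx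
        have hi' : i ∈ Ico lo hi := Finset.mem_Ico.2 ⟨hi₁, hi₂⟩
        rw [hsplit, List.mem_append, List.mem_cons, hL, hR, List.mem_filter, List.mem_filter,
          decide_eq_true_eq, decide_eq_true_eq]
        by_cases hip : i = p
        · simp [hip]
        by_cases ha : arc G (s.mem 0) i p
        · exact Or.inl ⟨hx, by rw [hm]; exact ha⟩
        · refine Or.inr (Or.inr ⟨hx, ?_⟩)
          rw [hm]
          exact not_not.1 (mt (htour.2 i hi' p hp hip).2 ha)
    rw [e14, Nat.add_sub_cancel] at hrecL hrecR
    have e4₂ : s₂.reg 4 = lo := (S₂.1 4 (by simp)).trans e4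
    have h2 := MainInv.split hG h1 e4 (Finset.mem_Ico.1 hp) hL hR hsplit hperm hout hrecL hrecp
      hrecR hfr e4₂ (S₂.1 0 (by simp)) (S₂.1 12 (by simp)) (S₂.1 13 (by simp)) (Y := Y p)
      (by rw [hm]; exact hsep p hp) rfl
    have htime := totalTime_splitList_le (l := l) (F + N) (d := d)
      (show lo ≤ lo + L.length by omega) (show lo + L.length < hi by omega)
    have hpot := potential_splitList_le ha (d := d) (show lo ≤ lo + L.length by omega)
      (show lo + L.length < hi by omega) hperm h1.segs.2.2.2 fun i hi' => hout i (by omega)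
    have hT : totalTime (F + N) lo ((hi, d + 1) :: l) =
        (hi - lo - 1) * (36 * (F + N) + 100 + 28 * (d + 1)) + (36 * (F + N) + 100 + 28 * (d + 1)) +
          totalTime (F + N) hi l := by
      rw [totalTime, segTime, if_neg (Nat.succ_ne_zero d)]
      simp only
      obtain ⟨k, hk⟩ : ∃ k, hi - lo = k + 1 := ⟨hi - lo - 1, by omega⟩
      rw [hk, Nat.add_sub_cancel]; ring
    have hrest := ih s₂ _ _ h2 (by rw [e4₂]; omega)
    refine ((CostLE.of_runs r₂ hrest).ite_false
      (by simpa [Expr.eval] using h10)).mono (by rw [e4₂]; omega) ?_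
    rw [e4₂, separation, cL, cR, hb, Nat.card_Ico]
    rw [hm, show lo + L.length - lo = L.length by omega,
      show hi - (lo + L.length + 1) = R.length by omega] at hpot
    have hc := card_sdiff_ge (X := X) (Z := (Y p).image (s₁.mem 0))
    have hc' : (((Y p).image (s₁.mem 0)).card : ℝ) ≤ 2 * j p := by
      exact_mod_cast Finset.card_image_le.trans (hY p hp)
    rw [hΦ]
    linarith
  -- a triangle is removed
  · intro s₁ hS h10 hp hu hv hT
    obtain ⟨p, hp15⟩ : ∃ p, s₁.reg 15 = p := ⟨_, rfl⟩
    obtain ⟨u, hu16⟩ : ∃ u, s₁.reg 16 = u := ⟨_, rfl⟩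
    obtain ⟨v, hv17⟩ : ∃ v, s₁.reg 17 = v := ⟨_, rfl⟩
    rw [hp15, hu16, hv17] at hT
    rw [hp15] at hp; rw [hu16] at hu; rw [hv17] at hv
    have hm : s₁.mem 0 = s.mem 0 := hS.2 0 (by simp)
    have h1 : MainInv n N F B rank X s₁ ((hi, d + 1) :: l) :=
      h.of_same hS (by simp) (by simp) (by simp) (by simp)
    have e4 : s₁.reg 4 = lo := (hS.1 4 (by simp)).trans hlo
    have e6 : s₁.reg 6 = hi := (hS.1 6 (by simp)).trans h6
    have e14 : s₁.reg 14 = d + 1 := (hS.1 14 (by simp)).trans h14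
    have hpu : p ≠ u := by rintro rfl; exact htour.1 p hp hT.1
    have huv : u ≠ v := by rintro rfl; exact htour.1 u hu hT.2.1
    have hvp : v ≠ p := by rintro rfl; exact htour.1 v hv hT.2.2
    obtain ⟨h3, s₂, r₂, S₂, e4₂, m0, m1, m2, hperm, hrec, hout, hfr⟩ := removeTriangle_runs
      (W := W) (G := G) e4 e6 hp15 hu16 hv17 (Finset.mem_Ico.1 hp) (Finset.mem_Ico.1 hu)
      (Finset.mem_Ico.1 hv) hpu huv hvp (by omega)
    rw [e14] at hrec
    rw [Finset.mem_Ico] at hp hu hv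
    have hbad : ∃ i, lo ≤ i ∧ i < lo + 3 ∧ s₂.mem 0 i ∈ B := by
      rcases hG.exists_bad h (by omega) (by omega) (by omega) hpu huv hvp hT with hB | hB | hB
      · exact ⟨lo, by omega, by omega, by rwa [m0, hm]⟩
      · exact ⟨lo + 1, by omega, by omega, by rwa [m1, hm]⟩
      · exact ⟨lo + 2, by omega, by omega, by rwa [m2, hm]⟩
    obtain ⟨X', h2, hpot⟩ := MainInv.exists_remove ha h1 e4 (Nat.succ_ne_zero d) h3 e4₂
      (S₂.1 0 (by simp)) (S₂.1 12 (by simp)) (S₂.1 13 (by simp)) hperm hout hrec hfr hbad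
    obtain ⟨k, hk⟩ : ∃ k, hi - lo = k + 3 := ⟨hi - lo - 3, by omega⟩
    have htime : totalTime (F + N) (lo + 3) (if lo + 3 < hi then (hi, d + 1) :: l else l) ≤
        k * (36 * (F + N) + 100 + 28 * (d + 1)) + totalTime (F + N) hi l := by
      split_ifs with hlt'
      · rw [totalTime, segTime, if_neg (Nat.succ_ne_zero d), show hi - (lo + 3) = k by omega]
      · rw [show lo + 3 = hi by omega]; omega
    have hT' : totalTime (F + N) lo ((hi, d + 1) :: l) =
        k * (36 * (F + N) + 100 + 28 * (d + 1)) + 3 * (36 * (F + N) + 100 + 28 * (d + 1)) +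
          totalTime (F + N) hi l := by
      rw [totalTime, segTime, if_neg (Nat.succ_ne_zero d)]
      simp only
      rw [hk]; ring
    have ht' : k * (36 * (F + N) + 100 + 28 * (d + 1)) + 2 * (36 * (F + N) + 100 + 28 * (d + 1)) +
        totalTime (F + N) hi l ≤ t := by
      rw [hk, show k + 3 - 1 = k + 2 by omega, add_mul] at ht
      omega
    have hrest := ih s₂ _ _ h2 (by rw [e4₂]; omega)
    refine ((CostLE.of_runs r₂ hrest).ite_true
      (by simpa [Expr.eval] using h10)).mono (by rw [e4₂]; omega) ?_
    rw [e4₂, hΦ, Nat.card_Ico]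
    rw [hm] at hpot
    refine hpot.trans (le_of_eq ?_)
    rw [pow_succ]

/-- The expected loss of the main loop is at most the loss so far plus the potential. -/
theorem costLE_mainLoop (hG : Represents G B rank) (ha : Admissible n N F M B al η lam)
    (hW : 3 * n + 3 < W)
    (hfinal : ∀ s X, MainInv n N F B rank X s [] → CostLE W G g 0 ([], s) (n - X.card))
    (h : MainInv n N F B rank X s l) :
    CostLE W G g (totalTime (F + N) (s.reg 4) l + 1) ([mainLoop], s)
      (n - X.card + potential B al η lam (s.mem 0) (s.reg 4) l) := by
  induction hτ : totalTime (F + N) (s.reg 4) l using Nat.strong_induction_on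
    generalizing s l X with
  | _ τ ih =>
  subst hτ
  rcases l with _ | ⟨⟨hi, d⟩, l⟩
  · have e4 : s.reg 4 = n := h.segs
    exact ((hfinal s X h).loop_done (by simp [Expr.eval, e4, h.reg0])).mono (by simp [totalTime])
      (by simp [potential])
  obtain ⟨lo, hlo⟩ : ∃ lo, s.reg 4 = lo := ⟨_, rfl⟩
  have hlt : lo < hi := hlo ▸ h.segs.1
  have hin : hi ≤ n := h.segs.2.2.2.le
  have hend : s.mem 2 lo = hi := hlo ▸ h.segs.2.1
  have hdep : s.mem 3 lo = d := hlo ▸ h.segs.2.2.1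
  have htest : (Expr.lt (.reg 4) (.reg 0)).eval W s ≠ 0 := by
    simp [Expr.eval, hlo, h.reg0]; omega
  set s₁ := s.setReg 6 hi with hs₁
  have r₁ : Runs W G 1 (.assign 6 (.load 2 (.reg 4))) s s₁ :=
    Runs.of_step fun K => by simp [step, Expr.eval, hlo, hend, hs₁]
  set s₂ := s₁.setReg 14 d with hs₂
  have r₂ : Runs W G 1 (.assign 14 (.load 3 (.reg 4))) s₁ s₂ :=
    Runs.of_step fun K => by
      simp [step, Expr.eval, hs₁, hs₂, State.setReg_reg, State.setReg_mem, hlo, hdep]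
  have S₂ : Same [6, 14] [] s s₂ := ((Same.refl _ _ _).setReg (by simp)).setReg (by simp)
  have h₂ : MainInv n N F B rank X s₂ ((hi, d) :: l) :=
    h.of_same S₂ (by simp) (by simp) (by simp) (by simp)
  have e4 : s₂.reg 4 = lo := (S₂.1 4 (by simp)).trans hlo
  have e6 : s₂.reg 6 = hi := by simp [hs₂, hs₁, State.setReg_reg]
  have e14 : s₂.reg 14 = d := by simp [hs₂, State.setReg_reg]
  have hm : s₂.mem = s.mem := rfl
  rw [hlo]
  rcases d with _ | d
  · set s₃ := s₂.setReg 4 hi with hs₃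
    have r₃ : Runs W G 1 (.assign 4 (.reg 6)) s₂ s₃ :=
      Runs.of_step fun K => by simp [step, Expr.eval, e6, hs₃]
    obtain ⟨X', h₃, hpot⟩ := h₂.exists_skip (s' := s₃) ha e4 (by simp [hs₃, State.setReg_reg])
      (by simp [hs₃, State.setReg_reg]) (by simp [hs₃, State.setReg_reg])
      (by simp [hs₃, State.setReg_reg]) rfl
    have e4₃ : s₃.reg 4 = hi := by simp [hs₃, State.setReg_reg]
    have hT : totalTime (F + N) lo ((hi, 0) :: l) = (hi - lo) * 10 + totalTime (F + N) hi l := by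
      simp [totalTime, segTime]
    have := ih _ (by rw [hlo, hT, e4₃]; omega) h₃ rfl
    rw [e4₃] at this
    exact ((((CostLE.of_runs r₁ ((CostLE.of_runs r₂ ((CostLE.of_runs r₃ this).ite_false
      (by simpa [Expr.eval] using e14))).seq)).seq).loop_step htest)).mono (by rw [hT]; omega) hpot
  · have hT : totalTime (F + N) lo ((hi, d + 1) :: l) =
        (hi - lo - 1) * (36 * (F + N) + 100 + 28 * (d + 1)) + (36 * (F + N) + 100 + 28 * (d + 1)) +
          totalTime (F + N) hi l := by
      rw [totalTime, segTime, if_neg (Nat.succ_ne_zero d)]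
      simp only
      obtain ⟨k, hk⟩ : ∃ k, hi - lo = k + 1 := ⟨hi - lo - 1, by omega⟩
      rw [hk, Nat.add_sub_cancel]; ring
    have := costLE_activeStep hG ha hW h₂ e4 e6 e14 le_rfl fun s' l' X' h' hlt' =>
      ih _ (by rwa [hlo]) h' rfl
    have htest' : (Expr.reg 14).eval W s₂ ≠ 0 := by simp [Expr.eval, e14]
    exact ((((CostLE.of_runs r₁ ((CostLE.of_runs r₂ ((this.seq).ite_true
      htest')).seq)).seq).loop_step htest)).mono (by rw [hT]; omega) le_rfl

end

end RobustSort

namespace RobustSort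

open scoped ENNReal
open Finset (Ico)

/-! ### The whole program -/

/-- The number of levels `⌈log₂ n⌉ + 1`. -/
def levels (n : ℕ) : ℕ := Nat.clog 2 n + 1

/-- The square root of the number of triples sampled for one pivot. -/
def sampleRoot (n m : ℕ) : ℕ := 32 * (levels n * m)

/-- The number of triples that must not be directed triangles before a pivot is accepted. -/
def sampleSize (n m : ℕ) : ℕ := sampleRoot n m * sampleRoot n m

/-- The depth at which the treatment of a segment is given up. -/
def depth (n m : ℕ) : ℕ := 6 * levels n + 3 * m + 6

/-- Store the sample sizes, and the segment that contains everything. -/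
def setParameters : Cmd :=
  .seq (.assign 18 (.mul (.lit 32) (.mul (.reg 2) (.reg 1))))
    (.seq (.assign 12 (.mul (.reg 18) (.reg 18)))
      (.seq (.assign 13 (.add (.mul (.lit 12) (.mul (.reg 12) (.reg 2))) (.reg 12)))
        (.seq (.assign 4 (.lit 0))
          (.seq (.store 2 (.lit 0) (.reg 0))
            (.store 3 (.lit 0)
              (.add (.add (.mul (.lit 6) (.reg 2)) (.mul (.lit 3) (.reg 1))) (.lit 6)))))))

/-- Sort the vertices by merging, and then again by a cautious quicksort. -/
def program : Cmd := .seq fillArray (.seq mergeSort (.seq setParameters mainLoop))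

/-- A bound for the number of steps of the program. -/
def timeBound (n m : ℕ) : ℕ :=
  n * (36 * (12 * (sampleSize n m * levels n) + sampleSize n m) + 100 + 28 * depth n m) +
    Nat.clog 2 n * (n * 60 + 9) + n * 4 + 30

section

variable {n m W : ℕ} {G : Digraph (Fin n)}

theorem levels_le (n : ℕ) : levels n ≤ n + 1 := by
  unfold levels
  have : Nat.clog 2 n ≤ n := (Nat.clog_le_iff_le_pow (by norm_num)).2 Nat.lt_two_pow_self.le
  omega

theorem sampleSize_mul_levels_le (n m : ℕ) :
    12 * (sampleSize n m * levels n) + sampleSize n m ≤ 13312 * (n + m + 1) ^ 5 := by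
  have hL : levels n ≤ n + m + 1 := (levels_le n).trans (by omega)
  have hL1 : 1 ≤ levels n := by unfold levels; omega
  have h1 : sampleSize n m ≤ sampleSize n m * levels n := Nat.le_mul_of_pos_right _ hL1
  have h2 : sampleSize n m * levels n ≤
      (32 * ((n + m + 1) * (n + m + 1))) * (32 * ((n + m + 1) * (n + m + 1))) * (n + m + 1) := by
    unfold sampleSize sampleRoot
    gcongr <;> omega
  calc _ ≤ 13 * (sampleSize n m * levels n) := by omega
    _ ≤ 13 * ((32 * ((n + m + 1) * (n + m + 1))) * (32 * ((n + m + 1) * (n + m + 1))) *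
        (n + m + 1)) := by gcongr
    _ = _ := by ring

theorem setParameters_runs (hW : 13312 * (n + m + 1) ^ 5 < W) {s : State} (h0 : s.reg 0 = n)
    (h1 : s.reg 1 = m) (h2 : s.reg 2 = levels n) :
    ∃ s', Runs W G 11 setParameters s s' ∧ s'.reg 0 = n ∧ s'.reg 12 = sampleSize n m ∧
      s'.reg 13 = 12 * (sampleSize n m * levels n) + sampleSize n m ∧ s'.reg 4 = 0 ∧
      s'.mem 0 = s.mem 0 ∧ s'.mem 2 0 = n ∧ s'.mem 3 0 = depth n m := by
  have hF := sampleSize_mul_levels_le n m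
  have hL : levels n ≤ n + 1 := levels_le n
  have hz : n + m + 1 ≤ (n + m + 1) ^ 5 := Nat.le_self_pow (by norm_num) _
  have hN : sampleSize n m * 1 ≤ sampleSize n m * levels n :=
    Nat.mul_le_mul_left _ (by unfold levels; omega)
  have hS : sampleRoot n m ≤ sampleSize n m := Nat.le_mul_self _
  have hR : levels n * m ≤ sampleRoot n m := by unfold sampleRoot; omega
  have hdep : depth n m < W := by unfold depth; omega
  have e1 : 32 % W = 32 := Nat.mod_eq_of_lt (by omega)
  have e2 : levels n * m % W = levels n * m := Nat.mod_eq_of_lt (by omega)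
  have e3 : 32 * (levels n * m) % W = sampleRoot n m := Nat.mod_eq_of_lt (by
    change sampleRoot n m < W; omega)
  have e4 : sampleRoot n m * sampleRoot n m % W = sampleSize n m := Nat.mod_eq_of_lt (by
    change sampleSize n m < W; omega)
  have e5 : 12 % W = 12 := Nat.mod_eq_of_lt (by omega)
  have e6 : sampleSize n m * levels n % W = sampleSize n m * levels n :=
    Nat.mod_eq_of_lt (by omega)
  have e7 : 12 * (sampleSize n m * levels n) % W = 12 * (sampleSize n m * levels n) :=
    Nat.mod_eq_of_lt (by omega)
  have e8 : (12 * (sampleSize n m * levels n) + sampleSize n m) % W =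
    12 * (sampleSize n m * levels n) + sampleSize n m := Nat.mod_eq_of_lt (by omega)
  have e9 : 6 % W = 6 := Nat.mod_eq_of_lt (by omega)
  have e10 : 3 % W = 3 := Nat.mod_eq_of_lt (by omega)
  have e11 : 6 * levels n % W = 6 * levels n := Nat.mod_eq_of_lt (by omega)
  have e12 : 3 * m % W = 3 * m := Nat.mod_eq_of_lt (by omega)
  have e13 : (6 * levels n + 3 * m) % W = 6 * levels n + 3 * m := Nat.mod_eq_of_lt (by omega)
  have e14 : (6 * levels n + 3 * m + 6) % W = depth n m := Nat.mod_eq_of_lt hdep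
  have e15 : 0 % W = 0 := Nat.zero_mod W
  refine ⟨_, runs_exec_of_size_le s (by simp [setParameters, Cmd.Straight])
    (by simp [setParameters, Cmd.size]), ?_⟩
  simp only [setParameters, Cmd.exec, Expr.eval, State.setReg_reg, State.setMem_reg,
    State.setReg_mem, State.setMem_mem, h0, h1, h2]
  norm_num [e1, e2, e3, e4, e5, e6, e7, e8, e9, e10, e11, e12, e13, e14, e15, h0]
  funext i
  simp [State.setMem_mem, State.setReg_mem]

variable {B : Finset ℕ} {rank : ℕ → ℕ} {al η lam : ℝ} {g : State → ℝ≥0∞} {M : ℕ}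

/-- The bound for the expected loss of the program. -/
theorem costLE_program (hG : Represents G B rank)
    (ha : Admissible n (sampleSize n m) (12 * (sampleSize n m * levels n)) M B al η lam)
    (hW : 13312 * (n + m + 1) ^ 5 < W)
    (hfinal : ∀ s X, MainInv n (sampleSize n m) (12 * (sampleSize n m * levels n)) B rank X s [] →
      CostLE W G g 0 ([], s) (n - X.card)) :
    CostLE W G g (timeBound n m) (init program n m)
      (B.card + if n = 0 then 0 else activePotential al η lam B.card n (depth n m)) := by
  classical
  have hz : n + m + 1 ≤ (n + m + 1) ^ 5 := Nat.le_self_pow (by norm_num) _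
  obtain ⟨s, hs, h0, h1⟩ : ∃ s, init program n m = ([program], s) ∧ s.reg 0 = n ∧ s.reg 1 = m :=
    ⟨_, rfl, rfl, rfl⟩
  obtain ⟨s₁, r₁, S₁, hr₁⟩ := fillArray_runs (W := W) (G := G) (by omega) h0
  -- without bad vertices the tournament sorts by rank
  obtain ⟨le, hle⟩ : ∃ le : ℕ → ℕ → Bool, ∀ x y, le x y =
      if B = ∅ then decide (rank x ≤ rank y) else decide (answer G y x = 0) :=
    ⟨_, fun _ _ => rfl⟩
  have hagree : Agrees G le := by
    intro x y hx hy
    rw [hle]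
    split_ifs with hB
    · rw [decide_eq_true_eq, ← not_lt]
      by_cases hxy : x = y
      · subst hxy
        simp only [lt_irrefl, not_false_eq_true, true_iff]
        exact not_not.1 (hG.tournament.1 x (Finset.mem_range.2 hx))
      · rw [← hG.good y hy x hx (by simp [hB]) (by simp [hB]) (Ne.symm hxy), not_not]
    · rw [decide_eq_true_eq]
  obtain ⟨s₂, r₂, S₂, e2₂, hp₂, hsort⟩ := mergeSort_runs hagree (by omega) (s := s₁)
    ((S₁.1 0 (by simp)).trans h0) (by rw [hr₁]) (W := W)
  have e0₂ : s₂.reg 0 = n := (S₂.1 0 (by simp)).trans ((S₁.1 0 (by simp)).trans h0)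
  obtain ⟨s₃, r₃, e0, e12, e13, e4, em, e2, e3⟩ := setParameters_runs (G := G) hW e0₂
    ((S₂.1 1 (by simp)).trans ((S₁.1 1 (by simp)).trans h1)) e2₂
  have hpw : B = ∅ → (slice (s₃.mem 0) 0 n).Pairwise fun x y => rank x ≤ rank y := by
    intro hB
    have := hsort (by simp only [hle, if_pos hB, decide_eq_true_eq]; omega)
      (by simp only [hle, if_pos hB, Bool.or_eq_true, decide_eq_true_eq]; omega)
    simp only [hle, if_pos hB, decide_eq_true_eq] at this
    rwa [em]
  have hinv : MainInv n (sampleSize n m) (12 * (sampleSize n m * levels n)) B rank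
      (Finset.range n \ B) s₃ (if n = 0 then [] else [(n, depth n m)]) := by
    have hperm : (slice (s₃.mem 0) 0 n).Perm (List.range n) := by rw [em]; exact hp₂
    refine ⟨e0, e12, e13, hperm, ?_, fun x hx => ?_, fun i j hi => by omega, ?_, ?_⟩
    · rw [e4]
      split_ifs with hn
      · exact hn.symm
      · exact ⟨by simp only; omega, e2, e3, rfl⟩
    · rw [Finset.mem_sdiff, Finset.mem_range] at hx
      exact hx
    · intro e he i j hi hj hjn
      split_ifs at he
      · simp at he
      · rw [List.mem_singleton] at he
        subst he
        simp only at hj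
        omega
    · intro hB i j hij hj _ _
      refine lt_of_le_of_ne (slice_pairwise.1 (hpw hB) i j (by omega) hij hj) fun heq => ?_
      have hi' := getElem_lt_of_perm hperm (show i < n by omega)
      have hj' := getElem_lt_of_perm hperm hj
      have hne : s₃.mem 0 i ≠ s₃.mem 0 j :=
        slice_pairwise.1 (hperm.nodup_iff.2 List.nodup_range) i j (by omega) hij hj
      have g1 := hG.good _ hi' _ hj' (by simp [hB]) (by simp [hB]) hne
      have g2 := hG.good _ hj' _ hi' (by simp [hB]) (by simp [hB]) hne.symm
      have g3 := hG.tournament.2 _ (Finset.mem_range.2 hi') _ (Finset.mem_range.2 hj') hne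
      rw [heq, lt_self_iff_false] at g1 g2
      tauto
  have hmain := costLE_mainLoop hG ha (by omega) hfinal hinv
  rw [hs]
  refine ((CostLE.of_runs r₁ ((CostLE.of_runs r₂ ((CostLE.of_runs r₃ hmain).seq)).seq)).seq).mono
    ?_ ?_
  · have hT : totalTime (12 * (sampleSize n m * levels n) + sampleSize n m) (s₃.reg 4)
        (if n = 0 then [] else [(n, depth n m)]) ≤
        n * (36 * (12 * (sampleSize n m * levels n) + sampleSize n m) + 100 + 28 * depth n m) := by
      rw [e4]
      split_ifs with hn
      · simp [totalTime]
      · rw [totalTime, totalTime, add_zero]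
        exact segTime_le _ _ _
    unfold timeBound
    omega
  · have hc := card_sdiff_ge (X := Finset.range n) (Z := B)
    rw [Finset.card_range] at hc
    have hpot : potential B al η lam (s₃.mem 0) (s₃.reg 4)
        (if n = 0 then [] else [(n, depth n m)]) ≤
        if n = 0 then 0 else activePotential al η lam B.card n (depth n m) := by
      rw [e4]
      split_ifs with hn
      · exact le_rfl
      · rw [potential, potential, add_zero]
        refine (segPotential_le ha.al_nonneg ha.η_nonneg ha.lam_nonneg _ _
          (Nat.pos_of_ne_zero hn)).trans ?_
        have hb : badCount B (s₃.mem 0) 0 n ≤ B.card := by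
          rw [badCount, List.countP_eq_length_filter, ← List.toFinset_card_of_nodup
            ((hinv.perm.nodup_iff.2 List.nodup_range).filter _)]
          refine Finset.card_le_card fun x hx => ?_
          simpa using (List.mem_filter.1 (List.mem_toFinset.1 hx)).2
        have hbr : (badCount B (s₃.mem 0) 0 n : ℝ) ≤ B.card := by exact_mod_cast hb
        unfold activePotential
        simp only [Nat.sub_zero]
        have h1 := Real.log_natCast_nonneg n
        have h2 := ha.al_nonneg
        have h3 := ha.η_nonneg
        gcongr
    linarith

end

end RobustSort

namespace RobustSort

open scoped ENNReal
open Finset (Ico)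

/-! ### The choice of the parameters -/

theorem le_two_pow_clog (n : ℕ) : n ≤ 2 ^ Nat.clog 2 n := Nat.le_pow_clog (by norm_num) n

theorem one_add_log_le_levels {n : ℕ} (hn : n ≠ 0) : 1 + Real.log n ≤ levels n := by
  have h1 : Real.log n ≤ Real.log ((2 : ℝ) ^ Nat.clog 2 n) :=
    Real.log_le_log (by exact_mod_cast Nat.pos_of_ne_zero hn) (by exact_mod_cast le_two_pow_clog n)
  rw [Real.log_pow] at h1
  have h2 : (Nat.clog 2 n : ℝ) * Real.log 2 ≤ Nat.clog 2 n * 1 := by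
    gcongr
    linarith [Real.log_two_lt_d9]
  unfold levels
  push_cast
  linarith

/-- A sample of this size shows a triangle with the required probability. -/
theorem one_sub_pow_le_div {n N : ℕ} (hN : 0 < N) {x : ℝ} (h0 : 1 / (12 * N : ℝ) ≤ x) (h1 : x ≤ 1)
    (hn : 0 < n) : (1 - x) ^ (12 * (N * levels n)) ≤ 1 / (2 * n) := by
  have hNr : (0 : ℝ) < N := by exact_mod_cast hN
  have hx : 0 ≤ x := le_trans (by positivity) h0
  have h2 : (1 - x) ^ (12 * N) ≤ 1 / 2 := by
    refine (one_sub_pow_le _ hx h1).trans ?_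
    have : 1 ≤ ((12 * N : ℕ) : ℝ) * x := by
      push_cast
      rwa [div_le_iff₀' (by positivity)] at h0
    gcongr
    linarith
  rw [show 12 * (N * levels n) = 12 * N * levels n by ring, pow_mul]
  have hnr : (0 : ℝ) < n := by exact_mod_cast hn
  calc ((1 - x) ^ (12 * N)) ^ levels n ≤ (1 / 2) ^ levels n :=
        pow_le_pow_left₀ (pow_nonneg (by linarith) _) h2 _
    _ = 1 / (2 * 2 ^ Nat.clog 2 n) := by
        rw [levels, pow_succ, one_div_pow]; field_simp
    _ ≤ 1 / (2 * n) := by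
        gcongr
        exact_mod_cast le_two_pow_clog n

/-- At depth `depth n m` the segments have become negligible. -/
theorem sq_mul_pow_depth_le (n : ℕ) {m : ℕ} (hm : 0 < m) :
    (n : ℝ) ^ 2 * (3 / 4) ^ depth n m ≤ 1 / (4 * m) := by
  have hmr : (0 : ℝ) < m := by exact_mod_cast hm
  have h1 : (n : ℝ) ≤ 2 ^ levels n := by
    have : n ≤ 2 ^ levels n := (le_two_pow_clog n).trans
      (Nat.pow_le_pow_right (by norm_num) (by unfold levels; omega))
    exact_mod_cast this
  have h2 : ((3 : ℝ) / 4) ^ (6 * levels n) ≤ (1 / 4) ^ levels n := by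
    rw [pow_mul]
    exact pow_le_pow_left₀ (by norm_num) (by norm_num) _
  have h3 : ((3 : ℝ) / 4) ^ (3 * m) ≤ 1 / m := by
    rw [pow_mul]
    calc (((3 : ℝ) / 4) ^ 3) ^ m ≤ (1 / 2) ^ m :=
          pow_le_pow_left₀ (by norm_num) (by norm_num) _
      _ = 1 / 2 ^ m := by rw [one_div_pow]
      _ ≤ 1 / m := by
          gcongr
          exact_mod_cast Nat.lt_two_pow_self.le
  have h4 : ((2 : ℝ) ^ levels n) ^ 2 * (1 / 4) ^ levels n = 1 := by
    rw [← pow_mul, mul_comm (levels n), pow_mul, ← mul_pow]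
    norm_num
  calc (n : ℝ) ^ 2 * (3 / 4 : ℝ) ^ depth n m
      = (n : ℝ) ^ 2 * ((3 / 4 : ℝ) ^ (6 * levels n) * (3 / 4 : ℝ) ^ (3 * m) * (3 / 4 : ℝ) ^ 6) := by
        rw [depth, pow_add, pow_add]
    _ ≤ ((2 : ℝ) ^ levels n) ^ 2 * ((1 / 4 : ℝ) ^ levels n * (1 / m) * (1 / 4 : ℝ)) := by
        gcongr
        norm_num
    _ = (((2 : ℝ) ^ levels n) ^ 2 * (1 / 4 : ℝ) ^ levels n) * (1 / m * (1 / 4 : ℝ)) := by ring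
    _ = 1 / (4 * m) := by
        rw [h4]; field_simp

section

variable {n m W : ℕ} {G : Digraph (Fin n)} {B : Finset ℕ} {rank : ℕ → ℕ} {g : State → ℝ≥0∞}

theorem levels_pos (n : ℕ) : 0 < levels n := Nat.succ_pos _

theorem admissible (B : Finset ℕ) (hm : 0 < m) :
    Admissible n (sampleSize n m) (12 * (sampleSize n m * levels n)) (sampleRoot n m) B
      (1 / (4 * m * levels n)) (1 / (4 * m)) (if B = ∅ then 0 else 1) := by
  have hmr : (0 : ℝ) < m := by exact_mod_cast hm
  have hLr : (1 : ℝ) ≤ levels n := by exact_mod_cast levels_pos n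
  have hM : 0 < sampleRoot n m := by
    have := levels_pos n
    unfold sampleRoot; positivity
  have hMr : (sampleRoot n m : ℝ) = 32 * (levels n * m) := by unfold sampleRoot; push_cast; ring
  refine ⟨hM, (sq _).symm, by positivity, ?_, by positivity, ?_, ?_, ?_, ?_⟩
  · rw [hMr]
    apply le_of_eq
    field_simp
    norm_num
  · rw [hMr, show 1 / (4 * (m : ℝ)) * (32 * (levels n * m)) = 8 * levels n by field_simp; norm_num]
    linarith
  · split_ifs <;> norm_num
  · intro hB
    rw [if_neg hB]
  · exact fun hn x h0 h1 => one_sub_pow_le_div (Nat.mul_pos hM hM) h0 h1 hn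

/-- The expected loss of the program is at most `3 + 1 / m` for each bad vertex. -/
theorem costLE_program_three_add (hG : Represents G B rank) (hm : 0 < m)
    (hW : 13312 * (n + m + 1) ^ 5 < W)
    (hfinal : ∀ s X, MainInv n (sampleSize n m) (12 * (sampleSize n m * levels n)) B rank X s [] →
      CostLE W G g 0 ([], s) (n - X.card)) :
    CostLE W G g (timeBound n m) (init program n m) ((3 + 1 / m) * B.card) := by
  refine (costLE_program hG (admissible B hm) hW hfinal).mono le_rfl ?_
  have hmr : (0 : ℝ) < m := by exact_mod_cast hm
  have hLr : (1 : ℝ) ≤ levels n := by exact_mod_cast levels_pos n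
  obtain ⟨b, hb⟩ : ∃ b : ℝ, b = B.card := ⟨_, rfl⟩
  have hb0 : 0 ≤ b := by rw [hb]; positivity
  have hinv : 0 ≤ 1 / (m : ℝ) * b := by positivity
  split_ifs with hn hB
  · rw [← hb]; linarith
  · subst hB
    simp [activePotential]
  · have hb1 : 1 ≤ b := by
      rw [hb]; exact_mod_cast Finset.card_pos.2 (Finset.nonempty_of_ne_empty hB)
    unfold activePotential
    rw [← hb]
    have h1 := sq_mul_pow_depth_le n hm
    have h2 : 1 / (4 * m * levels n : ℝ) * b * (1 + Real.log n) ≤ 1 / (4 * m) * b := by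
      calc 1 / (4 * m * levels n : ℝ) * b * (1 + Real.log n)
          ≤ 1 / (4 * m * levels n : ℝ) * b * levels n := by
            gcongr; exact one_add_log_le_levels hn
        _ = _ := by field_simp
    have h3 : 1 / (4 * (m : ℝ)) * 1 ≤ 1 / (4 * m) * b := by gcongr
    have h4 : 1 / (m : ℝ) * b = 4 * (1 / (4 * m) * b) := by field_simp
    nlinarith

theorem timeBound_le (hn : 0 < n) (hm : 0 < m) :
    timeBound n m ≤ 490000 * (n * (levels n ^ 3 * m ^ 2)) := by
  obtain ⟨L, hL⟩ : ∃ L, L = levels n := ⟨_, rfl⟩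
  have hL1 : 1 ≤ L := hL ▸ levels_pos n
  have hclog : Nat.clog 2 n ≤ L := by rw [hL, levels]; omega
  have hQ : 1 ≤ L ^ 3 * m ^ 2 := Nat.one_le_iff_ne_zero.2 (by positivity)
  have hLQ : L ≤ L ^ 3 * m ^ 2 :=
    (Nat.le_self_pow (by norm_num) L).trans (Nat.le_mul_of_pos_right _ (by positivity))
  have hmQ : m ≤ L ^ 3 * m ^ 2 :=
    (Nat.le_self_pow (by norm_num) m).trans (Nat.le_mul_of_pos_left _ (by positivity))
  have hS : 12 * (sampleSize n m * L) + sampleSize n m ≤ 13312 * (L ^ 3 * m ^ 2) := by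
    have h1 : sampleSize n m ≤ sampleSize n m * L := Nat.le_mul_of_pos_right _ hL1
    have h2 : sampleSize n m * L = 1024 * (L ^ 3 * m ^ 2) := by
      unfold sampleSize sampleRoot
      rw [← hL]; ring
    omega
  have hD : depth n m ≤ 15 * (L ^ 3 * m ^ 2) := by
    unfold depth
    rw [← hL]; omega
  unfold timeBound
  rw [← hL]
  obtain ⟨Q, hQdef⟩ : ∃ Q, Q = L ^ 3 * m ^ 2 := ⟨_, rfl⟩
  rw [← hQdef] at hQ hLQ hmQ hS hD ⊢
  have hnQ : 1 * 1 ≤ n * Q := Nat.mul_le_mul hn hQ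
  have hnQ' : n * 1 ≤ n * Q := Nat.mul_le_mul le_rfl hQ
  calc _ ≤ n * (36 * (13312 * Q) + 100 * Q + 28 * (15 * Q)) + Q * (n * 60 + n * 9) + n * 4 + 30 := by
        gcongr <;> omega
    _ = 479821 * (n * Q) + n * 4 + 30 := by ring
    _ ≤ _ := by omega

theorem levels_le_log (hn : 2 ≤ n) : (levels n : ℝ) ≤ 5 * Real.log n := by
  have h1 : 2 ^ (Nat.clog 2 n - 1) < n := by
    have hpos : 0 < Nat.clog 2 n := Nat.clog_pos (by norm_num) hn
    exact (Nat.lt_clog_iff_pow_lt (by norm_num)).1 (by omega)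
  have hpos : 0 < Nat.clog 2 n := Nat.clog_pos (by norm_num) hn
  obtain ⟨k, hk⟩ : ∃ k, Nat.clog 2 n = k + 1 := ⟨Nat.clog 2 n - 1, by omega⟩
  rw [hk, Nat.add_sub_cancel] at h1
  have h2 : Real.log ((2 : ℝ) ^ k) ≤ Real.log n :=
    Real.log_le_log (by positivity) (by exact_mod_cast h1.le)
  rw [Real.log_pow] at h2
  have h3 : Real.log 2 ≤ Real.log n := Real.log_le_log (by norm_num) (by exact_mod_cast hn)
  have h4 := Real.log_two_gt_d9
  unfold levels
  rw [hk]
  push_cast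
  have h5 : (k : ℝ) * 0.6931471803 ≤ k * Real.log 2 := by gcongr
  linarith

end

/-! ### The output -/

theorem length_le_lcs {α : Type*} {xs ys l : List α} (hx : l.Sublist xs) (hy : l.Sublist ys) :
    l.length ≤ lcs xs ys :=
  le_csSup ⟨xs.length, fun _ ⟨_, h, _, hk⟩ => hk ▸ h.length_le⟩ ⟨l, hx, hy, rfl⟩

theorem lcs_le_length_right {α : Type*} (xs ys : List α) : lcs xs ys ≤ ys.length :=
  csSup_le ⟨0, [], List.nil_sublist _, List.nil_sublist _, rfl⟩
    fun _ ⟨_, _, h, hk⟩ => hk ▸ h.length_le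

/-- The position of a vertex in an ordering. -/
def rankOf {n : ℕ} (π : List (Fin n)) (x : ℕ) : ℕ := if h : x < n then π.idxOf ⟨x, h⟩ else 0

theorem rankOf_val {n : ℕ} (π : List (Fin n)) (v : Fin n) : rankOf π v = π.idxOf v := by
  simp [rankOf]

theorem pairwise_rankOf {n : ℕ} {π : List (Fin n)} (h : π.Nodup) :
    (π.map Fin.val).Pairwise fun x y => rankOf π x < rankOf π y := by
  rw [List.pairwise_map]
  simp only [rankOf_val]
  rw [List.pairwise_iff_getElem]
  intro i j hi hj hij
  rwa [h.idxOf_getElem, h.idxOf_getElem]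

/-- A set `X` of vertices that appear in the order of `π` in a sequence is part of a common
subsequence. -/
theorem card_le_lcs {n : ℕ} {π : List (Fin n)} (hπ : IsOrdering π) {ys : List ℕ}
    (hys : ys.Perm (List.range n)) {X : Finset ℕ} (hX : ∀ x ∈ X, x < n)
    (h : ys.Pairwise (Ordered (rankOf π) X)) : X.card ≤ lcs (π.map Fin.val) ys := by
  have hπs : ((π.map Fin.val).filter fun x => decide (x ∈ X)).Pairwise
      fun x y => rankOf π x < rankOf π y := (pairwise_rankOf hπ.1).sublist List.filter_sublist
  have hyss : (ys.filter fun x => decide (x ∈ X)).Pairwise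
      fun x y => rankOf π x < rankOf π y := by
    rw [List.pairwise_filter]
    exact h.imp fun hxy hx hy => hxy (by simpa using hx) (by simpa using hy)
  have hynd : ys.Nodup := hys.nodup_iff.2 List.nodup_range
  have hperm : ((π.map Fin.val).filter fun x => decide (x ∈ X)).Perm
      (ys.filter fun x => decide (x ∈ X)) := by
    refine (List.perm_ext_iff_of_nodup ((hπ.1.map Fin.val_injective).filter _)
      (hynd.filter _)).2 fun x => ?_
    simp only [List.mem_filter, decide_eq_true_eq, and_congr_left_iff]
    intro hx
    rw [hys.mem_iff, List.mem_range]
    exact ⟨fun _ => hX x hx, fun hxn => List.mem_map.2 ⟨⟨x, hxn⟩, hπ.2 _, rfl⟩⟩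
  have heq := hperm.eq_of_pairwise (fun a b _ _ h1 h2 => (lt_asymm h1 h2).elim) hπs hyss
  have hlen : X.card = (ys.filter fun x => decide (x ∈ X)).length := by
    rw [← List.toFinset_card_of_nodup (hynd.filter _)]
    congr 1
    ext x
    simp only [List.mem_toFinset, List.mem_filter, decide_eq_true_eq]
    exact ⟨fun hx => ⟨hys.mem_iff.2 (List.mem_range.2 (hX x hx)), hx⟩, fun hx => hx.2⟩
  rw [hlen]
  exact length_le_lcs (heq ▸ List.filter_sublist) List.filter_sublist

theorem exists_ordering_of_perm {n : ℕ} {ys : List ℕ} (h : ys.Perm (List.range n)) :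
    ∃ σ : List (Fin n), IsOrdering σ ∧ ys = σ.map Fin.val := by
  have hlt : ∀ x ∈ ys, x < n := fun x hx => List.mem_range.1 (h.mem_iff.1 hx)
  have hmap : (ys.pmap Fin.mk hlt).map Fin.val = ys := by
    rw [List.map_pmap]; simp
  refine ⟨ys.pmap Fin.mk hlt, ⟨?_, fun v => ?_⟩, hmap.symm⟩
  · refine List.Nodup.of_map Fin.val ?_
    rw [hmap]
    exact h.nodup_iff.2 List.nodup_range
  · exact List.mem_pmap.2 ⟨v, h.mem_iff.2 (List.mem_range.2 v.2), rfl⟩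

theorem sub_le_expect {α : Type*} (p : PMF α) (f : α → ℝ) {N ℓ : ℝ} (hf : ∀ a, 0 ≤ f a)
    (hfN : ∀ a, f a ≤ N) (hℓ : 0 ≤ ℓ)
    (h : ∑' a, p a * ENNReal.ofReal (N - f a) ≤ ENNReal.ofReal ℓ) : N - ℓ ≤ expect p f := by
  have hp : Summable fun a => (p a).toReal :=
    ENNReal.summable_toReal (by rw [p.tsum_coe]; exact ENNReal.one_ne_top)
  have hp1 : ∑' a, (p a).toReal = 1 := by
    rw [← ENNReal.tsum_toReal_eq fun a => p.apply_ne_top a, p.tsum_coe]; simp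
  have hs : Summable fun a => (p a).toReal * f a :=
    (hp.mul_right N).of_nonneg_of_le (fun a => mul_nonneg ENNReal.toReal_nonneg (hf a))
      fun a => mul_le_mul_of_nonneg_left (hfN a) ENNReal.toReal_nonneg
  have h1 : (∑' a, p a * ENNReal.ofReal (N - f a)).toReal = N - expect p f := by
    rw [ENNReal.tsum_toReal_eq fun a => ENNReal.mul_ne_top (p.apply_ne_top a) ENNReal.ofReal_ne_top]
    have : ∀ a, (p a * ENNReal.ofReal (N - f a)).toReal = (p a).toReal * N - (p a).toReal * f a := by
      intro a
      rw [ENNReal.toReal_mul, ENNReal.toReal_ofReal (by linarith [hfN a])]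
      ring
    simp_rw [this]
    rw [(hp.mul_right N).tsum_sub hs, tsum_mul_right, hp1, one_mul, expect]
  have h2 := ENNReal.toReal_le_of_le_ofReal hℓ h
  linarith

section

variable {n m W : ℕ} {G : Digraph (Fin n)}

open Classical in
/-- The number of vertices outside of a longest common subsequence of `π` and the output; infinite
if the output is not an ordering of the vertices. -/
noncomputable def outputCost (π : List (Fin n)) (c : Config) : ℝ≥0∞ :=
  if ∃ σ : List (Fin n), IsOrdering σ ∧ output n c = σ.map Fin.val then
    ENNReal.ofReal (n - lcs (π.map Fin.val) (output n c))
  else ⊤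

theorem output_eq_slice (n : ℕ) (c : Config) : output n c = slice (c.2.mem 0) 0 n := by
  rw [output, slice, List.Ico.zero_bot]

theorem length_output (n : ℕ) (c : Config) : (output n c).length = n := by simp [output]

theorem MainInv.costLE_outputCost {N F : ℕ} {π : List (Fin n)} (hπ : IsOrdering π) {B X : Finset ℕ}
    {s : State} (h : MainInv n N F B (rankOf π) X s []) :
    CostLE W G (fun s => outputCost π ([], s)) 0 ([], s) (n - X.card) := by
  have hlcs := card_le_lcs hπ h.perm (fun x hx => (h.survivors x hx).1)
    (slice_pairwise.2 fun i j _ hij hj => h.done i j (by rw [show s.reg 4 = n from h.segs]; omega) hij hj)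
  have hX : X.card ≤ n := by
    have := Finset.card_le_card fun x hx => Finset.mem_range.2 (h.survivors x hx).1
    rwa [Finset.card_range] at this
  refine ⟨sub_nonneg.2 (by exact_mod_cast hX), ?_⟩
  have hσ := exists_ordering_of_perm h.perm
  rw [cost, if_pos rfl]
  simp only
  rw [outputCost, output_eq_slice, if_pos hσ]
  refine ENNReal.ofReal_le_ofReal (sub_le_sub_left ?_ _)
  exact_mod_cast hlcs

theorem answer_ne_zero_iff {i j : ℕ} : answer G i j ≠ 0 ↔
    ∃ (hi : i < n) (hj : j < n), G.Adj ⟨i, hi⟩ ⟨j, hj⟩ := by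
  unfold answer
  split_ifs with h <;> simp [h]

theorem IsImperfectOn.represents (hG : IsTournament G) {π : List (Fin n)} {B : Finset (Fin n)}
    (h : IsImperfectOn G π B) : Represents G (B.image Fin.val) (rankOf π) := by
  have hB : ∀ x (hx : x < n), x ∉ B.image Fin.val → (⟨x, hx⟩ : Fin n) ∉ B := fun x hx h' hm =>
    h' (Finset.mem_image.2 ⟨_, hm, rfl⟩)
  have hadj : ∀ x (hx : x < n) y (hy : y < n), answer G x y ≠ 0 ↔ G.Adj ⟨x, hx⟩ ⟨y, hy⟩ :=
    fun x hx y hy => answer_ne_zero_iff.trans ⟨fun ⟨_, _, h⟩ => h, fun h => ⟨hx, hy, h⟩⟩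
  refine ⟨⟨fun x hx => ?_, fun x hx y hy hxy => ?_⟩, fun x hx y hy hxB hyB hxy => ?_⟩
  · rw [Finset.mem_range] at hx
    beta_reduce
    rw [hadj x hx x hx]
    exact hG.1 _
  · rw [Finset.mem_range] at hx hy
    beta_reduce
    rw [hadj x hx y hy, hadj y hy x hx]
    exact hG.2 _ _ (by simpa using hxy)
  · rw [hadj x hx y hy, h _ _ (hB x hx hxB) (hB y hy hyB) (by simpa using hxy), Before,
      ← rankOf_val, ← rankOf_val]

theorem tsum_run_le (hG : IsTournament G) {π : List (Fin n)} (hπ : IsOrdering π)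
    {B : Finset (Fin n)} (h : IsImperfectOn G π B) (hm : 0 < m)
    (hW : 13312 * (n + m + 1) ^ 5 < W) :
    ∑' c, run W G (timeBound n m) (init program n m) c *
      (if c.1 = [] then outputCost π c else ⊤) ≤ ENNReal.ofReal ((3 + 1 / m) * B.card) := by
  have hc := (costLE_program_three_add (h.represents hG) hm hW
    fun s X hI => hI.costLE_outputCost hπ (W := W) (G := G)).2
  rw [cost_eq_tsum_run, Finset.card_image_of_injective _ Fin.val_injective] at hc
  exact hc

/-- The program halts in time with an ordering as output. The bound for the expected cost shows this
when all vertices are regarded as bad. -/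
theorem halted_and_ordering (hG : IsTournament G) (hm : 0 < m)
    (hW : 13312 * (n + m + 1) ^ 5 < W) {c : Config}
    (hc : c ∈ (run W G (timeBound n m) (init program n m)).support) :
    Halted c ∧ ∃ σ : List (Fin n), IsOrdering σ ∧ output n c = σ.map Fin.val := by
  have hle := tsum_run_le hG (π := List.finRange n) (B := Finset.univ)
    ⟨List.nodup_finRange n, List.mem_finRange⟩ (fun u _ hu => (hu (Finset.mem_univ u)).elim) hm hW
  have hne := ENNReal.ne_top_of_tsum_ne_top (ne_top_of_le_ne_top ENNReal.ofReal_ne_top hle) c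
  have hfin : (if c.1 = [] then outputCost (List.finRange n) c else ⊤) ≠ ⊤ := by
    intro htop
    rw [htop] at hne
    exact hne (ENNReal.mul_top ((PMF.mem_support_iff _ _).1 hc))
  split_ifs at hfin with hh
  · refine ⟨hh, ?_⟩
    by_contra hσ
    exact hfin (by rw [outputCost, if_neg hσ])
  · exact (hfin rfl).elim

theorem sub_le_expect_lcs (hG : IsTournament G) {π : List (Fin n)} (hπ : IsOrdering π)
    {B : Finset (Fin n)} (h : IsImperfectOn G π B) (hm : 0 < m)
    (hW : 13312 * (n + m + 1) ^ 5 < W) :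
    (n : ℝ) - (3 + 1 / m) * B.card ≤ expect (run W G (timeBound n m) (init program n m))
      fun c => (lcs (π.map Fin.val) (output n c) : ℝ) := by
  refine sub_le_expect _ _ (fun c => Nat.cast_nonneg _) (fun c => ?_) (by positivity)
    (le_trans (ENNReal.tsum_le_tsum fun c => ?_) (tsum_run_le hG hπ h hm hW))
  · exact_mod_cast (lcs_le_length_right _ _).trans (length_output n c).le
  · refine mul_le_mul_right ?_ _
    unfold outputCost
    split_ifs
    · exact le_rfl
    · exact le_top
    · exact le_top

theorem timeBound_le_log {ε : ℝ} (hε : 0 < ε) (hn : 2 ≤ n) :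
    (timeBound n ⌈1 / ε⌉₊ : ℝ) ≤ 245000000 * (n * Real.log n ^ 3 / (min ε 1) ^ 2) := by
  have hmin : 0 < min ε 1 := lt_min hε one_pos
  have hm : (⌈1 / ε⌉₊ : ℝ) ≤ 2 / min ε 1 := by
    have h1 := (Nat.ceil_lt_add_one (show 0 ≤ 1 / ε by positivity)).le
    have h2 : 1 / ε ≤ 1 / min ε 1 := one_div_le_one_div_of_le hmin (min_le_left _ _)
    have h3 : 1 ≤ 1 / min ε 1 := by rw [le_div_iff₀ hmin]; simp
    calc (⌈1 / ε⌉₊ : ℝ) ≤ 1 / min ε 1 + 1 / min ε 1 := by linarith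
      _ = 2 / min ε 1 := by ring
  have hT := timeBound_le (show 0 < n by omega) (Nat.ceil_pos.2 (show 0 < 1 / ε by positivity))
  have hlog : 0 ≤ Real.log n := Real.log_natCast_nonneg n
  calc (timeBound n ⌈1 / ε⌉₊ : ℝ) ≤ 490000 * (n * ((levels n : ℝ) ^ 3 * (⌈1 / ε⌉₊ : ℝ) ^ 2)) := by
        exact_mod_cast hT
    _ ≤ 490000 * (n * ((5 * Real.log n) ^ 3 * (2 / min ε 1) ^ 2)) := by
        gcongr
        exact levels_le_log hn
    _ = _ := by ring

theorem wordSize_lt {z : ℕ} (hz : 2 ≤ z) (h : z ^ 20 ≤ W) : 13312 * z ^ 5 < W := by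
  have h1 : 2 ^ 15 ≤ z ^ 15 := Nat.pow_le_pow_left hz 15
  have h2 : 0 < z ^ 5 := by positivity
  calc 13312 * z ^ 5 < 2 ^ 15 * z ^ 5 := Nat.mul_lt_mul_of_pos_right (by norm_num) h2
    _ ≤ z ^ 15 * z ^ 5 := Nat.mul_le_mul_right _ h1
    _ = z ^ 20 := by rw [← pow_add]
    _ ≤ W := h

end

end RobustSort

theorem theorem1 :
    ∃ (P : Cmd) (κ : ℕ) (C : ℝ), ∀ (ε : ℝ), 0 < ε → ∀ (n : ℕ) (G : Digraph (Fin n)),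
      IsTournament G → ∀ w : ℕ, (n + ⌈1 / ε⌉₊ + 1) ^ κ ≤ 2 ^ w →
        ∃ T : ℕ,
          (2 ≤ n → (T : ℝ) ≤ C * (n * Real.log n ^ 3 / (min ε 1) ^ 2)) ∧
          (∀ c ∈ (run (2 ^ w) G T (init P n ⌈1 / ε⌉₊)).support,
            Halted c ∧
            (2 ≤ n → (c.2.queries : ℝ) ≤ C * (n * Real.log n ^ 3 / (min ε 1) ^ 2)) ∧
            ∃ σ : List (Fin n), IsOrdering σ ∧ output n c = σ.map Fin.val) ∧
          ∀ (π : List (Fin n)) (b : ℕ), IsOrdering π → IsImperfect G π b →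
            (n : ℝ) - (3 + ε) * b ≤
              expect (run (2 ^ w) G T (init P n ⌈1 / ε⌉₊))
                (fun c => (lcs (π.map Fin.val) (output n c) : ℝ)) := by
  refine ⟨program, 20, 245000000, fun ε hε n G hG w hw => ⟨timeBound n ⌈1 / ε⌉₊,
    timeBound_le_log hε, fun c hc => ?_, fun π b hπ hb => ?_⟩⟩
  all_goals
    have hm : 0 < ⌈1 / ε⌉₊ := Nat.ceil_pos.2 (by positivity)
    have hW := wordSize_lt (by omega) hw
  · obtain ⟨hh, hσ⟩ := halted_and_ordering hG hm hW hc
    refine ⟨hh, fun hn => le_trans ?_ (timeBound_le_log hε hn), hσ⟩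
    have hq := queries_le_of_mem_support_run hc
    simp only [init, zero_add] at hq
    exact_mod_cast hq
  · obtain ⟨B, hBb, hB⟩ := hb
    refine le_trans ?_ (sub_le_expect_lcs hG hπ hB hm hW)
    have h1 : 1 / (⌈1 / ε⌉₊ : ℝ) ≤ ε := by
      rw [one_div_le (by exact_mod_cast hm) hε]
      exact Nat.le_ceil _
    have h2 : (B.card : ℝ) ≤ b := by exact_mod_cast hBb
    gcongr
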